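/- Setting. For a real function $t$ write $t^*(\omega)=\int_{\mathbb R} e^{i\omega x}t(x)\,dx$. Let $Y_1,\dots,Y_n$ be i.i.d. copies of $Y=\theta+\xi$, where $\theta$ and $\xi$ are independent with probability densities $f$ (unknown) and $g$ (known). Let $q=f*g$ be the density of $Y$. Fix an integer $m\ge 0$ and real weights $\psi_1,\psi_2$, and consider $$\Phi=\int_0^\infty \psi_1(\omega)\,\frac{d^m}{d\omega^m}\mathrm{Re}\,f^*(\omega)\,d\omega+\int_0^\infty \psi_2(\omega)\,\frac{d^m}{d\omega^m}\mathrm{Im}\,f^*(\omega)\,d\omega ,$$ where both integrals are assumed to converge absolutely. Estimator. Put $\hat v_{j1}(\omega)=n^{-1}\sum_l Y_l^j\cos(\omega Y_l)$ and $\hat v_{j2}(\omega)=n^{-1}\sum_l Y_l^j\sin(\omega Y_l)$. For even $j$ let $\hat u_{j1}=(-1)^{j/2}\hat v_{j1}$ and $\hat u_{j2}=(-1)^{j/2}\hat v_{j2}$. For odd $j$ let $\hat u_{j1}=(-1)^{(j+1)/2}\hat v_{j2}$ and $\hat u_{j2}=(-1)^{(j-1)/2}\hat v_{j1}$. These are unbiased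 estimators of $\mathrm{Re}\,(q^*)^{(j)}$ and $\mathrm{Im}\,(q^*)^{(j)}$. With $r(\omega)=1/g^*(\omega)$ and $0<h\le 1$, let $\hat\Phi_h=\hat\Phi_1+\hat F_m+\hat\Phi_{20,h}$, where $$\hat\Phi_1=\sum_{j=0}^m\binom mj\int_0^1 r^{(m-j)}\,[\psi_1\hat u_{j1}+\psi_2\hat u_{j2}]\,d\omega,$$ $$\hat F_m=\sum_{k=1}^m\sum_{j=0}^{m-k}(-1)^k\binom{m-k}{j}\Big[\psi_1^{(k-1)}r^{(m-k-j)}\hat u_{j1}+\psi_2^{(k-1)}r^{(m-k-j)}\hat u_{j2}\Big]_{\omega=1},$$ $$\hat\Phi_{20,h}=(-1)^m\int_1^{1/h}\big[\psi_1^{(m)}\hat u_{01}+\psi_2^{(m)}\hat u_{02}\big]\,r\,d\omega .$$ Let $\sigma_{jk}^2(\omega)=n\,\mathrm{Var}(\hat u_{jk}(\omega))$; this does not depend on $n$. Assumptions. (i) $\int x^{2m}g(x)\,dx<\infty$, $\int x^{2m}f(x)\,dx<\infty$, and $g$ is bounded. (ii) $g^*$ is real-valued, and there are constants $C_{g1}>0$,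 $C_{g2}$ and $\alpha,\beta,\gamma\ge0$, with $\alpha>0$ and $\beta=0$ if $\gamma=0$, such that $C_{g1}(\omega^2+1)^{-\alpha/2}e^{-\gamma|\omega|^\beta}\le|g^*(\omega)|\le C_{g2}(\omega^2+1)^{-\alpha/2}e^{-\gamma|\omega|^\beta}$ for all $\omega\in\mathbb R$. (iii) For some $C_g$ and some $\tau\ge0$, with $\tau=0$ if $\gamma=0$, $|(g^*)^{(j)}(\omega)/g^*(\omega)|\le C_g(|\omega|+1)^{j\tau}$ for $j=0,\dots,m$ and all $\omega\in\mathbb R$. (iv) $\psi_1,\psi_2$ are measurable and $m$ times differentiable on $[1,\infty)$ (one-sided at $1$). For some $C_\psi$ and $a_m,b,d\ge0$, with $b=0$ if $d=0$, $|\psi_k^{(j)}(\omega)|\le C_\psi(\omega^2+1)^{-a_m(j+1)/2}e^{-d\omega^b}$ for $\omega\ge1$, $j=0,\dots,m$, $k=1,2$. (v) For a constant $C_\sigma$, $\int_0^1 [r^{(m-j)}(\omega)]^2\,|\psi_k(\omega)|^2\,\sigma_{jk}^2(\omega)\,d\omega\le C_\sigma$ for $j=0,\dots,m$, $k=1,2$.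 Let $s\ge0$ and $B\in\mathbb R$. Suppose that either $f\in\Xi_s(B)=\{f:\sup_\omega|f^*(\omega)|(|\omega|^s+1)\le B\}$, in which case set $A=(m+1)a_m+s+b-1$, or $f\in\Omega_s(B)=\{f:\int|f^*(\omega)|^2(\omega^2+1)^s\,d\omega\le B^2\}$, in which case set $A=(m+1)a_m+s+(b-1)/2$. Conclusion. The integrals in $\hat\Phi_h$ converge absolutely, and there is a constant $C>0$ independent of $n$ and $h$ such that, for all $n\ge1$ and $0<h\le1$, $$\mathbb E(\hat\Phi_h-\Phi)^2\le C\Big[h^{2A}e^{-2dh^{-b}}+n^{-1}\int_1^{1/h}(\omega^2+1)^{\alpha-(m+1)a_m}e^{-2d\omega^b+2\gamma\omega^\beta}\,d\omega\Big].$$ Moreover, if $b>0$ or $A>0$, then for every $M$ the constant $C$ can be chosen the same for all $f$ in the class (for fixed $g,\psi_1,\psi_2$ and fixed constants $C_\sigma,s,B$) that satisfy the assumptions and $\int x^{2m}f(x)\,dx\le M$. -/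

import Mathlib

open MeasureTheory ProbabilityTheory Set

universe u

noncomputable section

namespace InvDeconv

/-- Fourier transform `t*(ω) = ∫ exp(i ω x) t(x) dx` of a real function. -/
def fourier (t : ℝ → ℝ) (ω : ℝ) : ℂ :=
  ∫ x : ℝ, Complex.exp (Complex.I * (ω : ℂ) * (x : ℂ)) * (t x : ℂ)

/-- `t` is a probability density on `ℝ`. -/
structure IsPdf (t : ℝ → ℝ) : Prop where
  measurable : Measurable t
  nonneg : ∀ x, 0 ≤ t x
  lintegral_eq_one : ∫⁻ x, ENNReal.ofReal (t x) = 1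

/-- The law on `ℝ` with density `t`. -/
def law (t : ℝ → ℝ) : Measure ℝ := volume.withDensity (fun x => ENNReal.ofReal (t x))

/-- The law of one observation `Y = θ + ξ`, where `θ` (density `f`) and `ξ` (density `g`) are
independent. -/
def obsLaw (f g : ℝ → ℝ) : Measure ℝ := Measure.conv (law f) (law g)

/-- `Y₁, …, Yₙ` are independent observations from the deconvolution model. -/
structure IsSample (f g : ℝ → ℝ) {n : ℕ} {Ω : Type u} [MeasurableSpace Ω] (P : Measure Ω)
    (Y : Fin n → Ω → ℝ) : Prop where
  measurable : ∀ i, Measurable (Y i)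
  indep : iIndepFun Y P
  law_eq : ∀ i, P.map (Y i) = obsLaw f g

/-- The moment of order `k` of `t` is finite (used for even `k`). -/
def HasMoment (k : ℕ) (t : ℝ → ℝ) : Prop := Integrable (fun x : ℝ => x ^ k * t x)

/-- The moment `∫ x^k t(x) dx`. -/
def moment (k : ℕ) (t : ℝ → ℝ) : ℝ := ∫ x : ℝ, x ^ k * t x

/-- The Sobolev ball `Ω_s(B)`. -/
def SobolevBall (s B : ℝ) : Set (ℝ → ℝ) :=
  {t | ∫⁻ ω : ℝ, ENNReal.ofReal (‖fourier t ω‖ ^ 2 * (ω ^ 2 + 1) ^ s) ≤ ENNReal.ofReal (B ^ 2)}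

/-- The class `Ξ_s(B)`. -/
def DecayBall (s B : ℝ) : Set (ℝ → ℝ) :=
  {t | ∀ ω : ℝ, ‖fourier t ω‖ * (|ω| ^ s + 1) ≤ B}

/-- The two-sided bounds on `|g*|`. -/
structure AssumptionA1 (g : ℝ → ℝ) (α β γ C₁ C₂ : ℝ) : Prop where
  α_nonneg : 0 ≤ α
  β_nonneg : 0 ≤ β
  γ_nonneg : 0 ≤ γ
  C₁_pos : 0 < C₁
  of_γ_eq_zero : γ = 0 → 0 < α ∧ β = 0
  lower : ∀ ω : ℝ, C₁ * (ω ^ 2 + 1) ^ (-α / 2) * Real.exp (-γ * |ω| ^ β) ≤ ‖fourier g ω‖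
  upper : ∀ ω : ℝ, ‖fourier g ω‖ ≤ C₂ * (ω ^ 2 + 1) ^ (-α / 2) * Real.exp (-γ * |ω| ^ β)

/-- The derivatives `(d/dω)^k (1 / g*(ω))`, for real-valued `g*`. -/
def invDeriv (g : ℝ → ℝ) (k : ℕ) (ω : ℝ) : ℝ :=
  iteratedDeriv k (fun w : ℝ => 1 / (fourier g w).re) ω

/-- The derivatives of a weight on `[1, ∞)`, one-sided at `1`. -/
def wDeriv (k : ℕ) (ψ : ℝ → ℝ) (ω : ℝ) : ℝ := iteratedDerivWithin k ψ (Ici 1) ω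

/-- `ψ` is measurable and, on `[1, ∞)`, it is `m` times differentiable with
`|ψ^(j)(ω)| ≤ C (ω² + 1)^(-a (j+1)/2) exp(-d ω^b)` for `j ≤ m`. -/
structure IsWeight (m : ℕ) (a b d C : ℝ) (ψ : ℝ → ℝ) : Prop where
  measurable : Measurable ψ
  differentiable : ∀ j < m, DifferentiableOn ℝ (wDeriv j ψ) (Ici 1)
  bound : ∀ j ≤ m, ∀ ω : ℝ, 1 ≤ ω →
    |wDeriv j ψ ω| ≤ C * (ω ^ 2 + 1) ^ (-(a * ((j : ℝ) + 1)) / 2) * Real.exp (-d * ω ^ b)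

/-- The functional
`Φ = ∫₀^∞ ψ₁ (d/dω)^m Re f* dω + ∫₀^∞ ψ₂ (d/dω)^m Im f* dω`. -/
def Phi (m : ℕ) (ψ₁ ψ₂ f : ℝ → ℝ) : ℝ :=
  (∫ ω in Ioi (0 : ℝ), ψ₁ ω * iteratedDeriv m (fun w => (fourier f w).re) ω) +
    ∫ ω in Ioi (0 : ℝ), ψ₂ ω * iteratedDeriv m (fun w => (fourier f w).im) ω

/-- The contribution of a single observation `y` to the estimator of `Re (d/dω)^j q*`. -/
def uRe (j : ℕ) (ω y : ℝ) : ℝ :=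
  if Even j then (-1) ^ (j / 2) * (y ^ j * Real.cos (ω * y))
  else (-1) ^ ((j + 1) / 2) * (y ^ j * Real.sin (ω * y))

/-- The contribution of a single observation `y` to the estimator of `Im (d/dω)^j q*`. -/
def uIm (j : ℕ) (ω y : ℝ) : ℝ :=
  if Even j then (-1) ^ (j / 2) * (y ^ j * Real.sin (ω * y))
  else (-1) ^ ((j - 1) / 2) * (y ^ j * Real.cos (ω * y))

/-- The estimator of `Re (d/dω)^j q*(ω)` from the sample `y`. -/
def uHatRe {n : ℕ} (y : Fin n → ℝ) (j : ℕ) (ω : ℝ) : ℝ := (n : ℝ)⁻¹ * ∑ l, uRe j ω (y l)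

/-- The estimator of `Im (d/dω)^j q*(ω)` from the sample `y`. -/
def uHatIm {n : ℕ} (y : Fin n → ℝ) (j : ℕ) (ω : ℝ) : ℝ := (n : ℝ)⁻¹ * ∑ l, uIm j ω (y l)

/-- `n` times the variance of the estimator of `Re (d/dω)^j q*(ω)`; as the sample is independent
and identically distributed, this is the variance of the contribution of one observation. -/
def sigmaSqRe (f g : ℝ → ℝ) (j : ℕ) (ω : ℝ) : ℝ := variance (uRe j ω) (obsLaw f g)

/-- `n` times the variance of the estimator of `Im (d/dω)^j q*(ω)`. -/
def sigmaSqIm (f g : ℝ → ℝ) (j : ℕ) (ω : ℝ) : ℝ := variance (uIm j ω) (obsLaw f g)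

/-- The integrand of the `j`-th term of the estimator of the part of `Φ` over `[0, 1]`. -/
def integrand1 (m : ℕ) (g ψ₁ ψ₂ : ℝ → ℝ) {n : ℕ} (y : Fin n → ℝ) (j : ℕ) (ω : ℝ) : ℝ :=
  invDeriv g (m - j) ω * (ψ₁ ω * uHatRe y j ω + ψ₂ ω * uHatIm y j ω)

/-- The estimator of the part of `Φ` over `[0, 1]`. -/
def PhiHat1 (m : ℕ) (g ψ₁ ψ₂ : ℝ → ℝ) {n : ℕ} (y : Fin n → ℝ) : ℝ :=
  ∑ j ∈ Finset.range (m + 1),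
    (m.choose j : ℝ) * ∫ ω in (0 : ℝ)..1, integrand1 m g ψ₁ ψ₂ y j ω

/-- `A_{m,j,k}(ω) = ψ^(k-1)(ω) (d/dω)^(m-k-j) (1 / g*(ω))`. -/
def coefA (m j k : ℕ) (g ψ : ℝ → ℝ) (ω : ℝ) : ℝ := wDeriv (k - 1) ψ ω * invDeriv g (m - k - j) ω

/-- The estimator of the boundary term at `ω = 1`. -/
def FHat (m : ℕ) (g ψ₁ ψ₂ : ℝ → ℝ) {n : ℕ} (y : Fin n → ℝ) : ℝ :=
  ∑ k ∈ Finset.Icc 1 m, ∑ j ∈ Finset.range (m - k + 1),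
    (-1) ^ k * ((m - k).choose j : ℝ) *
      (coefA m j k g ψ₁ 1 * uHatRe y j 1 + coefA m j k g ψ₂ 1 * uHatIm y j 1)

/-- The integrand of the estimator of the remaining integral over `(1, ∞)`. -/
def integrand2 (m : ℕ) (g ψ₁ ψ₂ : ℝ → ℝ) {n : ℕ} (y : Fin n → ℝ) (ω : ℝ) : ℝ :=
  (wDeriv m ψ₁ ω * uHatRe y 0 ω + wDeriv m ψ₂ ω * uHatIm y 0 ω) * (1 / (fourier g ω).re)

/-- The truncated estimator of the remaining integral over `(1, ∞)`. -/
def PhiHat20 (m : ℕ) (g ψ₁ ψ₂ : ℝ → ℝ) (h : ℝ) {n : ℕ} (y : Fin n → ℝ) : ℝ :=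
  (-1) ^ m * ∫ ω in (1 : ℝ)..(1 / h), integrand2 m g ψ₁ ψ₂ y ω

/-- The estimator `Φ̂_h` of `Φ`. -/
def PhiHat (m : ℕ) (g ψ₁ ψ₂ : ℝ → ℝ) (h : ℝ) {n : ℕ} (y : Fin n → ℝ) : ℝ :=
  PhiHat1 m g ψ₁ ψ₂ y + FHat m g ψ₁ ψ₂ y + PhiHat20 m g ψ₁ ψ₂ h y

/-- The conditions on the mixing density `f`: finite moment of order `2m`, absolute convergence of
the two integrals in `Φ`, and the variance conditions on `[0, 1]` with constant `Cσ`. -/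
structure Admissible (m : ℕ) (g ψ₁ ψ₂ : ℝ → ℝ) (Cσ : ℝ) (f : ℝ → ℝ) : Prop where
  pdf : IsPdf f
  hasMoment : HasMoment (2 * m) f
  integrable_re : IntegrableOn
    (fun ω => ψ₁ ω * iteratedDeriv m (fun w => (fourier f w).re) ω) (Ioi 0)
  integrable_im : IntegrableOn
    (fun ω => ψ₂ ω * iteratedDeriv m (fun w => (fourier f w).im) ω) (Ioi 0)
  variance_re : ∀ j ≤ m, ∫⁻ ω in Icc (0 : ℝ) 1, ENNReal.ofReal
    ((invDeriv g (m - j) ω) ^ 2 * |ψ₁ ω| ^ 2 * sigmaSqRe f g j ω) ≤ ENNReal.ofReal Cσ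
  variance_im : ∀ j ≤ m, ∫⁻ ω in Icc (0 : ℝ) 1, ENNReal.ofReal
    ((invDeriv g (m - j) ω) ^ 2 * |ψ₂ ω| ^ 2 * sigmaSqIm f g j ω) ≤ ENNReal.ofReal Cσ

/-- The rate
`h^(2A) exp(-2 d h^(-b)) + n⁻¹ ∫₁^{1/h} (ω²+1)^(α-(m+1)a) exp(-2 d ω^b + 2 γ ω^β) dω`. -/
def rate (m : ℕ) (α β γ a b d A : ℝ) (n : ℕ) (h : ℝ) : ℝ :=
  h ^ (2 * A) * Real.exp (-2 * d * h ^ (-b)) +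
    (n : ℝ)⁻¹ * ∫ ω in (1 : ℝ)..(1 / h),
      (ω ^ 2 + 1) ^ (α - ((m : ℝ) + 1) * a) * Real.exp (-2 * d * ω ^ b + 2 * γ * ω ^ β)

/-- For every sample size `n ≥ 1` and every `0 < h ≤ 1`, the integrals in the estimator converge
absolutely and its mean squared error is at most `R n h`. -/
def RiskBound (m : ℕ) (g ψ₁ ψ₂ f : ℝ → ℝ) (R : ℕ → ℝ → ℝ) : Prop :=
  ∀ (n : ℕ), 1 ≤ n → ∀ (h : ℝ), 0 < h → h ≤ 1 →
    (∀ y : Fin n → ℝ,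
      (∀ j ≤ m, IntervalIntegrable (integrand1 m g ψ₁ ψ₂ y j) volume 0 1) ∧
        IntervalIntegrable (integrand2 m g ψ₁ ψ₂ y) volume 1 (1 / h)) ∧
    ∀ (Ω : Type u) [MeasurableSpace Ω] (P : Measure Ω) [IsProbabilityMeasure P]
      (Y : Fin n → Ω → ℝ), IsSample f g P Y →
      ∫⁻ x, ENNReal.ofReal ((PhiHat m g ψ₁ ψ₂ h (fun i => Y i x) - Phi m ψ₁ ψ₂ f) ^ 2) ∂P ≤
        ENNReal.ofReal (R n h)

end InvDeconv

end

open InvDeconv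

namespace InvDeconv

/-! ### The law of one observation: moments, characteristic function, bounded density. -/

section Model

/-! The estimator is an average of i.i.d. terms `Z(Y_l)`, so its mean squared error is `n⁻¹ Var Z`
plus the squared bias (`IsSample.lintegral_sq_mean_sub_le`). Everything rests on identifying the
mean of `Z` and bounding its variance.

Mean. Since `q* = f* g*` with `g*` real and nonvanishing, the real and imaginary parts of `f*` are
those of `q*` times `1 / g*`, and Leibniz' rule expresses derivatives of `f*` through those of `q*`,
which are the means of `uRe` and `uIm`. On `[1, T]` the functional is integrated by parts `m` times;
as `T → ∞` the boundary terms at `T` vanish by the Riemann–Lebesgue lemma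
(`Admissible.tendsto_Phi`). Hence the mean of `Z` is `Φ` with the last integral cut at `1/h`, and
the bias is the missing tail. It is bounded by the pointwise decay of `f*` (`exists_bias_decayBall`)
or by Cauchy–Schwarz (`exists_bias_sobolevBall`).

Variance. The part over `[0, 1]` is controlled by Jensen and the assumed variance integrals
(`meanVar_setIntegral`), the boundary part by the moments. The part over `[1, 1/h]` needs more than
the triangle inequality: `q` is bounded because `g` is, so Plancherel bounds the second moment by
the integral of the squared coefficients (`lintegral_sq_trig_integral_le`), which is the integral in
the rate. The two constant variances are absorbed because `n⁻¹` is at most a multiple of the rate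
(`exists_inv_le_rate`).

Integrability on `[0, 1]` is not assumed separately. The variance conditions give it once the
variances are bounded below: a nonconstant analytic function of `Y` is nondegenerate, uniformly over
compact sets of frequencies (`exists_pos_le_lintegral_sq_sub`). Sine terms degenerate like `ω²`,
which their own factor `ω` compensates. The cosine term with `j = 0` degenerates at `ω = 0`; there
integrability comes from the absolute convergence of `Φ` (`ErrorModel.integrableOn_re_zero`).

If `b = 0` and `A ≤ 0`, no tail rate is needed: the bias is bounded and its claimed bound stays away
from zero. -/

theorem isProbabilityMeasure_law {t : ℝ → ℝ} (ht : IsPdf t) : IsProbabilityMeasure (law t) :=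
  ⟨by rw [law, withDensity_apply _ MeasurableSet.univ, Measure.restrict_univ, ht.lintegral_eq_one]⟩

theorem integral_law {E : Type*} [NormedAddCommGroup E] [NormedSpace ℝ E]
    {t : ℝ → ℝ} (ht : IsPdf t) (φ : ℝ → E) : ∫ x, φ x ∂(law t) = ∫ x, t x • φ x := by
  rw [law, integral_withDensity_eq_integral_toReal_smul ht.measurable.ennreal_ofReal
    (by simp)]
  simp_rw [ENNReal.toReal_ofReal (ht.nonneg _)]

theorem integrable_law_iff {t : ℝ → ℝ} (ht : IsPdf t) (φ : ℝ → ℝ) :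
    Integrable φ (law t) ↔ Integrable (fun x => φ x * t x) := by
  rw [law, integrable_withDensity_iff ht.measurable.ennreal_ofReal (by simp)]
  simp_rw [ENNReal.toReal_ofReal (ht.nonneg _)]

theorem fourier_eq_charFun {t : ℝ → ℝ} (ht : IsPdf t) : fourier t = charFun (law t) := by
  ext ω
  rw [charFun_apply_real, integral_law ht, fourier]
  refine integral_congr_ae (.of_forall fun x => ?_)
  simp only [Complex.real_smul]
  rw [mul_comm]
  congr 2
  ring

theorem memLp_id_of_integrable_pow {k : ℕ} (hk : Even k) {μ : Measure ℝ} [IsFiniteMeasure μ]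
    (h : Integrable (fun x => x ^ k) μ) : MemLp id k μ := by
  rcases Nat.eq_zero_or_pos k with rfl | hk0
  · simpa using by fun_prop
  · rw [← integrable_norm_rpow_iff (by fun_prop) (by simpa using hk0.ne') (by simp)]
    refine h.congr (.of_forall fun x => ?_)
    simp [hk.pow_abs]

theorem memLp_id_law {m : ℕ} {t : ℝ → ℝ} (ht : IsPdf t) (hm : HasMoment (2 * m) t) :
    MemLp id (2 * m : ℕ) (law t) := by
  have := isProbabilityMeasure_law ht
  exact memLp_id_of_integrable_pow (even_two_mul m) ((integrable_law_iff ht _).2 hm)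

theorem integral_pow_law {t : ℝ → ℝ} (ht : IsPdf t) (k : ℕ) :
    ∫ x, x ^ k ∂(law t) = moment k t := by
  rw [integral_law ht, moment]
  simp_rw [smul_eq_mul, mul_comm]

theorem integrable_pow_of_memLp {n j : ℕ} {μ : Measure ℝ} [IsFiniteMeasure μ]
    (h : MemLp id n μ) (hj : j ≤ n) : Integrable (fun x => x ^ j) μ := by
  have h' : MemLp id j μ := h.mono_exponent (by simpa using hj)
  refine h'.integrable_norm_pow'.mono (by fun_prop) (.of_forall fun x => by simp)

theorem integrable_abs_pow_of_memLp {n j : ℕ} {μ : Measure ℝ} [IsFiniteMeasure μ]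
    (h : MemLp id n μ) (hj : j ≤ n) : Integrable (fun x => |x| ^ j) μ := by
  simpa [abs_pow] using (integrable_pow_of_memLp h hj).abs

variable {f g : ℝ → ℝ}

theorem isProbabilityMeasure_obsLaw (hf : IsPdf f) (hg : IsPdf g) :
    IsProbabilityMeasure (obsLaw f g) := by
  have := isProbabilityMeasure_law hf
  have := isProbabilityMeasure_law hg
  unfold obsLaw
  infer_instance

theorem charFun_obsLaw (hf : IsPdf f) (hg : IsPdf g) (ω : ℝ) :
    charFun (obsLaw f g) ω = fourier f ω * fourier g ω := by
  have := isProbabilityMeasure_law hf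
  have := isProbabilityMeasure_law hg
  rw [obsLaw, charFun_conv, fourier_eq_charFun hf, fourier_eq_charFun hg]

theorem memLp_id_obsLaw (hf : IsPdf f) (hg : IsPdf g) {m : ℕ} (hfm : HasMoment (2 * m) f)
    (hgm : HasMoment (2 * m) g) : MemLp id (2 * m : ℕ) (obsLaw f g) := by
  have := isProbabilityMeasure_law hf
  have := isProbabilityMeasure_law hg
  rw [obsLaw, Measure.conv, memLp_map_measure_iff (by fun_prop) (by fun_prop)]
  have h1 := (memLp_id_law hf hfm).comp_measurePreserving
    (measurePreserving_fst (μ := law f) (ν := law g))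
  have h2 := (memLp_id_law hg hgm).comp_measurePreserving
    (measurePreserving_snd (μ := law f) (ν := law g))
  exact h1.add h2

/-- Convexity of the even power, integrated over the product law. Through this bound the constants
depend on `f` only via its moment. -/
theorem integral_pow_obsLaw_le (hf : IsPdf f) (hg : IsPdf g) {m : ℕ}
    (hfm : HasMoment (2 * m) f) (hgm : HasMoment (2 * m) g) :
    ∫ y, y ^ (2 * m) ∂(obsLaw f g) ≤
      2 ^ (2 * m - 1) * (moment (2 * m) f + moment (2 * m) g) := by
  have := isProbabilityMeasure_law hf
  have := isProbabilityMeasure_law hg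
  have := isProbabilityMeasure_obsLaw hf hg
  have hq := integrable_pow_of_memLp (memLp_id_obsLaw hf hg hfm hgm) le_rfl
  have hi := hq
  rw [obsLaw, Measure.conv, integrable_map_measure (by fun_prop) (by fun_prop)] at hi
  have h1 := (integrable_pow_of_memLp (memLp_id_law hf hfm) le_rfl).comp_fst (law g)
  have h2 := (integrable_pow_of_memLp (memLp_id_law hg hgm) le_rfl).comp_snd (law f)
  rw [obsLaw, Measure.conv, integral_map (by fun_prop) (by fun_prop)]
  calc ∫ p : ℝ × ℝ, (p.1 + p.2) ^ (2 * m) ∂((law f).prod (law g))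
      ≤ ∫ p : ℝ × ℝ, 2 ^ (2 * m - 1) * (p.1 ^ (2 * m) + p.2 ^ (2 * m)) ∂((law f).prod (law g)) :=
        integral_mono hi ((h1.add h2).const_mul _) fun p => (even_two_mul m).add_pow_le
    _ = _ := by
        rw [integral_const_mul, integral_add h1 h2,
          integral_fun_fst (f := fun x : ℝ => x ^ (2 * m)),
          integral_fun_snd (f := fun x : ℝ => x ^ (2 * m)), integral_pow_law hf,
          integral_pow_law hg]
        simp

/-- Given `θ`, the density of `Y` is a translate of `g`, hence at most `K`; averaging over `θ`
preserves this by translation invariance. Domination of measures is all that the Plancherel step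
uses. -/
theorem obsLaw_le (hf : IsPdf f) (hg : IsPdf g) {K : ℝ} (hK : ∀ᵐ x ∂volume, g x ≤ K) :
    obsLaw f g ≤ ENNReal.ofReal K • (volume : Measure ℝ) := by
  have := isProbabilityMeasure_law hf
  have := isProbabilityMeasure_law hg
  have hlaw : law g ≤ ENNReal.ofReal K • (volume : Measure ℝ) := by
    rw [law, ← withDensity_const]
    exact withDensity_mono (hK.mono fun x hx => ENNReal.ofReal_le_ofReal hx)
  refine Measure.le_iff.2 fun S hS => ?_
  rw [← lintegral_indicator_one hS, obsLaw,
    Measure.lintegral_conv (measurable_one.indicator hS)]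
  calc ∫⁻ x, ∫⁻ y, S.indicator 1 (x + y) ∂(law g) ∂(law f)
      ≤ ∫⁻ x, ENNReal.ofReal K * volume S ∂(law f) := by
        refine lintegral_mono fun x => ?_
        calc ∫⁻ y, S.indicator 1 (x + y) ∂(law g)
            ≤ ∫⁻ y, S.indicator 1 (x + y) ∂(ENNReal.ofReal K • (volume : Measure ℝ)) :=
              lintegral_mono' hlaw le_rfl
          _ = _ := by
              rw [lintegral_smul_measure, lintegral_add_left_eq_self
                (f := S.indicator (1 : ℝ → ENNReal)), lintegral_indicator_one hS, smul_eq_mul]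
    _ = _ := by simp

theorem obsLaw_absolutelyContinuous (hf : IsPdf f) (hg : IsPdf g) {K : ℝ}
    (hK : ∀ᵐ x ∂volume, g x ≤ K) : obsLaw f g ≪ volume :=
  (Measure.absolutelyContinuous_of_le (obsLaw_le hf hg hK)).trans
    (Measure.smul_absolutelyContinuous)

end Model

/-! ### Trigonometric contributions as derivatives of the characteristic function. -/

section Trig

theorem abs_uRe_le (j : ℕ) (ω y : ℝ) : |uRe j ω y| ≤ |y| ^ j := by
  unfold uRe
  split_ifs <;> simp only [abs_mul, abs_pow, abs_neg, abs_one, one_pow, one_mul]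
  · exact mul_le_of_le_one_right (by positivity) (Real.abs_cos_le_one _)
  · exact mul_le_of_le_one_right (by positivity) (Real.abs_sin_le_one _)

theorem abs_uIm_le (j : ℕ) (ω y : ℝ) : |uIm j ω y| ≤ |y| ^ j := by
  unfold uIm
  split_ifs <;> simp only [abs_mul, abs_pow, abs_neg, abs_one, one_pow, one_mul]
  · exact mul_le_of_le_one_right (by positivity) (Real.abs_sin_le_one _)
  · exact mul_le_of_le_one_right (by positivity) (Real.abs_cos_le_one _)

theorem continuous_uRe (j : ℕ) : Continuous (fun p : ℝ × ℝ => uRe j p.1 p.2) := by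
  unfold uRe
  split_ifs <;> fun_prop

theorem continuous_uIm (j : ℕ) : Continuous (fun p : ℝ × ℝ => uIm j p.1 p.2) := by
  unfold uIm
  split_ifs <;> fun_prop

/-- The parity-dependent signs of `uRe` and `uIm` are those of the real and imaginary parts of the
`j`-th derivative of `ω ↦ exp(iωy)`. This identity is the source of unbiasedness. -/
theorem ofReal_uRe_add_uIm (j : ℕ) (ω y : ℝ) :
    Complex.I ^ j * ((y : ℂ) ^ j * Complex.exp (ω * y * Complex.I)) =
      (uRe j ω y : ℂ) + (uIm j ω y : ℂ) * Complex.I := by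
  rw [Complex.exp_mul_I]
  rcases Nat.even_or_odd' j with ⟨k, rfl | rfl⟩
  · have h : Even (2 * k) := even_two_mul k
    simp only [uRe, uIm, h, if_true, pow_mul, Complex.I_sq]
    rw [Nat.mul_div_cancel_left _ two_pos]
    push_cast
    ring
  · have h : ¬ Even (2 * k + 1) := by simp
    have h1 : (2 * k + 1 + 1) / 2 = k + 1 := by omega
    have h2 : (2 * k + 1 - 1) / 2 = k := by omega
    simp only [uRe, uIm, h, if_false, h1, h2]
    rw [pow_succ Complex.I, pow_mul Complex.I, Complex.I_sq]
    push_cast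
    linear_combination ((-1 : ℂ) ^ k * (y : ℂ) ^ (2 * k + 1) * Complex.sin (ω * y)) * Complex.I_sq

variable {μ : Measure ℝ} [IsProbabilityMeasure μ] {n : ℕ}

theorem integrable_uRe (h : MemLp id n μ) {j : ℕ} (hj : j ≤ n) (ω : ℝ) :
    Integrable (uRe j ω) μ :=
  (integrable_abs_pow_of_memLp h hj).mono'
    ((continuous_uRe j).comp (Continuous.prodMk_right ω)).aestronglyMeasurable
    (.of_forall fun y => abs_uRe_le j ω y)

theorem integrable_uIm (h : MemLp id n μ) {j : ℕ} (hj : j ≤ n) (ω : ℝ) :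
    Integrable (uIm j ω) μ :=
  (integrable_abs_pow_of_memLp h hj).mono'
    ((continuous_uIm j).comp (Continuous.prodMk_right ω)).aestronglyMeasurable
    (.of_forall fun y => abs_uIm_le j ω y)

theorem memLp_two_of_abs_le_pow {m : ℕ} (h : MemLp id (2 * m : ℕ) μ) {j : ℕ} (hj : j ≤ m)
    {X : ℝ → ℝ} (hX : AEStronglyMeasurable X μ) (hb : ∀ y, |X y| ≤ |y| ^ j) : MemLp X 2 μ := by
  rw [memLp_two_iff_integrable_sq hX]
  refine (integrable_abs_pow_of_memLp h (j := 2 * j) (by omega)).mono' (hX.pow 2)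
    (.of_forall fun y => ?_)
  rw [Real.norm_eq_abs, abs_pow, mul_comm, pow_mul]
  exact pow_le_pow_left₀ (abs_nonneg _) (hb y) 2

theorem memLp_uRe {m : ℕ} (h : MemLp id (2 * m : ℕ) μ) {j : ℕ} (hj : j ≤ m) (ω : ℝ) :
    MemLp (uRe j ω) 2 μ :=
  memLp_two_of_abs_le_pow h hj
    ((continuous_uRe j).comp (Continuous.prodMk_right ω)).aestronglyMeasurable (abs_uRe_le j ω)

theorem memLp_uIm {m : ℕ} (h : MemLp id (2 * m : ℕ) μ) {j : ℕ} (hj : j ≤ m) (ω : ℝ) :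
    MemLp (uIm j ω) 2 μ :=
  memLp_two_of_abs_le_pow h hj
    ((continuous_uIm j).comp (Continuous.prodMk_right ω)).aestronglyMeasurable (abs_uIm_le j ω)

theorem iteratedDeriv_charFun_eq (h : MemLp id n μ) {j : ℕ} (hj : j ≤ n) (ω : ℝ) :
    iteratedDeriv j (charFun μ) ω =
      ((∫ y, uRe j ω y ∂μ : ℝ) : ℂ) + ((∫ y, uIm j ω y ∂μ : ℝ) : ℂ) * Complex.I := by
  rw [iteratedDeriv_charFun (h.mono_exponent (by simpa using hj)), ← integral_const_mul]
  simp_rw [ofReal_uRe_add_uIm]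
  rw [integral_add (integrable_uRe h hj ω).ofReal
    ((integrable_uIm h hj ω).ofReal.mul_const _), integral_mul_const,
    integral_complex_ofReal, integral_complex_ofReal]

theorem iteratedDeriv_re {n : ℕ} {F : ℝ → ℂ} (hF : ContDiff ℝ n F) (ω : ℝ) :
    iteratedDeriv n (fun w => (F w).re) ω = (iteratedDeriv n F ω).re := by
  have := Complex.reCLM.iteratedFDeriv_comp_left (f := F) (x := ω) hF.contDiffAt
    (i := n) le_rfl
  simp only [iteratedDeriv]
  exact congrArg (fun T => T fun _ => (1 : ℝ)) this

theorem iteratedDeriv_im {n : ℕ} {F : ℝ → ℂ} (hF : ContDiff ℝ n F) (ω : ℝ) :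
    iteratedDeriv n (fun w => (F w).im) ω = (iteratedDeriv n F ω).im := by
  have := Complex.imCLM.iteratedFDeriv_comp_left (f := F) (x := ω) hF.contDiffAt
    (i := n) le_rfl
  simp only [iteratedDeriv]
  exact congrArg (fun T => T fun _ => (1 : ℝ)) this

theorem contDiff_re {n : WithTop ℕ∞} {F : ℝ → ℂ} (hF : ContDiff ℝ n F) :
    ContDiff ℝ n (fun w => (F w).re) := Complex.reCLM.contDiff.comp hF

theorem contDiff_im {n : WithTop ℕ∞} {F : ℝ → ℂ} (hF : ContDiff ℝ n F) :
    ContDiff ℝ n (fun w => (F w).im) := Complex.imCLM.contDiff.comp hF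

theorem contDiff_charFun_of_le (h : MemLp id n μ) {j : ℕ} (hj : j ≤ n) :
    ContDiff ℝ j (charFun μ) := contDiff_charFun (h.mono_exponent (by simpa using hj))

theorem iteratedDeriv_re_charFun (h : MemLp id n μ) {j : ℕ} (hj : j ≤ n) (ω : ℝ) :
    iteratedDeriv j (fun w => (charFun μ w).re) ω = ∫ y, uRe j ω y ∂μ := by
  rw [iteratedDeriv_re (contDiff_charFun_of_le h hj), iteratedDeriv_charFun_eq h hj]
  simp

theorem iteratedDeriv_im_charFun (h : MemLp id n μ) {j : ℕ} (hj : j ≤ n) (ω : ℝ) :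
    iteratedDeriv j (fun w => (charFun μ w).im) ω = ∫ y, uIm j ω y ∂μ := by
  rw [iteratedDeriv_im (contDiff_charFun_of_le h hj), iteratedDeriv_charFun_eq h hj]
  simp

end Trig

end InvDeconv

namespace InvDeconv

/-! ### Plancherel's inequality by Gaussian weighting. -/

section Plancherel

open Filter Topology ComplexConjugate

theorem integrable_exp_mul {k : ℝ → ℂ} (hk : Integrable k) (y : ℝ) :
    Integrable (fun ω : ℝ => k ω * Complex.exp (ω * y * Complex.I)) := by
  refine (integrable_norm_iff (hk.aestronglyMeasurable.mul (by fun_prop))).1 ?_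
  refine hk.norm.congr (.of_forall fun ω => ?_)
  simp only [Pi.mul_apply]
  rw [norm_mul, ← Complex.ofReal_mul, Complex.norm_exp_ofReal_mul_I, mul_one]

/-- Expand the squared modulus as a double integral over frequencies and apply Fubini: integrating
out `y` leaves the characteristic function of `N` at the frequency difference. -/
theorem integral_normSq_integral_exp (N : Measure ℝ) [IsFiniteMeasure N] {k : ℝ → ℂ}
    (hk : Integrable k) :
    ((∫ y, ‖∫ ω, k ω * Complex.exp (ω * y * Complex.I)‖ ^ 2 ∂N : ℝ) : ℂ) =
      ∫ p : ℝ × ℝ, k p.1 * conj (k p.2) * charFun N (p.1 - p.2) := by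
  have hc : Integrable (fun p : ℝ × ℝ => k p.1 * conj (k p.2)) :=
    hk.mul_prod (Complex.conjCLE.toContinuousLinearMap.integrable_comp hk)
  have hF : Integrable (Function.uncurry fun (y : ℝ) (p : ℝ × ℝ) =>
      k p.1 * conj (k p.2) * Complex.exp ((p.1 - p.2 : ℝ) * y * Complex.I))
      (N.prod volume) := by
    refine (integrable_norm_iff ?_).1 ?_
    · exact (hc.comp_snd N).aestronglyMeasurable.mul (by fun_prop)
    · refine (hc.comp_snd N).norm.congr (.of_forall fun q => ?_)
      simp only [Function.uncurry, norm_mul]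
      rw [← Complex.ofReal_mul, Complex.norm_exp_ofReal_mul_I, mul_one]
  rw [← integral_complex_ofReal]
  calc ∫ y, ((‖∫ ω, k ω * Complex.exp (ω * y * Complex.I)‖ ^ 2 : ℝ) : ℂ) ∂N
      = ∫ y, (∫ p : ℝ × ℝ, k p.1 * conj (k p.2) *
          Complex.exp ((p.1 - p.2 : ℝ) * y * Complex.I)) ∂N := by
        refine integral_congr_ae (.of_forall fun y => ?_)
        simp only
        rw [Complex.ofReal_pow, ← Complex.mul_conj', ← integral_conj, Measure.volume_eq_prod,
          ← integral_prod_mul]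
        refine integral_congr_ae (.of_forall fun p => ?_)
        simp only [map_mul, ← Complex.exp_conj, Complex.conj_ofReal, Complex.conj_I]
        rw [mul_mul_mul_comm, ← Complex.exp_add]
        congr 2
        push_cast
        ring
    _ = ∫ p : ℝ × ℝ, ∫ y, k p.1 * conj (k p.2) *
          Complex.exp ((p.1 - p.2 : ℝ) * y * Complex.I) ∂N := integral_integral_swap hF
    _ = _ := by
        refine integral_congr_ae (.of_forall fun p => ?_)
        simp only
        rw [integral_const_mul, charFun_apply_real]

theorem lintegral_ofReal_exp_neg_mul_sq {b : ℝ} (hb : 0 < b) :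
    ∫⁻ x : ℝ, ENNReal.ofReal (Real.exp (-b * x ^ 2)) = ENNReal.ofReal (√(Real.pi / b)) := by
  rw [← integral_gaussian b, ofReal_integral_eq_lintegral_ofReal (integrable_exp_neg_mul_sq hb)
    (.of_forall fun x => (Real.exp_pos _).le)]

/-- A Schur test: the kernel is the characteristic function of a centred Gaussian, which is positive
and has integral `√(2π/v)` in each variable separately. -/
theorem lintegral_normSq_gaussian_le {k : ℝ → ℂ} (hk : Integrable k) {v : NNReal} (hv : 0 < v) :
    ∫⁻ y, ENNReal.ofReal (‖∫ ω, k ω * Complex.exp (ω * y * Complex.I)‖ ^ 2) ∂(gaussianReal 0 v) ≤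
      ENNReal.ofReal (√(2 * Real.pi / v)) * ∫⁻ ω, ENNReal.ofReal (‖k ω‖ ^ 2) := by
  set N := gaussianReal 0 v
  set E : ℝ → ℝ := fun t => Real.exp (-(v / 2 : ℝ) * t ^ 2)
  have hv' : (0 : ℝ) < v := by exact_mod_cast hv
  have hE : ∀ t : ℝ, ‖charFun N t‖ = E t := fun t => by
    simp only [N, charFun_gaussianReal, Complex.norm_exp, E]
    congr 1
    rw [Complex.ofReal_zero, mul_zero, zero_mul, zero_sub,
      ← neg_div, ← neg_mul]
    rw [show (-((v : ℝ) : ℂ) * (t : ℂ) ^ 2 / 2) = ((-(v / 2 : ℝ) * t ^ 2 : ℝ) : ℂ) by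
      push_cast; ring, Complex.ofReal_re]
  have hEint : ∫⁻ x : ℝ, ENNReal.ofReal (E x) = ENNReal.ofReal (√(2 * Real.pi / v)) := by
    rw [lintegral_ofReal_exp_neg_mul_sq (by positivity)]
    congr 2
    field_simp
  have hcont : Continuous fun y : ℝ => ∫ ω, k ω * Complex.exp (ω * y * Complex.I) := by
    refine continuous_of_dominated (bound := fun ω => ‖k ω‖) ?_ ?_ hk.norm ?_
    · exact fun y => (integrable_exp_mul hk y).aestronglyMeasurable
    · refine fun y => .of_forall fun ω => ?_
      rw [norm_mul, ← Complex.ofReal_mul, Complex.norm_exp_ofReal_mul_I, mul_one]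
    · exact .of_forall fun ω => by fun_prop
  have hbd : ∀ y : ℝ, ‖∫ ω, k ω * Complex.exp (ω * y * Complex.I)‖ ≤ ∫ ω, ‖k ω‖ := fun y => by
    refine (norm_integral_le_integral_norm _).trans_eq (integral_congr_ae (.of_forall fun ω => ?_))
    simp only
    rw [norm_mul, ← Complex.ofReal_mul, Complex.norm_exp_ofReal_mul_I, mul_one]
  have hint : Integrable (fun y : ℝ => ‖∫ ω, k ω * Complex.exp (ω * y * Complex.I)‖ ^ 2) N := by
    refine Integrable.of_bound (hcont.norm.pow 2).aestronglyMeasurable ((∫ ω, ‖k ω‖) ^ 2) (.of_forall fun y => ?_)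
    rw [Real.norm_of_nonneg (by positivity)]
    exact pow_le_pow_left₀ (norm_nonneg _) (hbd y) 2
  rw [← ofReal_integral_eq_lintegral_ofReal hint (.of_forall fun y => by positivity)]
  have hnorm : ‖((∫ y, ‖∫ ω, k ω * Complex.exp (ω * y * Complex.I)‖ ^ 2 ∂N : ℝ) : ℂ)‖ =
      ∫ y, ‖∫ ω, k ω * Complex.exp (ω * y * Complex.I)‖ ^ 2 ∂N := by
    rw [Complex.norm_real, Real.norm_of_nonneg (integral_nonneg fun y => by positivity)]
  rw [← hnorm, integral_normSq_integral_exp N hk, ofReal_norm]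
  refine (enorm_integral_le_lintegral_enorm _).trans ?_
  have hkm : AEMeasurable (fun ω => ENNReal.ofReal (‖k ω‖ ^ 2)) :=
    (hk.aestronglyMeasurable.norm.aemeasurable.pow_const 2).ennreal_ofReal
  have hEm : Measurable fun t => ENNReal.ofReal (E t) := by fun_prop
  have h1 : AEMeasurable (fun p : ℝ × ℝ => ENNReal.ofReal (‖k p.1‖ ^ 2) *
      ENNReal.ofReal (E (p.1 - p.2))) (volume.prod volume) :=
    (hkm.comp_quasiMeasurePreserving Measure.quasiMeasurePreserving_fst).mul
      (hEm.comp (measurable_fst.sub measurable_snd)).aemeasurable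
  have h2 : AEMeasurable (fun p : ℝ × ℝ => ENNReal.ofReal (‖k p.2‖ ^ 2) *
      ENNReal.ofReal (E (p.1 - p.2))) (volume.prod volume) :=
    (hkm.comp_quasiMeasurePreserving Measure.quasiMeasurePreserving_snd).mul
      (hEm.comp (measurable_fst.sub measurable_snd)).aemeasurable
  -- The inequality `2|k(s)||k(t)| ≤ |k(s)|² + |k(t)|²` separates the variables.
  calc ∫⁻ p : ℝ × ℝ, ‖k p.1 * conj (k p.2) * charFun N (p.1 - p.2)‖ₑ
      ≤ ∫⁻ p : ℝ × ℝ, 2⁻¹ * (ENNReal.ofReal (‖k p.1‖ ^ 2) * ENNReal.ofReal (E (p.1 - p.2)) +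
          ENNReal.ofReal (‖k p.2‖ ^ 2) * ENNReal.ofReal (E (p.1 - p.2))) := by
        refine lintegral_mono fun p => ?_
        rw [← ofReal_norm, norm_mul, norm_mul, hE, RCLike.norm_conj, ← add_mul,
          ← ENNReal.ofReal_add (by positivity) (by positivity),
          ← ENNReal.ofReal_mul (by positivity)]
        have : (2⁻¹ : ENNReal) = ENNReal.ofReal (1 / 2) := by
          rw [one_div, ENNReal.ofReal_inv_of_pos two_pos]; simp
        rw [this, ← ENNReal.ofReal_mul (by positivity)]
        refine ENNReal.ofReal_le_ofReal ?_
        have hEp : 0 ≤ E (p.1 - p.2) := (Real.exp_pos _).le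
        nlinarith [mul_nonneg (sq_nonneg (‖k p.1‖ - ‖k p.2‖)) hEp]
    _ = 2⁻¹ * (ENNReal.ofReal (√(2 * Real.pi / v)) * (∫⁻ ω, ENNReal.ofReal (‖k ω‖ ^ 2)) +
          ENNReal.ofReal (√(2 * Real.pi / v)) * ∫⁻ ω, ENNReal.ofReal (‖k ω‖ ^ 2)) := by
        rw [Measure.volume_eq_prod, lintegral_const_mul' _ _ (by simp), lintegral_add_left' h1]
        congr 2
        · rw [lintegral_prod _ h1, ← lintegral_const_mul'' _ hkm]
          refine lintegral_congr fun ω => ?_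
          simp only
          rw [lintegral_const_mul' _ _ (by simp),
            lintegral_sub_left_eq_self (fun t => ENNReal.ofReal (E t)), hEint, mul_comm]
        · rw [lintegral_prod_symm _ h2, ← lintegral_const_mul'' _ hkm]
          refine lintegral_congr fun ω => ?_
          simp only
          rw [lintegral_const_mul' _ _ (by simp),
            lintegral_sub_right_eq_self (fun t => ENNReal.ofReal (E t)), hEint, mul_comm]
    _ = _ := by
        rw [← two_mul, ← mul_assoc, ENNReal.inv_mul_cancel (by simp) (by simp), one_mul]

/-- The Plancherel inequality for integrable functions. -/
theorem lintegral_normSq_integral_exp_le {k : ℝ → ℂ} (hk : Integrable k) :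
    ∫⁻ y : ℝ, ENNReal.ofReal (‖∫ ω, k ω * Complex.exp (ω * y * Complex.I)‖ ^ 2) ≤
      ENNReal.ofReal (2 * Real.pi) * ∫⁻ ω, ENNReal.ofReal (‖k ω‖ ^ 2) := by
  set G : ℝ → ENNReal := fun y =>
    ENNReal.ofReal (‖∫ ω, k ω * Complex.exp (ω * y * Complex.I)‖ ^ 2)
  have hcont : Continuous fun y : ℝ => ∫ ω, k ω * Complex.exp (ω * y * Complex.I) := by
    refine continuous_of_dominated (bound := fun ω => ‖k ω‖) ?_ ?_ hk.norm ?_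
    · exact fun y => (integrable_exp_mul hk y).aestronglyMeasurable
    · refine fun y => .of_forall fun ω => ?_
      rw [norm_mul, ← Complex.ofReal_mul, Complex.norm_exp_ofReal_mul_I, mul_one]
    · exact .of_forall fun ω => by fun_prop
  have hG : Measurable G := (hcont.norm.pow 2).measurable.ennreal_ofReal
  -- Up to its normalising constant, `w n` is the Gaussian density of variance `v = n + 1`, and it
  -- tends to `1`. The factors `√(2πv)` and `√(2π/v)` multiply to `2π` for every `v`, so Fatou's
  -- lemma gives the unweighted bound.
  set w : ℕ → ℝ → ℝ := fun n y => Real.exp (-y ^ 2 / (2 * (n + 1)))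
  have hw : ∀ y, Tendsto (fun n => G y * ENNReal.ofReal (w n y)) atTop (𝓝 (G y)) := fun y => by
    have h1 : Tendsto (fun n : ℕ => w n y) atTop (𝓝 1) := by
      have h2 : Tendsto (fun n : ℕ => -y ^ 2 / (2 * ((n : ℝ) + 1))) atTop (𝓝 0) := by
        refine Tendsto.div_atTop tendsto_const_nhds ?_
        exact Tendsto.const_mul_atTop two_pos
          (tendsto_atTop_add_const_right _ _ tendsto_natCast_atTop_atTop)
      simpa [w, Function.comp_def] using (Real.continuous_exp.tendsto 0).comp h2
    have h2 := (ENNReal.continuous_ofReal.tendsto 1).comp h1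
    rw [ENNReal.ofReal_one] at h2
    simpa using ENNReal.Tendsto.const_mul h2 (a := G y) (Or.inl (by simp))
  have hn : ∀ n : ℕ, ∫⁻ y, G y * ENNReal.ofReal (w n y) ≤
      ENNReal.ofReal (2 * Real.pi) * ∫⁻ ω, ENNReal.ofReal (‖k ω‖ ^ 2) := fun n => by
    set v : NNReal := (n : NNReal) + 1
    have hv : 0 < v := by positivity
    have hv' : (0 : ℝ) < v := by exact_mod_cast hv
    have hpi := Real.pi_pos
    have hs : (0 : ℝ) < √(2 * Real.pi * v) := by positivity
    have hg := lintegral_normSq_gaussian_le hk hv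
    rw [gaussianReal_of_var_ne_zero _ hv.ne',
      lintegral_withDensity_eq_lintegral_mul _ (measurable_gaussianPDF _ _) hG] at hg
    have hpt : ∀ y, G y * ENNReal.ofReal (w n y) =
        ENNReal.ofReal (√(2 * Real.pi * v)) * (gaussianPDF 0 v * G) y := fun y => by
      simp only [Pi.mul_apply, gaussianPDF, gaussianPDFReal]
      rw [← mul_assoc, ← ENNReal.ofReal_mul hs.le, ← mul_assoc, mul_inv_cancel₀ hs.ne', one_mul,
        mul_comm]
      simp [w, v]
    simp_rw [hpt]
    rw [lintegral_const_mul _ ((measurable_gaussianPDF _ _).mul hG)]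
    refine (mul_le_mul_right hg _).trans_eq ?_
    rw [← mul_assoc, ← ENNReal.ofReal_mul hs.le, ← Real.sqrt_mul (by positivity)]
    congr 2
    rw [show 2 * Real.pi * v * (2 * Real.pi / v) = (2 * Real.pi) ^ 2 by field_simp,
      Real.sqrt_sq (by positivity)]
  calc ∫⁻ y, G y = ∫⁻ y, liminf (fun n => G y * ENNReal.ofReal (w n y)) atTop :=
        lintegral_congr fun y => (hw y).liminf_eq.symm
    _ ≤ liminf (fun n => ∫⁻ y, G y * ENNReal.ofReal (w n y)) atTop :=
        lintegral_liminf_le fun n => hG.mul (by fun_prop)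
    _ ≤ _ := liminf_le_of_frequently_le' (Frequently.of_forall hn)

/-- Second moment of a random trigonometric integral under a law with bounded density. -/
theorem lintegral_sq_trig_integral_le {μ : Measure ℝ} {K : ℝ} (hK : 0 ≤ K)
    (hμ : μ ≤ ENNReal.ofReal K • (volume : Measure ℝ)) {S : Set ℝ}
    (hS : MeasurableSet S) {k₁ k₂ : ℝ → ℝ} (h₁ : IntegrableOn k₁ S) (h₂ : IntegrableOn k₂ S)
    (hsq : IntegrableOn (fun ω => k₁ ω ^ 2 + k₂ ω ^ 2) S) :
    ∫⁻ y, ENNReal.ofReal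
        ((∫ ω in S, (k₁ ω * Real.cos (ω * y) + k₂ ω * Real.sin (ω * y))) ^ 2) ∂μ ≤
      ENNReal.ofReal (K * (2 * Real.pi) * ∫ ω in S, (k₁ ω ^ 2 + k₂ ω ^ 2)) := by
  -- With `k = k₁ - i k₂` the real part of `k exp(iωy)` is the integrand, and `|k|² = k₁² + k₂²`.
  set k : ℝ → ℂ := S.indicator fun ω => (k₁ ω : ℂ) - k₂ ω * Complex.I
  have hkS : IntegrableOn (fun ω => (k₁ ω : ℂ) - k₂ ω * Complex.I) S :=
    h₁.ofReal.sub (h₂.ofReal.mul_const _)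
  have hk : Integrable k := hkS.integrable_indicator hS
  have hpt : ∀ y, ∫ ω in S, (k₁ ω * Real.cos (ω * y) + k₂ ω * Real.sin (ω * y)) =
      (∫ ω, k ω * Complex.exp (ω * y * Complex.I)).re := fun y => by
    rw [← Complex.reCLM_apply, ← ContinuousLinearMap.integral_comp_comm _ (integrable_exp_mul hk y),
      ← integral_indicator hS]
    refine integral_congr_ae (.of_forall fun ω => ?_)
    by_cases h : ω ∈ S
    · simp only [k, indicator_of_mem h, Complex.reCLM_apply]
      rw [Complex.exp_mul_I, ← Complex.ofReal_mul, ← Complex.ofReal_cos, ← Complex.ofReal_sin]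
      simp [-Complex.ofReal_mul, -Complex.ofReal_cos, -Complex.ofReal_sin]
    · simp [k, h]
  have hnk : ∀ ω, ENNReal.ofReal (‖k ω‖ ^ 2) =
      S.indicator (fun ω => ENNReal.ofReal (k₁ ω ^ 2 + k₂ ω ^ 2)) ω := fun ω => by
    by_cases h : ω ∈ S
    · simp only [k, indicator_of_mem h]
      rw [Complex.sq_norm, Complex.normSq_apply]
      simp [sq]
    · simp [k, h]
  calc ∫⁻ y, ENNReal.ofReal
        ((∫ ω in S, (k₁ ω * Real.cos (ω * y) + k₂ ω * Real.sin (ω * y))) ^ 2) ∂μ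
      ≤ ∫⁻ y, ENNReal.ofReal (‖∫ ω, k ω * Complex.exp (ω * y * Complex.I)‖ ^ 2) ∂μ := by
        refine lintegral_mono fun y => ENNReal.ofReal_le_ofReal ?_
        rw [hpt, ← sq_abs]
        exact pow_le_pow_left₀ (abs_nonneg _) (Complex.abs_re_le_norm _) 2
    _ ≤ ∫⁻ y, ENNReal.ofReal (‖∫ ω, k ω * Complex.exp (ω * y * Complex.I)‖ ^ 2)
          ∂(ENNReal.ofReal K • (volume : Measure ℝ)) := lintegral_mono' hμ le_rfl
    _ ≤ ENNReal.ofReal K * (ENNReal.ofReal (2 * Real.pi) * ∫⁻ ω, ENNReal.ofReal (‖k ω‖ ^ 2)) := by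
        rw [lintegral_smul_measure, smul_eq_mul]
        exact mul_le_mul_right (lintegral_normSq_integral_exp_le hk) _
    _ = _ := by
        simp_rw [hnk]
        rw [lintegral_indicator hS, ← ofReal_integral_eq_lintegral_ofReal hsq
          (.of_forall fun ω => by positivity), ← mul_assoc, ← ENNReal.ofReal_mul hK,
          ← ENNReal.ofReal_mul (by positivity)]

end Plancherel

end InvDeconv

namespace InvDeconv

/-! ### Uniform nondegeneracy of analytic functions of an observation. -/

section Nondegenerate

open Filter Topology

/-- By the identity theorem, a nonconstant analytic function on the line takes a given value only on
a set with codiscrete complement, which is Lebesgue null. -/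
theorem ae_ne_of_analytic {F : ℝ → ℝ} (hF : AnalyticOnNhd ℝ F univ) {y₁ y₂ : ℝ}
    (hne : F y₁ ≠ F y₂) (c : ℝ) : ∀ᵐ y ∂volume, F y ≠ c := by
  have hG : AnalyticOnNhd ℝ (fun y => F y - c) univ := hF.sub analyticOnNhd_const
  rcases hG.eqOn_zero_or_eventually_ne_zero_of_preconnected isPreconnected_univ with h | h
  · have h1 := h (mem_univ y₁)
    have h2 := h (mem_univ y₂)
    simp only [Pi.zero_apply] at h1 h2
    exact absurd (by linarith) hne
  · have := ae_restrict_le_codiscreteWithin (μ := (volume : Measure ℝ)) MeasurableSet.univ h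
    rw [Measure.restrict_univ] at this
    filter_upwards [this] with y hy using fun h => hy (by simp [h])

/-- Uniform lower bound on the variances of a continuous family of nondegenerate functions. -/
theorem exists_pos_le_lintegral_sq_sub {μ : Measure ℝ} [IsProbabilityMeasure μ] (hμ : μ ≪ volume)
    {φ : ℝ → ℝ → ℝ} (hφ : Continuous (Function.uncurry φ)) {S : Set ℝ} (hS : IsCompact S)
    (hne : ∀ ω ∈ S, ∀ c, ∀ᵐ y ∂volume, φ ω y ≠ c) :
    ∃ c : ℝ, 0 < c ∧ ∀ ω ∈ S, ∀ e : ℝ,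
      ENNReal.ofReal c ≤ ∫⁻ y, ENNReal.ofReal ((φ ω y - e) ^ 2) ∂μ := by
  rcases S.eq_empty_or_nonempty with rfl | hSne
  · exact ⟨1, one_pos, by simp⟩
  -- Cutting to a compact interval of positive mass makes the double integral below finite and
  -- continuous in `ω` without any moment hypothesis.
  obtain ⟨n, hn⟩ : ∃ n : ℕ, μ (Icc (-(n : ℝ)) n) ≠ 0 := by
    by_contra! h
    have : μ (⋃ n : ℕ, Icc (-(n : ℝ)) n) = 0 := measure_iUnion_null h
    rw [show (⋃ n : ℕ, Icc (-(n : ℝ)) n) = univ from ?_, measure_univ] at this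
    · exact one_ne_zero this
    · refine eq_univ_of_forall fun x => ?_
      obtain ⟨n, hn⟩ := exists_nat_ge |x|
      exact mem_iUnion.2 ⟨n, abs_le.1 hn⟩
  set I := Icc (-(n : ℝ)) n
  set ν := μ.restrict I
  have hIc : IsCompact I := isCompact_Icc
  have hνne : ν ≠ 0 := by simpa [ν, Measure.restrict_eq_zero] using hn
  have hνuniv : ν univ ≤ 1 := by
    rw [Measure.restrict_apply_univ]; exact prob_le_one
  have hνvol : ν ≪ volume := Measure.absolutelyContinuous_of_le Measure.restrict_le_self |>.trans hμ
  set Q : ℝ → ℝ × ℝ → ℝ := fun ω p => (φ ω p.1 - φ ω p.2) ^ 2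
  have hQ : Continuous (Function.uncurry Q) := by
    have h1 : Continuous fun q : ℝ × ℝ × ℝ => φ q.1 q.2.1 :=
      hφ.comp (continuous_fst.prodMk continuous_snd.fst)
    have h2 : Continuous fun q : ℝ × ℝ × ℝ => φ q.1 q.2.2 :=
      hφ.comp (continuous_fst.prodMk continuous_snd.snd)
    exact (h1.sub h2).pow 2
  -- The symmetrised quantity does not involve the centre `e`. It is continuous and positive on `S`,
  -- so its minimum over the compact set `S` bounds all centred second moments at once.
  set D : ℝ → ℝ := fun ω => ∫ p in I ×ˢ I, Q ω p ∂(μ.prod μ)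
  have hD : Continuous D := continuous_parametric_integral_of_continuous hQ (hIc.prod hIc)
  have hprod : (μ.prod μ).restrict (I ×ˢ I) = ν.prod ν := (Measure.prod_restrict _ _).symm
  have hQω : ∀ ω, Continuous (Q ω) := fun ω => hQ.comp (Continuous.prodMk_right ω)
  have hint : ∀ ω, Integrable (Q ω) (ν.prod ν) := fun ω => by
    rw [← hprod]
    exact (hQω ω).continuousOn.integrableOn_compact (hIc.prod hIc)
  have hpos : ∀ ω ∈ S, 0 < D ω := fun ω hω => by
    refine lt_of_le_of_ne (integral_nonneg fun p => sq_nonneg _) fun h0 => ?_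
    simp only [D, hprod] at h0
    have h1 := (integral_eq_zero_iff_of_nonneg (fun p => sq_nonneg _) (hint ω)).1 h0.symm
    have h2 := Measure.ae_ae_of_ae_prod h1
    -- If `D ω` vanished, then for almost every `y` the function `φ ω` would be almost everywhere
    -- equal to the constant `φ ω y`, against `hne`.
    have h3 : ∀ᵐ y ∂ν, False := by
      filter_upwards [h2] with y hy
      have h4 : ∀ᵐ z ∂ν, False := by
        filter_upwards [hy, hνvol.ae_le (hne ω hω (φ ω y))] with z hz hz'
        simp only [Pi.zero_apply] at hz
        exact hz' (by have := pow_eq_zero_iff two_ne_zero |>.1 hz; linarith)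
      exact hνne (by simpa using h4)
    exact hνne (by simpa using h3)
  obtain ⟨ω₀, hω₀, hmin⟩ := hS.exists_isMinOn hSne hD.continuousOn
  -- The `4` comes from `(x - y)² ≤ 2 (x - e)² + 2 (y - e)²`, the restricted measure having mass at
  -- most `1`.
  refine ⟨D ω₀ / 4, by have := hpos ω₀ hω₀; positivity, fun ω hω e => ?_⟩
  have hφω : Continuous (φ ω) := hφ.comp (Continuous.prodMk_right ω)
  have hm : Measurable fun y => ENNReal.ofReal ((φ ω y - e) ^ 2) := by fun_prop
  set J := ∫⁻ y, ENNReal.ofReal ((φ ω y - e) ^ 2) ∂μ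
  have hJ : ∫⁻ y, ENNReal.ofReal ((φ ω y - e) ^ 2) ∂ν ≤ J :=
    lintegral_mono' Measure.restrict_le_self le_rfl
  have h4 : ENNReal.ofReal (D ω) ≤ 4 * J := by
    simp only [D, hprod]
    rw [ofReal_integral_eq_lintegral_ofReal (hint ω) (.of_forall fun p => sq_nonneg _)]
    calc ∫⁻ p, ENNReal.ofReal (Q ω p) ∂(ν.prod ν)
        ≤ ∫⁻ p : ℝ × ℝ, 2 * (ENNReal.ofReal ((φ ω p.1 - e) ^ 2) +
            ENNReal.ofReal ((φ ω p.2 - e) ^ 2)) ∂(ν.prod ν) := by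
          refine lintegral_mono fun p => ?_
          rw [← ENNReal.ofReal_add (sq_nonneg _) (sq_nonneg _),
            show (2 : ENNReal) = ENNReal.ofReal 2 by simp, ← ENNReal.ofReal_mul two_pos.le]
          refine ENNReal.ofReal_le_ofReal ?_
          simp only [Q]
          nlinarith [sq_nonneg (φ ω p.1 - e + (φ ω p.2 - e))]
      _ = 2 * ((∫⁻ y, ENNReal.ofReal ((φ ω y - e) ^ 2) ∂ν) * ν univ +
            (∫⁻ y, ENNReal.ofReal ((φ ω y - e) ^ 2) ∂ν) * ν univ) := by
          rw [lintegral_const_mul _ (by fun_prop), lintegral_add_left (by fun_prop)]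
          congr 2
          · rw [lintegral_prod _ (by fun_prop)]
            simp [lintegral_mul_const _ hm, lintegral_const]
          · rw [lintegral_prod _ (by fun_prop)]
            simp
      _ ≤ 2 * (J * 1 + J * 1) := by gcongr
      _ = 4 * J := by rw [mul_one, ← two_mul, ← mul_assoc]; norm_num
  have h5 : ENNReal.ofReal (D ω₀) ≤ ENNReal.ofReal (D ω) := ENNReal.ofReal_le_ofReal (hmin hω)
  rw [ENNReal.ofReal_div_of_pos (by norm_num)]
  refine ENNReal.div_le_of_le_mul ?_
  rw [mul_comm]
  simpa using h5.trans h4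

end Nondegenerate

end InvDeconv

namespace InvDeconv

/-! ### Lower bounds on the variances, and integrability from variance conditions. -/

section WeightIntegrability

theorem lintegral_sq_sub_mean {μ : Measure ℝ} [IsProbabilityMeasure μ] {X : ℝ → ℝ}
    (hX : MemLp X 2 μ) :
    ∫⁻ y, ENNReal.ofReal ((X y - ∫ z, X z ∂μ) ^ 2) ∂μ = ENNReal.ofReal (variance X μ) := by
  rw [variance_eq_integral hX.aestronglyMeasurable.aemeasurable,
    ofReal_integral_eq_lintegral_ofReal _ (.of_forall fun y => sq_nonneg _)]
  exact (hX.sub (memLp_const _)).integrable_sq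

/-- The lower bound on `v` puts `ρ w` in `L²`, hence in `L¹` because `S` has finite measure. It is
used with `ρ = 1` for cosine terms and `ρ(ω) = ω` for sine terms. -/
theorem integrableOn_mul_of_lintegral_sq {S : Set ℝ} (hS : MeasurableSet S)
    (hSfin : volume S ≠ ⊤) {w ρ v : ℝ → ℝ} (hw : AEStronglyMeasurable w (volume.restrict S))
    (hρ : AEStronglyMeasurable ρ (volume.restrict S)) {c : ℝ} (hc : 0 < c)
    (hv : ∀ ω ∈ S, c * ρ ω ^ 2 ≤ v ω)
    (hfin : ∫⁻ ω in S, ENNReal.ofReal (w ω ^ 2 * v ω) < ⊤) :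
    IntegrableOn (fun ω => ρ ω * w ω) S := by
  have : IsFiniteMeasure (volume.restrict S) := ⟨by
    rw [Measure.restrict_apply_univ]; exact lt_top_iff_ne_top.2 hSfin⟩
  have hm : MemLp (fun ω => ρ ω * w ω) 2 (volume.restrict S) := by
    refine (memLp_two_iff_integrable_sq (hρ.mul hw)).2 ?_
    have h1 : Integrable (fun ω => c * (ρ ω * w ω) ^ 2) (volume.restrict S) := by
      refine ⟨((hρ.mul hw).pow 2).const_mul c, ?_⟩
      rw [hasFiniteIntegral_iff_ofReal (.of_forall fun ω => by positivity)]
      refine lt_of_le_of_lt (setLIntegral_mono' hS fun ω hω => ENNReal.ofReal_le_ofReal ?_) hfin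
      nlinarith [mul_le_mul_of_nonneg_left (hv ω hω) (sq_nonneg (w ω))]
    exact (integrable_const_mul_iff (isUnit_iff_ne_zero.2 hc.ne') (fun ω => (ρ ω * w ω) ^ 2)).1 h1
  exact hm.integrable one_le_two

variable {μ : Measure ℝ} [IsProbabilityMeasure μ]

/-- The function `y ↦ y^j cos(ωy)` is constant only for `j = 0` and `ω = 0`, exactly the case that
`h` excludes. -/
theorem exists_pos_le_lintegral_cos (hμ : μ ≪ volume) (j : ℕ) {S : Set ℝ} (hS : IsCompact S)
    (h : j ≠ 0 ∨ (0 : ℝ) ∉ S) :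
    ∃ c : ℝ, 0 < c ∧ ∀ ω ∈ S, ∀ e : ℝ,
      ENNReal.ofReal c ≤ ∫⁻ y, ENNReal.ofReal ((y ^ j * Real.cos (ω * y) - e) ^ 2) ∂μ := by
  refine exists_pos_le_lintegral_sq_sub hμ (φ := fun ω y => y ^ j * Real.cos (ω * y))
    (by fun_prop) hS fun ω hω c => ?_
  have hF : AnalyticOnNhd ℝ (fun y : ℝ => y ^ j * Real.cos (ω * y)) univ := fun y _ => by
    fun_prop
  have hπ := Real.pi_ne_zero
  rcases eq_or_ne ω 0 with rfl | h0
  · have hj : j ≠ 0 := h.resolve_right (not_not.2 hω)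
    exact ae_ne_of_analytic hF (y₁ := 0) (y₂ := 1) (by simp [hj]) c
  · refine ae_ne_of_analytic hF (y₁ := 0) (y₂ := Real.pi / ω) ?_ c
    rw [mul_div_cancel₀ _ h0]
    rcases eq_or_ne j 0 with rfl | hj
    · norm_num
    · simp [hj, hπ, h0]

/-- At `ω = 0` the function vanishes, so no constant lower bound is possible. Factoring out `ω`
leaves `y^(j+1) sinc(ωy)`, which is continuous in `(ω, y)` and nonconstant in `y` even at `ω = 0`;
the uniform bound for it costs only the factor `ω²`. -/
theorem exists_pos_le_lintegral_sin (hμ : μ ≪ volume) (j : ℕ) :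
    ∃ c : ℝ, 0 < c ∧ ∀ ω ∈ Icc (0 : ℝ) 1, ∀ e : ℝ,
      ENNReal.ofReal (c * ω ^ 2) ≤
        ∫⁻ y, ENNReal.ofReal ((y ^ j * Real.sin (ω * y) - e) ^ 2) ∂μ := by
  have hmul : ∀ ω y : ℝ, ω * (y ^ (j + 1) * Real.sinc (ω * y)) = y ^ j * Real.sin (ω * y) := by
    intro ω y
    rcases eq_or_ne (ω * y) 0 with h | h
    · rcases mul_eq_zero.1 h with h' | h' <;> simp [h']
    · rw [Real.sinc_of_ne_zero h]
      have h1 : ω ≠ 0 := left_ne_zero_of_mul h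
      have h2 : y ≠ 0 := right_ne_zero_of_mul h
      field_simp
      ring
  obtain ⟨c, hc, hcb⟩ := exists_pos_le_lintegral_sq_sub hμ
    (φ := fun ω y => y ^ (j + 1) * Real.sinc (ω * y)) (S := Icc (0 : ℝ) 1) (by
      have := Real.continuous_sinc
      fun_prop) isCompact_Icc fun ω _ c => by
      rcases eq_or_ne ω 0 with rfl | h0
      · simp only [zero_mul, Real.sinc_zero, mul_one]
        exact ae_ne_of_analytic (F := fun y => y ^ (j + 1)) (fun y _ => by fun_prop)
          (y₁ := 0) (y₂ := 1) (by simp) c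
      · have hF : AnalyticOnNhd ℝ (fun y : ℝ => y ^ j * Real.sin (ω * y)) univ := fun y _ => by
          fun_prop
        have := ae_ne_of_analytic hF (y₁ := 0) (y₂ := Real.pi / 2 / ω) (by
          rw [mul_div_cancel₀ _ h0]
          have := pow_ne_zero j (div_ne_zero (div_ne_zero Real.pi_ne_zero two_ne_zero) h0)
          simpa using this.symm) (ω * c)
        filter_upwards [this] with y hy hy'
        exact hy (by rw [← hmul, hy'])
  refine ⟨c, hc, fun ω hω e => ?_⟩
  rcases eq_or_ne ω 0 with rfl | h0
  · simp
  · calc ENNReal.ofReal (c * ω ^ 2) = ENNReal.ofReal (ω ^ 2) * ENNReal.ofReal c := by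
          rw [mul_comm, ENNReal.ofReal_mul (sq_nonneg _)]
      _ ≤ ENNReal.ofReal (ω ^ 2) *
            ∫⁻ y, ENNReal.ofReal ((y ^ (j + 1) * Real.sinc (ω * y) - e / ω) ^ 2) ∂μ := by
          gcongr; exact hcb ω hω _
      _ = _ := by
          rw [← lintegral_const_mul' _ _ (by simp)]
          refine lintegral_congr fun y => ?_
          rw [← ENNReal.ofReal_mul (sq_nonneg _), ← mul_pow, mul_sub, hmul, mul_div_cancel₀ _ h0]

theorem le_variance_of_le_lintegral {X : ℝ → ℝ} (hX : MemLp X 2 μ) {c : ℝ}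
    (h : ∀ e : ℝ, ENNReal.ofReal c ≤ ∫⁻ y, ENNReal.ofReal ((X y - e) ^ 2) ∂μ) :
    c ≤ variance X μ := by
  have := h (∫ z, X z ∂μ)
  rw [lintegral_sq_sub_mean hX] at this
  exact (ENNReal.ofReal_le_ofReal_iff (variance_nonneg _ _)).1 this

theorem neg_one_pow_mul_sub_sq (k : ℕ) (x e : ℝ) :
    ((-1) ^ k * x - e) ^ 2 = (x - (-1) ^ k * e) ^ 2 := by
  rcases neg_one_pow_eq_or ℝ k with h | h <;> rw [h] <;> ring

theorem exists_pos_le_variance_uRe_of_even (hμ : μ ≪ volume) {m j : ℕ}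
    (hm : MemLp id (2 * m : ℕ) μ) (hjm : j ≤ m) (hj : Even j) {S : Set ℝ} (hS : IsCompact S)
    (h : j ≠ 0 ∨ (0 : ℝ) ∉ S) : ∃ c : ℝ, 0 < c ∧ ∀ ω ∈ S, c ≤ variance (uRe j ω) μ := by
  obtain ⟨c, hc, hcb⟩ := exists_pos_le_lintegral_cos hμ j hS h
  refine ⟨c, hc, fun ω hω => le_variance_of_le_lintegral (memLp_uRe hm hjm ω) fun e => ?_⟩
  simp only [uRe, hj, if_true, neg_one_pow_mul_sub_sq]
  exact hcb ω hω _

theorem exists_pos_le_variance_uIm_of_odd (hμ : μ ≪ volume) {m j : ℕ}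
    (hm : MemLp id (2 * m : ℕ) μ) (hjm : j ≤ m) (hj : ¬ Even j) :
    ∃ c : ℝ, 0 < c ∧ ∀ ω ∈ Icc (0 : ℝ) 1, c ≤ variance (uIm j ω) μ := by
  obtain ⟨c, hc, hcb⟩ := exists_pos_le_lintegral_cos hμ j (isCompact_Icc (a := (0 : ℝ)) (b := 1))
    (Or.inl (by rintro rfl; simp at hj))
  refine ⟨c, hc, fun ω hω => le_variance_of_le_lintegral (memLp_uIm hm hjm ω) fun e => ?_⟩
  simp only [uIm, hj, if_false, neg_one_pow_mul_sub_sq]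
  exact hcb ω hω _

theorem exists_pos_le_variance_uRe_of_odd (hμ : μ ≪ volume) {m j : ℕ}
    (hm : MemLp id (2 * m : ℕ) μ) (hjm : j ≤ m) (hj : ¬ Even j) :
    ∃ c : ℝ, 0 < c ∧ ∀ ω ∈ Icc (0 : ℝ) 1, c * ω ^ 2 ≤ variance (uRe j ω) μ := by
  obtain ⟨c, hc, hcb⟩ := exists_pos_le_lintegral_sin hμ j
  refine ⟨c, hc, fun ω hω => le_variance_of_le_lintegral (memLp_uRe hm hjm ω) fun e => ?_⟩
  simp only [uRe, hj, if_false, neg_one_pow_mul_sub_sq]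
  exact hcb ω hω _

theorem exists_pos_le_variance_uIm_of_even (hμ : μ ≪ volume) {m j : ℕ}
    (hm : MemLp id (2 * m : ℕ) μ) (hjm : j ≤ m) (hj : Even j) :
    ∃ c : ℝ, 0 < c ∧ ∀ ω ∈ Icc (0 : ℝ) 1, c * ω ^ 2 ≤ variance (uIm j ω) μ := by
  obtain ⟨c, hc, hcb⟩ := exists_pos_le_lintegral_sin hμ j
  refine ⟨c, hc, fun ω hω => le_variance_of_le_lintegral (memLp_uIm hm hjm ω) fun e => ?_⟩
  simp only [uIm, hj, if_true, neg_one_pow_mul_sub_sq]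
  exact hcb ω hω _

/-- The factor `|ω|` compensates for the weight being known to be integrable only after
multiplication by `ω`; the price is one more power of `|y|`. -/
theorem abs_uRe_le_of_odd {j : ℕ} (hj : ¬ Even j) (ω y : ℝ) :
    |uRe j ω y| ≤ |ω| * |y| ^ (j + 1) := by
  simp only [uRe, hj, if_false, abs_mul, abs_pow, abs_neg, abs_one, one_pow, one_mul]
  calc |y| ^ j * |Real.sin (ω * y)| ≤ |y| ^ j * |ω * y| := by
        exact mul_le_mul_of_nonneg_left Real.abs_sin_le_abs (by positivity)
    _ = _ := by rw [abs_mul]; ring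

theorem abs_uIm_le_of_even {j : ℕ} (hj : Even j) (ω y : ℝ) :
    |uIm j ω y| ≤ |ω| * |y| ^ (j + 1) := by
  simp only [uIm, hj, if_true, abs_mul, abs_pow, abs_neg, abs_one, one_pow, one_mul]
  calc |y| ^ j * |Real.sin (ω * y)| ≤ |y| ^ j * |ω * y| := by
        exact mul_le_mul_of_nonneg_left Real.abs_sin_le_abs (by positivity)
    _ = _ := by rw [abs_mul]; ring

end WeightIntegrability

end InvDeconv

namespace InvDeconv

/-- The standing conditions on the error density. -/
structure ErrorModel (m : ℕ) (g : ℝ → ℝ) (K : ℝ) : Prop where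
  pdf : IsPdf g
  bdd : ∀ᵐ x ∂volume, g x ≤ K
  hasMoment : HasMoment (2 * m) g
  im_eq_zero : ∀ ω : ℝ, (fourier g ω).im = 0
  re_ne_zero : ∀ ω : ℝ, (fourier g ω).re ≠ 0

/-! ### Leibniz' rule for `f* = q* / g*`. -/

section Leibniz

variable {m : ℕ} {f g ψ₁ ψ₂ : ℝ → ℝ} {K Cσ : ℝ}

theorem contDiff_fourier {t : ℝ → ℝ} (ht : IsPdf t) (hm : HasMoment (2 * m) t) {k : ℕ}
    (hk : k ≤ 2 * m) : ContDiff ℝ k (fourier t) := by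
  have := isProbabilityMeasure_law ht
  rw [fourier_eq_charFun ht]
  exact contDiff_charFun_of_le (memLp_id_law ht hm) hk

theorem ErrorModel.contDiff_inv (G : ErrorModel m g K) :
    ContDiff ℝ m (fun w : ℝ => 1 / (fourier g w).re) :=
  contDiff_const.div (contDiff_re (contDiff_fourier G.pdf G.hasMoment (by omega))) G.re_ne_zero

theorem ErrorModel.continuous_invDeriv (G : ErrorModel m g K) {k : ℕ} (hk : k ≤ m) :
    Continuous (invDeriv g k) :=
  G.contDiff_inv.continuous_iteratedDeriv k (by exact_mod_cast hk)

theorem ErrorModel.isProbabilityMeasure (G : ErrorModel m g K) (hf : IsPdf f) :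
    IsProbabilityMeasure (obsLaw f g) := isProbabilityMeasure_obsLaw hf G.pdf

theorem ErrorModel.memLp_id (G : ErrorModel m g K) (hf : IsPdf f) (hm : HasMoment (2 * m) f) :
    MemLp id (2 * m : ℕ) (obsLaw f g) := memLp_id_obsLaw hf G.pdf hm G.hasMoment

theorem ErrorModel.re_fourier (G : ErrorModel m g K) (hf : IsPdf f) :
    (fun w => (fourier f w).re) =
      (fun w => (charFun (obsLaw f g) w).re) * fun w => 1 / (fourier g w).re := by
  ext w
  simp only [Pi.mul_apply]
  rw [charFun_obsLaw hf G.pdf, Complex.mul_re, G.im_eq_zero]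
  have := G.re_ne_zero w
  field_simp
  ring

theorem ErrorModel.im_fourier (G : ErrorModel m g K) (hf : IsPdf f) :
    (fun w => (fourier f w).im) =
      (fun w => (charFun (obsLaw f g) w).im) * fun w => 1 / (fourier g w).re := by
  ext w
  simp only [Pi.mul_apply]
  rw [charFun_obsLaw hf G.pdf, Complex.mul_im, G.im_eq_zero]
  have := G.re_ne_zero w
  field_simp
  ring

/-- Leibniz' rule for `Re f* = Re q* · (1 / g*)`, valid because `g*` is real. It explains the
binomial coefficients in the estimator and gives the unbiasedness of each of its parts. -/
theorem ErrorModel.iteratedDeriv_re_fourier (G : ErrorModel m g K) (hf : IsPdf f)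
    (hm : HasMoment (2 * m) f) {k : ℕ} (hk : k ≤ m) (ω : ℝ) :
    iteratedDeriv k (fun w => (fourier f w).re) ω = ∑ j ∈ Finset.range (k + 1),
      (k.choose j : ℝ) * (invDeriv g (k - j) ω * ∫ y, uRe j ω y ∂(obsLaw f g)) := by
  have := G.isProbabilityMeasure hf
  have hq := G.memLp_id hf hm
  rw [G.re_fourier hf, iteratedDeriv_mul
    (contDiff_re (contDiff_charFun_of_le hq (by omega))).contDiffAt
    (G.contDiff_inv.of_le (by exact_mod_cast hk)).contDiffAt]
  refine Finset.sum_congr rfl fun j hj => ?_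
  rw [iteratedDeriv_re_charFun hq (by simp at hj; omega), invDeriv]
  ring

theorem ErrorModel.iteratedDeriv_im_fourier (G : ErrorModel m g K) (hf : IsPdf f)
    (hm : HasMoment (2 * m) f) {k : ℕ} (hk : k ≤ m) (ω : ℝ) :
    iteratedDeriv k (fun w => (fourier f w).im) ω = ∑ j ∈ Finset.range (k + 1),
      (k.choose j : ℝ) * (invDeriv g (k - j) ω * ∫ y, uIm j ω y ∂(obsLaw f g)) := by
  have := G.isProbabilityMeasure hf
  have hq := G.memLp_id hf hm
  rw [G.im_fourier hf, iteratedDeriv_mul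
    (contDiff_im (contDiff_charFun_of_le hq (by omega))).contDiffAt
    (G.contDiff_inv.of_le (by exact_mod_cast hk)).contDiffAt]
  refine Finset.sum_congr rfl fun j hj => ?_
  rw [iteratedDeriv_im_charFun hq (by simp at hj; omega), invDeriv]
  ring

end Leibniz

/-! ### Absolute convergence of the integrals over the unit interval. -/

section UnitInterval

variable {S : Set ℝ}

theorem integrableOn_mul_of_abs_le {w φ : ℝ → ℝ} (hw : IntegrableOn w S)
    (hφ : Measurable φ) {C : ℝ} (hb : ∀ ω, |φ ω| ≤ C) : IntegrableOn (fun ω => w ω * φ ω) S :=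
  hw.mul_bdd hφ.aestronglyMeasurable (.of_forall hb)

theorem integrableOn_mul_of_abs_le_mul {w φ : ℝ → ℝ} (hwm : Measurable w)
    (hw : IntegrableOn (fun ω => ω * w ω) S)
    (hφ : Measurable φ) {C : ℝ} (hb : ∀ ω, |φ ω| ≤ |ω| * C) :
    IntegrableOn (fun ω => w ω * φ ω) S := by
  refine (hw.norm.const_mul C).mono' (hwm.mul hφ).aestronglyMeasurable (.of_forall fun ω => ?_)
  rw [Real.norm_eq_abs, Real.norm_eq_abs, abs_mul, abs_mul]
  nlinarith [mul_le_mul_of_nonneg_left (hb ω) (abs_nonneg (w ω))]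

theorem abs_integral_le_of_abs_le {μ : Measure ℝ} {φ b : ℝ → ℝ} (hb : Integrable b μ) (h : ∀ y, |φ y| ≤ b y) :
    |∫ y, φ y ∂μ| ≤ ∫ y, b y ∂μ :=
  (Real.norm_eq_abs _).symm.trans_le (norm_integral_le_of_norm_le hb (.of_forall h))

theorem measurable_uRe_left (j : ℕ) (y : ℝ) : Measurable fun ω => uRe j ω y :=
  ((continuous_uRe j).comp (Continuous.prodMk_left y)).measurable

theorem measurable_uIm_left (j : ℕ) (y : ℝ) : Measurable fun ω => uIm j ω y :=
  ((continuous_uIm j).comp (Continuous.prodMk_left y)).measurable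

variable {μ : Measure ℝ} [IsProbabilityMeasure μ]

theorem measurable_integral_uRe (j : ℕ) : Measurable fun ω => ∫ y, uRe j ω y ∂μ :=
  ((continuous_uRe j).stronglyMeasurable.integral_prod_right (ν := μ)).measurable

theorem measurable_integral_uIm (j : ℕ) : Measurable fun ω => ∫ y, uIm j ω y ∂μ :=
  ((continuous_uIm j).stronglyMeasurable.integral_prod_right (ν := μ)).measurable

variable {m : ℕ} {f g ψ₁ ψ₂ : ℝ → ℝ} {K Cσ : ℝ}

theorem Admissible.lintegral_re_lt_top (hA : Admissible m g ψ₁ ψ₂ Cσ f) {j : ℕ} (hj : j ≤ m)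
    {T : Set ℝ} (hT : T ⊆ Icc 0 1) :
    ∫⁻ ω in T, ENNReal.ofReal ((invDeriv g (m - j) ω * ψ₁ ω) ^ 2 *
      variance (uRe j ω) (obsLaw f g)) < ⊤ := by
  refine ((lintegral_mono_set hT).trans ?_).trans_lt (ENNReal.ofReal_lt_top (r := Cσ))
  simpa only [mul_pow, sq_abs, sigmaSqRe] using hA.variance_re j hj

theorem Admissible.lintegral_im_lt_top (hA : Admissible m g ψ₁ ψ₂ Cσ f) {j : ℕ} (hj : j ≤ m)
    {T : Set ℝ} (hT : T ⊆ Icc 0 1) :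
    ∫⁻ ω in T, ENNReal.ofReal ((invDeriv g (m - j) ω * ψ₂ ω) ^ 2 *
      variance (uIm j ω) (obsLaw f g)) < ⊤ := by
  refine ((lintegral_mono_set hT).trans ?_).trans_lt (ENNReal.ofReal_lt_top (r := Cσ))
  simpa only [mul_pow, sq_abs, sigmaSqIm] using hA.variance_im j hj

/-- The left end `δ` keeps away from `ω = 0`, where the variance for `j = 0` vanishes; for `j ≠ 0`
one may take `δ = 0`. -/
theorem ErrorModel.integrableOn_re_even (G : ErrorModel m g K)
    (hA : Admissible m g ψ₁ ψ₂ Cσ f) (hψ : Measurable ψ₁) {j : ℕ} (hj : j ≤ m) (he : Even j)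
    {δ : ℝ} (hδ : 0 ≤ δ) (h : j ≠ 0 ∨ 0 < δ) :
    IntegrableOn (fun ω => invDeriv g (m - j) ω * ψ₁ ω) (Icc δ 1) := by
  have := G.isProbabilityMeasure hA.pdf
  obtain ⟨c, hc, hcv⟩ := exists_pos_le_variance_uRe_of_even
    (obsLaw_absolutelyContinuous hA.pdf G.pdf G.bdd) (G.memLp_id hA.pdf hA.hasMoment) hj he
    (S := Icc δ 1) isCompact_Icc (h.imp_right fun h h' => absurd h'.1 (not_le.2 h))
  have := integrableOn_mul_of_lintegral_sq (S := Icc δ 1) measurableSet_Icc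
    (by simp) (ρ := fun _ => 1)
    ((G.continuous_invDeriv (by omega)).measurable.mul hψ).aestronglyMeasurable
    aestronglyMeasurable_const hc (fun ω hω => by simpa using hcv ω hω)
    (hA.lintegral_re_lt_top hj (Icc_subset_Icc_left hδ))
  simpa using this

theorem ErrorModel.integrableOn_re_odd (G : ErrorModel m g K)
    (hA : Admissible m g ψ₁ ψ₂ Cσ f) (hψ : Measurable ψ₁) {j : ℕ} (hj : j ≤ m) (he : ¬ Even j) :
    IntegrableOn (fun ω => ω * (invDeriv g (m - j) ω * ψ₁ ω)) (Icc 0 1) := by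
  have := G.isProbabilityMeasure hA.pdf
  obtain ⟨c, hc, hcv⟩ := exists_pos_le_variance_uRe_of_odd
    (obsLaw_absolutelyContinuous hA.pdf G.pdf G.bdd) (G.memLp_id hA.pdf hA.hasMoment) hj he
  exact integrableOn_mul_of_lintegral_sq (S := Icc 0 1) measurableSet_Icc
    (by simp) (ρ := fun ω => ω)
    ((G.continuous_invDeriv (by omega)).measurable.mul hψ).aestronglyMeasurable
    (by fun_prop) hc hcv (hA.lintegral_re_lt_top hj subset_rfl)

theorem ErrorModel.integrableOn_im_odd (G : ErrorModel m g K)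
    (hA : Admissible m g ψ₁ ψ₂ Cσ f) (hψ : Measurable ψ₂) {j : ℕ} (hj : j ≤ m) (he : ¬ Even j) :
    IntegrableOn (fun ω => invDeriv g (m - j) ω * ψ₂ ω) (Icc 0 1) := by
  have := G.isProbabilityMeasure hA.pdf
  obtain ⟨c, hc, hcv⟩ := exists_pos_le_variance_uIm_of_odd
    (obsLaw_absolutelyContinuous hA.pdf G.pdf G.bdd) (G.memLp_id hA.pdf hA.hasMoment) hj he
  have := integrableOn_mul_of_lintegral_sq (S := Icc 0 1) measurableSet_Icc
    (by simp) (ρ := fun _ => 1)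
    ((G.continuous_invDeriv (by omega)).measurable.mul hψ).aestronglyMeasurable
    aestronglyMeasurable_const hc (fun ω hω => by simpa using hcv ω hω)
    (hA.lintegral_im_lt_top hj subset_rfl)
  simpa using this

theorem ErrorModel.integrableOn_im_even (G : ErrorModel m g K)
    (hA : Admissible m g ψ₁ ψ₂ Cσ f) (hψ : Measurable ψ₂) {j : ℕ} (hj : j ≤ m) (he : Even j) :
    IntegrableOn (fun ω => ω * (invDeriv g (m - j) ω * ψ₂ ω)) (Icc 0 1) := by
  have := G.isProbabilityMeasure hA.pdf
  obtain ⟨c, hc, hcv⟩ := exists_pos_le_variance_uIm_of_even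
    (obsLaw_absolutelyContinuous hA.pdf G.pdf G.bdd) (G.memLp_id hA.pdf hA.hasMoment) hj he
  exact integrableOn_mul_of_lintegral_sq (S := Icc 0 1) measurableSet_Icc
    (by simp) (ρ := fun ω => ω)
    ((G.continuous_invDeriv (by omega)).measurable.mul hψ).aestronglyMeasurable
    (by fun_prop) hc hcv (hA.lintegral_im_lt_top hj subset_rfl)

theorem ErrorModel.integrableOn_mul_uIm (G : ErrorModel m g K)
    (hA : Admissible m g ψ₁ ψ₂ Cσ f) (hψ : Measurable ψ₂) {j : ℕ} (hj : j ≤ m) (y : ℝ) :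
    IntegrableOn (fun ω => invDeriv g (m - j) ω * ψ₂ ω * uIm j ω y) (Icc 0 1) := by
  by_cases he : Even j
  · exact integrableOn_mul_of_abs_le_mul ((G.continuous_invDeriv (by omega)).measurable.mul hψ)
      (G.integrableOn_im_even hA hψ hj he) (measurable_uIm_left j y)
      (fun ω => abs_uIm_le_of_even he ω y)
  · exact integrableOn_mul_of_abs_le (G.integrableOn_im_odd hA hψ hj he)
      (measurable_uIm_left j y) (fun ω => abs_uIm_le j ω y)

theorem integrableOn_Icc_zero_one_of_Ioi {φ : ℝ → ℝ} (h : IntegrableOn φ (Ioi 0)) :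
    IntegrableOn φ (Icc 0 1) := by
  rw [integrableOn_Icc_iff_integrableOn_Ioc]
  exact h.mono_set Ioc_subset_Ioi_self

theorem ErrorModel.integrableOn_mul_integral_uIm (G : ErrorModel m g K)
    (hA : Admissible m g ψ₁ ψ₂ Cσ f) (hψ : Measurable ψ₂) {j : ℕ} (hj : j ≤ m) :
    IntegrableOn (fun ω => invDeriv g (m - j) ω * ψ₂ ω * ∫ y, uIm j ω y ∂(obsLaw f g))
      (Icc 0 1) := by
  have := G.isProbabilityMeasure hA.pdf
  have hq := G.memLp_id hA.pdf hA.hasMoment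
  by_cases he : Even j
  -- The sine bound needs the moment of order `j + 1`, which is at most `2m` only when `m ≥ 1`. For
  -- `m = 0` the Leibniz sum has a single term, so the function is itself the integrand of `Φ`.
  · rcases Nat.eq_zero_or_pos m with rfl | hm
    · obtain rfl : j = 0 := by omega
      refine (integrableOn_Icc_zero_one_of_Ioi hA.integrable_im).congr (.of_forall fun ω => ?_)
      simp only [G.iteratedDeriv_im_fourier hA.pdf hA.hasMoment le_rfl]
      simp
      ring
    · refine integrableOn_mul_of_abs_le_mul ((G.continuous_invDeriv (by omega)).measurable.mul hψ)
        (G.integrableOn_im_even hA hψ hj he) (measurable_integral_uIm j)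
        (C := ∫ y, |y| ^ (j + 1) ∂(obsLaw f g)) fun ω => ?_
      rw [← integral_const_mul]
      exact abs_integral_le_of_abs_le
        ((integrable_abs_pow_of_memLp hq (by omega)).const_mul _)
        fun y => abs_uIm_le_of_even he ω y
  · exact integrableOn_mul_of_abs_le (G.integrableOn_im_odd hA hψ hj he)
      (measurable_integral_uIm j) (fun ω => abs_integral_le_of_abs_le
        (integrable_abs_pow_of_memLp hq (by omega)) fun y => abs_uIm_le j ω y)

theorem ErrorModel.integrableOn_mul_integral_uRe_of_ne_zero (G : ErrorModel m g K)
    (hA : Admissible m g ψ₁ ψ₂ Cσ f) (hψ : Measurable ψ₁) {j : ℕ} (hj : j ≤ m) (hj0 : j ≠ 0) :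
    IntegrableOn (fun ω => invDeriv g (m - j) ω * ψ₁ ω * ∫ y, uRe j ω y ∂(obsLaw f g))
      (Icc 0 1) := by
  have := G.isProbabilityMeasure hA.pdf
  have hq := G.memLp_id hA.pdf hA.hasMoment
  by_cases he : Even j
  · exact integrableOn_mul_of_abs_le (G.integrableOn_re_even hA hψ hj he le_rfl (Or.inl hj0))
      (measurable_integral_uRe j) (fun ω => abs_integral_le_of_abs_le
        (integrable_abs_pow_of_memLp hq (by omega)) fun y => abs_uRe_le j ω y)
  · refine integrableOn_mul_of_abs_le_mul ((G.continuous_invDeriv (by omega)).measurable.mul hψ)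
      (G.integrableOn_re_odd hA hψ hj he) (measurable_integral_uRe j)
      (C := ∫ y, |y| ^ (j + 1) ∂(obsLaw f g)) fun ω => ?_
    rw [← integral_const_mul]
    exact abs_integral_le_of_abs_le
      ((integrable_abs_pow_of_memLp hq (by omega)).const_mul _)
      fun y => abs_uRe_le_of_odd he ω y

/-- The term `j = 0` is the integrand of `Φ` minus the other Leibniz terms, all of which are already
integrable. The absolute convergence of `Φ` thus replaces the variance bound that is missing here.
-/
theorem ErrorModel.integrableOn_mul_integral_uRe_zero (G : ErrorModel m g K)
    (hA : Admissible m g ψ₁ ψ₂ Cσ f) (hψ : Measurable ψ₁) :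
    IntegrableOn (fun ω => invDeriv g (m - 0) ω * ψ₁ ω * ∫ y, uRe 0 ω y ∂(obsLaw f g))
      (Icc 0 1) := by
  have h1 := integrableOn_Icc_zero_one_of_Ioi hA.integrable_re
  have h2 : IntegrableOn (fun ω => ∑ j ∈ Finset.range m, (m.choose (j + 1) : ℝ) *
      (invDeriv g (m - (j + 1)) ω * ψ₁ ω * ∫ y, uRe (j + 1) ω y ∂(obsLaw f g))) (Icc 0 1) :=
    integrable_finsetSum _ fun j hj =>
      (G.integrableOn_mul_integral_uRe_of_ne_zero hA hψ (by simp at hj; omega)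
        (Nat.succ_ne_zero j)).const_mul _
  refine (h1.sub h2).congr (.of_forall fun ω => ?_)
  simp only [Pi.sub_apply]
  rw [G.iteratedDeriv_re_fourier hA.pdf hA.hasMoment le_rfl, Finset.sum_range_succ', mul_add,
    Finset.mul_sum, add_sub_right_comm, ← Finset.sum_sub_distrib, Finset.sum_eq_zero]
  · simp
    ring
  · intro j _
    ring

/-- Near `ω = 0` the factor `Re q*` is at least `1/2`, because `q*(0) = 1` and `q*` is continuous,
so it can be divided out of the preceding integrability. Away from `0` the variance is bounded
below. -/
theorem ErrorModel.integrableOn_re_zero (G : ErrorModel m g K)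
    (hA : Admissible m g ψ₁ ψ₂ Cσ f) (hψ : Measurable ψ₁) :
    IntegrableOn (fun ω => invDeriv g (m - 0) ω * ψ₁ ω) (Icc 0 1) := by
  have := G.isProbabilityMeasure hA.pdf
  set e : ℝ → ℝ := fun ω => ∫ y, uRe 0 ω y ∂(obsLaw f g)
  have he : e = fun ω => (charFun (obsLaw f g) ω).re := by
    ext ω
    change ∫ y, uRe 0 ω y ∂(obsLaw f g) = _
    rw [← iteratedDeriv_re_charFun (G.memLp_id hA.pdf hA.hasMoment) (Nat.zero_le _),
      iteratedDeriv_zero]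
  have hec : Continuous e := by
    rw [he]; exact Complex.continuous_re.comp continuous_charFun
  have he0 : e 0 = 1 := by simp [he]
  obtain ⟨δ, hδ, hδe⟩ := Metric.continuousAt_iff.1 (hec.continuousAt (x := 0)) (1 / 2) (by norm_num)
  have hlow : ∀ ω ∈ Icc 0 (δ / 2), 1 / 2 ≤ e ω := fun ω hω => by
    have := hδe (by
      rw [Real.dist_eq, sub_zero, abs_of_nonneg hω.1]; linarith [hω.2])
    rw [he0, Real.dist_eq] at this
    linarith [(abs_lt.1 this).1]
  have hwm : Measurable fun ω => invDeriv g (m - 0) ω * ψ₁ ω :=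
    (G.continuous_invDeriv (by omega)).measurable.mul hψ
  have h1 : IntegrableOn (fun ω => invDeriv g (m - 0) ω * ψ₁ ω) (Icc 0 (δ / 2) ∩ Icc 0 1) := by
    refine (((G.integrableOn_mul_integral_uRe_zero hA hψ).mono_set
      inter_subset_right).norm.const_mul 2).mono' hwm.aestronglyMeasurable ?_
    filter_upwards [ae_restrict_mem (measurableSet_Icc.inter measurableSet_Icc)] with ω hω
    rw [norm_mul _ (∫ y, uRe 0 ω y ∂(obsLaw f g))]
    have h2 : 1 / 2 ≤ ‖∫ y, uRe 0 ω y ∂(obsLaw f g)‖ := (hlow ω hω.1).trans (le_abs_self _)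
    nlinarith [norm_nonneg (invDeriv g (m - 0) ω * ψ₁ ω)]
  refine (h1.union (G.integrableOn_re_even hA hψ (Nat.zero_le m) (by simp) (δ := δ / 2)
    (by positivity) (Or.inr (by positivity)))).mono_set fun ω hω => ?_
  rcases le_total ω (δ / 2) with h | h
  · exact Or.inl ⟨⟨hω.1, h⟩, hω⟩
  · exact Or.inr ⟨h, hω.2⟩

theorem ErrorModel.integrableOn_mul_integral_uRe (G : ErrorModel m g K)
    (hA : Admissible m g ψ₁ ψ₂ Cσ f) (hψ : Measurable ψ₁) {j : ℕ} (hj : j ≤ m) :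
    IntegrableOn (fun ω => invDeriv g (m - j) ω * ψ₁ ω * ∫ y, uRe j ω y ∂(obsLaw f g))
      (Icc 0 1) := by
  rcases eq_or_ne j 0 with rfl | hj0
  · exact G.integrableOn_mul_integral_uRe_zero hA hψ
  · exact G.integrableOn_mul_integral_uRe_of_ne_zero hA hψ hj hj0

theorem ErrorModel.integrableOn_mul_uRe (G : ErrorModel m g K)
    (hA : Admissible m g ψ₁ ψ₂ Cσ f) (hψ : Measurable ψ₁) {j : ℕ} (hj : j ≤ m) (y : ℝ) :
    IntegrableOn (fun ω => invDeriv g (m - j) ω * ψ₁ ω * uRe j ω y) (Icc 0 1) := by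
  rcases eq_or_ne j 0 with rfl | hj0
  · exact integrableOn_mul_of_abs_le (G.integrableOn_re_zero hA hψ)
      (measurable_uRe_left 0 y) (fun ω => abs_uRe_le 0 ω y)
  by_cases he : Even j
  · exact integrableOn_mul_of_abs_le (G.integrableOn_re_even hA hψ hj he le_rfl (Or.inl hj0))
      (measurable_uRe_left j y) (fun ω => abs_uRe_le j ω y)
  · exact integrableOn_mul_of_abs_le_mul ((G.continuous_invDeriv (by omega)).measurable.mul hψ)
      (G.integrableOn_re_odd hA hψ hj he) (measurable_uRe_left j y)
      (fun ω => abs_uRe_le_of_odd he ω y)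

end UnitInterval

end InvDeconv

namespace InvDeconv

/-- `X` is square integrable with mean `e` and variance at most `v`. -/
structure MeanVar {Ω : Type*} [MeasurableSpace Ω] (X : Ω → ℝ) (μ : Measure Ω) (e v : ℝ) :
    Prop where
  memLp : MemLp X 2 μ
  mean : ∫ y, X y ∂μ = e
  variance_le : variance X μ ≤ v

/-! ### Calculus of means and variance bounds; the mean squared error of an average. -/

section MeanVar

variable {Ω : Type*} [MeasurableSpace Ω] {μ : Measure Ω}
  {X X' : Ω → ℝ} {e e' v v' : ℝ}

theorem MeanVar.mono (h : MeanVar X μ e v) (hv : v ≤ v') : MeanVar X μ e v' :=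
  ⟨h.memLp, h.mean, h.variance_le.trans hv⟩

theorem MeanVar.nonneg (h : MeanVar X μ e v) : 0 ≤ v := (variance_nonneg _ _).trans h.variance_le

theorem MeanVar.const_mul (h : MeanVar X μ e v) (c : ℝ) :
    MeanVar (fun y => c * X y) μ (c * e) (c ^ 2 * v) :=
  ⟨h.memLp.const_mul c, by rw [integral_const_mul, h.mean], by
    rw [variance_const_mul]; exact mul_le_mul_of_nonneg_left h.variance_le (sq_nonneg _)⟩

variable [IsProbabilityMeasure μ]

/-- Cauchy–Schwarz for the centred sum. No covariance is needed; the price is the cardinality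
factor, harmless since only fixed numbers of terms are added. -/
theorem MeanVar.sum {ι : Type*} (s : Finset ι) {X : ι → Ω → ℝ} {e v : ι → ℝ}
    (h : ∀ i ∈ s, MeanVar (X i) μ (e i) (v i)) :
    MeanVar (fun y => ∑ i ∈ s, X i y) μ (∑ i ∈ s, e i) (s.card * ∑ i ∈ s, v i) := by
  have hmem : MemLp (fun y => ∑ i ∈ s, X i y) 2 μ := memLp_finsetSum s fun i hi => (h i hi).memLp
  have hmean : ∫ y, ∑ i ∈ s, X i y ∂μ = ∑ i ∈ s, e i := by
    rw [integral_finsetSum _ fun i hi => (h i hi).memLp.integrable one_le_two]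
    exact Finset.sum_congr rfl fun i hi => (h i hi).mean
  have hsq : ∀ i ∈ s, Integrable (fun y => (X i y - e i) ^ 2) μ := fun i hi =>
    ((h i hi).memLp.sub (memLp_const _)).integrable_sq
  have hvar : ∀ i ∈ s, ∫ y, (X i y - e i) ^ 2 ∂μ ≤ v i := fun i hi => by
    have := (h i hi).variance_le
    rwa [variance_eq_integral (h i hi).memLp.aestronglyMeasurable.aemeasurable,
      (h i hi).mean] at this
  refine ⟨hmem, hmean, ?_⟩
  rw [variance_eq_integral hmem.aestronglyMeasurable.aemeasurable, hmean]
  calc ∫ y, (∑ i ∈ s, X i y - ∑ i ∈ s, e i) ^ 2 ∂μ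
      ≤ ∫ y, (s.card : ℝ) * ∑ i ∈ s, (X i y - e i) ^ 2 ∂μ := by
        refine integral_mono (hmem.sub (memLp_const _)).integrable_sq
          ((integrable_finsetSum _ hsq).const_mul _) fun y => ?_
        simp only
        rw [← Finset.sum_sub_distrib]
        exact sq_sum_le_card_mul_sum_sq
    _ = s.card * ∑ i ∈ s, ∫ y, (X i y - e i) ^ 2 ∂μ := by
        rw [integral_const_mul, integral_finsetSum _ hsq]
    _ ≤ _ := by gcongr with i hi; exact hvar i hi

theorem MeanVar.add (h : MeanVar X μ e v) (h' : MeanVar X' μ e' v') :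
    MeanVar (fun y => X y + X' y) μ (e + e') (2 * (v + v')) := by
  have := MeanVar.sum (μ := μ) (Finset.univ : Finset (Fin 2)) (X := ![X, X']) (e := ![e, e'])
    (v := ![v, v']) (fun i _ => by fin_cases i <;> assumption)
  simpa using this

/-- The variance is at most the second moment about any point, so `c` need not be the mean. -/
theorem MeanVar.of_lintegral_le (hX : AEStronglyMeasurable X μ) (hmean : ∫ y, X y ∂μ = e)
    (c : ℝ) (hv : 0 ≤ v) (h : ∫⁻ y, ENNReal.ofReal ((X y - c) ^ 2) ∂μ ≤ ENNReal.ofReal v) :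
    MeanVar X μ e v := by
  have hm : MemLp (fun y => X y - c) 2 μ := by
    refine (memLp_two_iff_integrable_sq (hX.sub aestronglyMeasurable_const)).2
      ⟨(hX.sub aestronglyMeasurable_const).pow 2, ?_⟩
    rw [hasFiniteIntegral_iff_ofReal (.of_forall fun y => sq_nonneg _)]
    exact h.trans_lt ENNReal.ofReal_lt_top
  have hX2 : MemLp X 2 μ := by
    have := hm.add (memLp_const c)
    simpa [Pi.add_def] using this
  refine ⟨hX2, hmean, ?_⟩
  have h1 : variance X μ = variance (fun y => X y - c) μ := (variance_sub_const hX c).symm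
  rw [h1]
  refine (variance_le_expectation_sq (hX.sub aestronglyMeasurable_const)).trans ?_
  rw [← ENNReal.ofReal_le_ofReal_iff hv]
  refine le_trans (le_of_eq ?_) h
  exact ofReal_integral_eq_lintegral_ofReal hm.integrable_sq (.of_forall fun y => sq_nonneg _)

end MeanVar

/-- The bias–variance decomposition. -/
theorem lintegral_sq_sub_eq {Ω : Type*} [MeasurableSpace Ω] {P : Measure Ω}
    [IsProbabilityMeasure P] {X : Ω → ℝ} (hX : MemLp X 2 P) (p : ℝ) :
    ∫⁻ x, ENNReal.ofReal ((X x - p) ^ 2) ∂P =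
      ENNReal.ofReal (variance X P + ((∫ x, X x ∂P) - p) ^ 2) := by
  have h1 : MemLp (fun x => X x - p) 2 P := hX.sub (memLp_const p)
  rw [← ofReal_integral_eq_lintegral_ofReal h1.integrable_sq (.of_forall fun y => sq_nonneg _)]
  congr 1
  have h2 := variance_eq_sub h1
  have h3 : variance (fun x => X x - p) P = variance X P :=
    variance_sub_const hX.aestronglyMeasurable p
  rw [h3, integral_sub (hX.integrable one_le_two) (integrable_const p)] at h2
  simp only [integral_const, probReal_univ, smul_eq_mul, one_mul, Pi.pow_apply] at h2
  linarith

/-- The mean squared error of an average over a sample. -/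
theorem IsSample.lintegral_sq_mean_sub_le {f g : ℝ → ℝ} {n : ℕ} (hn : 1 ≤ n) {Ω : Type u}
    [MeasurableSpace Ω] {P : Measure Ω} [IsProbabilityMeasure P] {Y : Fin n → Ω → ℝ}
    (hY : IsSample f g P Y) [IsProbabilityMeasure (obsLaw f g)] {Z : ℝ → ℝ} {e v : ℝ}
    (hZ : MeanVar Z (obsLaw f g) e v) (hZm : Measurable Z) (p : ℝ) :
    ∫⁻ x, ENNReal.ofReal (((n : ℝ)⁻¹ * ∑ l, Z (Y l x) - p) ^ 2) ∂P ≤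
      ENNReal.ofReal ((n : ℝ)⁻¹ * v + (e - p) ^ 2) := by
  have hn0 : (n : ℝ) ≠ 0 := by positivity
  have hmem : ∀ l, MemLp (fun x => Z (Y l x)) 2 P := fun l =>
    hZ.memLp.comp_measurePreserving ⟨hY.measurable l, hY.law_eq l⟩
  have hmean : ∀ l, ∫ x, Z (Y l x) ∂P = e := fun l => by
    rw [← hZ.mean, ← hY.law_eq l, integral_map (hY.measurable l).aemeasurable
      hZm.aestronglyMeasurable]
  have hvar : ∀ l, variance (fun x => Z (Y l x)) P ≤ v := fun l => by
    have h := variance_map (μ := P) (X := Z) (Y := Y l) (by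
      rw [hY.law_eq l]; exact hZ.memLp.aestronglyMeasurable.aemeasurable)
      (hY.measurable l).aemeasurable
    rw [hY.law_eq l] at h
    exact h.symm.trans_le hZ.variance_le
  have hind : iIndepFun (fun l => Z ∘ Y l) P := hY.indep.comp (fun _ => Z) fun _ => hZm
  have hsum : MemLp (fun x => ∑ l, Z (Y l x)) 2 P := memLp_finsetSum _ fun l _ => hmem l
  have hvs : variance (fun x => ∑ l, Z (Y l x)) P ≤ n * v := by
    have h := IndepFun.variance_sum (μ := P) (X := fun l => Z ∘ Y l) (s := Finset.univ)
      (fun l _ => hmem l) fun i _ j _ hij => hind.indepFun hij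
    have h2 : (∑ l, Z ∘ Y l) = fun x => ∑ l, Z (Y l x) := by
      ext x; simp
    rw [h2] at h
    rw [h]
    calc ∑ l, variance (Z ∘ Y l) P ≤ ∑ _l : Fin n, v := Finset.sum_le_sum fun l _ => hvar l
      _ = n * v := by simp
  rw [lintegral_sq_sub_eq (hsum.const_mul _)]
  refine ENNReal.ofReal_le_ofReal ?_
  rw [variance_const_mul, integral_const_mul, integral_finsetSum _ fun l _ =>
    (hmem l).integrable one_le_two]
  simp only [hmean, Finset.sum_const, Finset.card_univ, Fintype.card_fin, nsmul_eq_mul]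
  rw [inv_mul_cancel_left₀ hn0]
  have h3 : ((n : ℝ)⁻¹) ^ 2 * (n * v) = (n : ℝ)⁻¹ * v := by field_simp
  have h4 := mul_le_mul_of_nonneg_left hvs (sq_nonneg ((n : ℝ)⁻¹))
  linarith

/-- Mean and variance of `∫₀¹ w(ω) φ(ω, Y) dω`. -/
theorem meanVar_setIntegral {μ : Measure ℝ} [IsProbabilityMeasure μ] {φ : ℝ → ℝ → ℝ} {w : ℝ → ℝ}
    (hφ : Continuous (fun p : ℝ × ℝ => φ p.1 p.2)) (hw : Measurable w)
    (hφ2 : ∀ ω, MemLp (φ ω) 2 μ)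
    (hint : ∀ y, IntegrableOn (fun ω => w ω * φ ω y) (Icc 0 1))
    (hmint : IntegrableOn (fun ω => w ω * ∫ y, φ ω y ∂μ) (Icc 0 1)) {v : ℝ} (hv : 0 ≤ v)
    (hvar : ∫⁻ ω in Icc (0 : ℝ) 1, ENNReal.ofReal (w ω ^ 2 * variance (φ ω) μ) ≤
      ENNReal.ofReal v) :
    MeanVar (fun y => ∫ ω in Icc (0 : ℝ) 1, w ω * φ ω y) μ
      (∫ ω in Icc (0 : ℝ) 1, w ω * ∫ y, φ ω y ∂μ) v := by
  set ν : Measure ℝ := volume.restrict (Icc (0 : ℝ) 1)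
  have hν : IsProbabilityMeasure ν := ⟨by simp [ν]⟩
  set e : ℝ → ℝ := fun ω => ∫ y, φ ω y ∂μ
  have hem : Measurable e := (hφ.stronglyMeasurable.integral_prod_right (ν := μ)).measurable
  -- Only the centred integrand is known to be square integrable on the product, by `hvar`; Fubini
  -- is therefore applied to `D`, and the mean is recovered from `hcent`.
  set D : ℝ × ℝ → ℝ := fun p => w p.1 * (φ p.1 p.2 - e p.1)
  have hDm : Measurable D := (hw.comp measurable_fst).mul
    (hφ.measurable.sub (hem.comp measurable_fst))
  have hDsq : ∫⁻ p, ENNReal.ofReal (D p ^ 2) ∂(ν.prod μ) ≤ ENNReal.ofReal v := by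
    rw [lintegral_prod _ (by fun_prop)]
    refine le_trans (le_of_eq (lintegral_congr fun ω => ?_)) hvar
    simp only [D, mul_pow]
    simp_rw [ENNReal.ofReal_mul (sq_nonneg (w ω))]
    rw [lintegral_const_mul' _ _ (by simp), lintegral_sq_sub_mean (hφ2 ω)]
  have hD2 : MemLp D 2 (ν.prod μ) := by
    refine (memLp_two_iff_integrable_sq hDm.aestronglyMeasurable).2
      ⟨(hDm.pow_const 2).aestronglyMeasurable, ?_⟩
    rw [hasFiniteIntegral_iff_ofReal (.of_forall fun y => sq_nonneg _)]
    exact hDsq.trans_lt ENNReal.ofReal_lt_top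
  have hD1 : Integrable D (ν.prod μ) := hD2.integrable one_le_two
  have hDy : ∀ y, ∫ ω, D (ω, y) ∂ν = (∫ ω, w ω * φ ω y ∂ν) - ∫ ω, w ω * e ω ∂ν := fun y => by
    rw [← integral_sub (hint y) hmint]
    refine integral_congr_ae (.of_forall fun ω => ?_)
    simp only [D]
    ring
  have hDint : ∀ y, Integrable (fun ω => D (ω, y)) ν := fun y => by
    refine ((hint y).sub hmint).congr (.of_forall fun ω => ?_)
    simp only [D, Pi.sub_apply]
    ring
  have hZm : AEStronglyMeasurable (fun y => ∫ ω, w ω * φ ω y ∂ν) μ := by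
    have : StronglyMeasurable (Function.uncurry fun y ω => w ω * φ ω y) :=
      ((hw.comp measurable_snd).mul
        (hφ.measurable.comp (measurable_snd.prodMk measurable_fst))).stronglyMeasurable
    exact this.integral_prod_right.aestronglyMeasurable
  have hcent : ∫ y, ((∫ ω, w ω * φ ω y ∂ν) - ∫ ω, w ω * e ω ∂ν) ∂μ = 0 := by
    simp_rw [← hDy]
    rw [← integral_prod_symm D hD1, integral_prod D hD1]
    refine integral_eq_zero_of_ae (.of_forall fun ω => ?_)
    simp only [D, Pi.zero_apply]
    rw [integral_const_mul, integral_sub ((hφ2 ω).integrable one_le_two) (integrable_const _)]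
    simp [e]
  have hle : ∫⁻ y, ENNReal.ofReal (((∫ ω, w ω * φ ω y ∂ν) - ∫ ω, w ω * e ω ∂ν) ^ 2) ∂μ ≤
      ENNReal.ofReal v := by
    refine le_trans ?_ hDsq
    rw [lintegral_prod_symm _ (by fun_prop)]
    refine lintegral_mono fun y => ?_
    rw [← hDy]
    -- Jensen on the probability space `[0, 1]`, as nonnegativity of a variance. If `D(·, y)²` is
    -- not integrable, the right side is `⊤`.
    by_cases hfin : Integrable (fun ω => D (ω, y) ^ 2) ν
    · rw [← ofReal_integral_eq_lintegral_ofReal hfin (.of_forall fun ω => sq_nonneg _)]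
      refine ENNReal.ofReal_le_ofReal ?_
      have hmem : MemLp (fun ω => D (ω, y)) 2 ν :=
        (memLp_two_iff_integrable_sq (hDint y).aestronglyMeasurable).2 hfin
      have h1 := variance_nonneg (fun ω => D (ω, y)) ν
      rw [variance_eq_sub hmem] at h1
      simpa using h1
    · have : ∫⁻ ω, ENNReal.ofReal (D (ω, y) ^ 2) ∂ν = ⊤ := by
        by_contra h
        refine hfin ⟨(hDint y).aestronglyMeasurable.pow 2, ?_⟩
        rw [hasFiniteIntegral_iff_ofReal (.of_forall fun y => sq_nonneg _)]
        exact lt_top_iff_ne_top.2 h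
      rw [this]
      exact le_top
  have key := MeanVar.of_lintegral_le (e := ∫ y, ∫ ω, w ω * φ ω y ∂ν ∂μ) hZm rfl _ hv hle
  refine ⟨key.memLp, ?_, key.variance_le⟩
  have h1 := key.memLp.integrable one_le_two
  rw [integral_sub h1 (integrable_const _)] at hcent
  simpa [sub_eq_zero] using hcent

end InvDeconv

namespace InvDeconv

/-! ### Mean and variance of trigonometric integrals with integrable coefficients. -/

section TrigIntegral

variable {μ : Measure ℝ} [IsProbabilityMeasure μ] {S : Set ℝ} {k₁ k₂ : ℝ → ℝ}

theorem integrableOn_mul_uRe_zero (h₁ : IntegrableOn k₁ S) (y : ℝ) :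
    IntegrableOn (fun ω => k₁ ω * uRe 0 ω y) S :=
  integrableOn_mul_of_abs_le h₁ (measurable_uRe_left 0 y) fun ω => abs_uRe_le 0 ω y

theorem integrableOn_mul_uIm_zero (h₁ : IntegrableOn k₁ S) (y : ℝ) :
    IntegrableOn (fun ω => k₁ ω * uIm 0 ω y) S :=
  integrableOn_mul_of_abs_le h₁ (measurable_uIm_left 0 y) fun ω => abs_uIm_le 0 ω y

theorem continuous_trig_integral (h₁ : IntegrableOn k₁ S) (h₂ : IntegrableOn k₂ S) :
    Continuous fun y => ∫ ω in S, (k₁ ω * uRe 0 ω y + k₂ ω * uIm 0 ω y) := by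
  refine continuous_of_dominated (bound := fun ω => ‖k₁ ω‖ + ‖k₂ ω‖) (fun y => ?_)
    (fun y => .of_forall fun ω => ?_) (h₁.norm.add h₂.norm) (.of_forall fun ω => ?_)
  · exact ((integrableOn_mul_uRe_zero h₁ y).add (integrableOn_mul_uIm_zero h₂ y)).1
  · refine (norm_add_le _ _).trans (add_le_add ?_ ?_) <;> rw [norm_mul]
    · exact mul_le_of_le_one_right (norm_nonneg _) (by simpa using abs_uRe_le 0 ω y)
    · exact mul_le_of_le_one_right (norm_nonneg _) (by simpa using abs_uIm_le 0 ω y)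
  · have h1 := (continuous_uRe 0).comp (Continuous.prodMk_right ω)
    have h2 := (continuous_uIm 0).comp (Continuous.prodMk_right ω)
    exact (continuous_const.mul h1).add (continuous_const.mul h2)

theorem integral_trig_integral (h₁ : IntegrableOn k₁ S) (h₂ : IntegrableOn k₂ S) :
    ∫ y, (∫ ω in S, (k₁ ω * uRe 0 ω y + k₂ ω * uIm 0 ω y)) ∂μ =
      ∫ ω in S, (k₁ ω * ∫ y, uRe 0 ω y ∂μ + k₂ ω * ∫ y, uIm 0 ω y ∂μ) := by
  have hm : MemLp id ((0 : ℕ) : ENNReal) μ := by simpa using by fun_prop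
  have hi₁ : Integrable (fun p : ℝ × ℝ => k₁ p.2 * uRe 0 p.2 p.1) (μ.prod (volume.restrict S)) :=
    (h₁.comp_snd μ).mul_bdd (c := 1)
      ((continuous_uRe 0).comp continuous_swap).aestronglyMeasurable
      (.of_forall fun p => by simpa using abs_uRe_le 0 p.2 p.1)
  have hi₂ : Integrable (fun p : ℝ × ℝ => k₂ p.2 * uIm 0 p.2 p.1) (μ.prod (volume.restrict S)) :=
    (h₂.comp_snd μ).mul_bdd (c := 1)
      ((continuous_uIm 0).comp continuous_swap).aestronglyMeasurable
      (.of_forall fun p => by simpa using abs_uIm_le 0 p.2 p.1)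
  rw [integral_integral_swap (f := fun y ω => k₁ ω * uRe 0 ω y + k₂ ω * uIm 0 ω y)
    (hi₁.add hi₂)]
  refine integral_congr_ae (.of_forall fun ω => ?_)
  simp only
  rw [integral_add ((integrable_uRe hm le_rfl ω).const_mul _)
    ((integrable_uIm hm le_rfl ω).const_mul _), integral_const_mul, integral_const_mul]

/-- The second moment about `0` is bounded by Plancherel. This yields the integral of the squared
coefficients, where a direct estimate would give the square of the integral of their moduli. -/
theorem meanVar_trig_integral {K : ℝ} (hK : 0 ≤ K)
    (hμ : μ ≤ ENNReal.ofReal K • (volume : Measure ℝ)) (hS : MeasurableSet S)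
    (h₁ : IntegrableOn k₁ S) (h₂ : IntegrableOn k₂ S)
    (hsq : IntegrableOn (fun ω => k₁ ω ^ 2 + k₂ ω ^ 2) S) :
    MeanVar (fun y => ∫ ω in S, (k₁ ω * uRe 0 ω y + k₂ ω * uIm 0 ω y)) μ
      (∫ ω in S, (k₁ ω * ∫ y, uRe 0 ω y ∂μ + k₂ ω * ∫ y, uIm 0 ω y ∂μ))
      (K * (2 * Real.pi) * ∫ ω in S, (k₁ ω ^ 2 + k₂ ω ^ 2)) := by
  refine MeanVar.of_lintegral_le (continuous_trig_integral h₁ h₂).aestronglyMeasurable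
    (integral_trig_integral h₁ h₂) 0 ?_ ?_
  · have : 0 ≤ ∫ ω in S, (k₁ ω ^ 2 + k₂ ω ^ 2) := integral_nonneg fun ω => by positivity
    have := Real.pi_pos
    positivity
  · simpa [uRe, uIm] using lintegral_sq_trig_integral_le hK hμ hS h₁ h₂ hsq

end TrigIntegral

/-! ### Regularity of the weights on `[1, ∞)`. -/

section Weights

variable {m : ℕ} {a b d C : ℝ} {ψ : ℝ → ℝ}

theorem IsWeight.hasDerivWithinAt (h : IsWeight m a b d C ψ) {j : ℕ} (hj : j < m) {ω : ℝ}
    (hω : 1 ≤ ω) : HasDerivWithinAt (wDeriv j ψ) (wDeriv (j + 1) ψ ω) (Ici 1) ω := by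
  have := (h.differentiable j hj ω hω).hasDerivWithinAt
  unfold wDeriv at *
  rwa [iteratedDerivWithin_succ]

/-- The top derivative need not be continuous. On `[1, ∞)` it agrees with the right derivative of
the preceding one, and right derivatives are measurable. -/
theorem IsWeight.aestronglyMeasurable (h : IsWeight m a b d C ψ) {j : ℕ} (hj : j ≤ m) :
    AEStronglyMeasurable (wDeriv j ψ) (volume.restrict (Ici 1)) := by
  cases j with
  | zero =>
    have : wDeriv 0 ψ = ψ := by ext; simp [wDeriv]
    rw [this]
    exact h.measurable.aestronglyMeasurable
  | succ j =>
    refine (stronglyMeasurable_derivWithin_Ici (wDeriv j ψ)).aestronglyMeasurable.congr ?_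
    filter_upwards [ae_restrict_mem measurableSet_Ici] with ω hω
    exact ((h.hasDerivWithinAt (by omega) hω).mono (Ici_subset_Ici.2 hω)).derivWithin
      (uniqueDiffOn_Ici ω ω self_mem_Ici)

theorem IsWeight.const_nonneg (h : IsWeight m a b d C ψ) : 0 ≤ C := by
  have h1 := (abs_nonneg _).trans (h.bound 0 (Nat.zero_le m) 1 le_rfl)
  have h2 : 0 < ((1 : ℝ) ^ 2 + 1) ^ (-(a * (((0 : ℕ) : ℝ) + 1)) / 2) * Real.exp (-d * 1 ^ b) := by
    positivity
  rw [mul_assoc] at h1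
  exact nonneg_of_mul_nonneg_left h1 h2

theorem IsWeight.abs_le (h : IsWeight m a b d C ψ) (ha : 0 ≤ a) (hd : 0 ≤ d) {j : ℕ} (hj : j ≤ m)
    {ω : ℝ} (hω : 1 ≤ ω) : |wDeriv j ψ ω| ≤ C := by
  refine (h.bound j hj ω hω).trans ?_
  rw [mul_assoc]
  refine mul_le_of_le_one_right h.const_nonneg (mul_le_one₀ ?_ (Real.exp_pos _).le ?_)
  · refine Real.rpow_le_one_of_one_le_of_nonpos (by nlinarith) ?_
    have : 0 ≤ a * ((j : ℝ) + 1) := by positivity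
    linarith
  · rw [Real.exp_le_one_iff]
    have : 0 ≤ ω ^ b := by positivity
    nlinarith

theorem IsWeight.integrableOn_mul (h : IsWeight m a b d C ψ) (ha : 0 ≤ a) (hd : 0 ≤ d) {j : ℕ}
    (hj : j ≤ m) {T : ℝ} {φ : ℝ → ℝ} (hφ : IntegrableOn φ (Icc 1 T)) :
    IntegrableOn (fun ω => wDeriv j ψ ω * φ ω) (Icc 1 T) := by
  refine Integrable.bdd_mul (c := C) hφ
    ((h.aestronglyMeasurable hj).mono_measure (Measure.restrict_mono Icc_subset_Ici_self le_rfl)) ?_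
  filter_upwards [ae_restrict_mem measurableSet_Icc] with ω hω
  exact h.abs_le ha hd hj hω.1

end Weights

/-! ### The estimator as a sample average; the part over `[0, 1]`. -/

section Observation

variable {m : ℕ} {f g ψ₁ ψ₂ : ℝ → ℝ} {K Cσ a b d Cψ h : ℝ}

/-- The contribution of one observation to `PhiHat1`. -/
noncomputable def obs1 (m : ℕ) (g ψ₁ ψ₂ : ℝ → ℝ) (y : ℝ) : ℝ :=
  ∑ j ∈ Finset.range (m + 1), (m.choose j : ℝ) *
    ((∫ ω in Icc (0 : ℝ) 1, invDeriv g (m - j) ω * ψ₁ ω * uRe j ω y) +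
      ∫ ω in Icc (0 : ℝ) 1, invDeriv g (m - j) ω * ψ₂ ω * uIm j ω y)

/-- The contribution of one observation to `FHat`. -/
noncomputable def obsF (m : ℕ) (g ψ₁ ψ₂ : ℝ → ℝ) (y : ℝ) : ℝ :=
  ∑ k ∈ Finset.Icc 1 m, ∑ j ∈ Finset.range (m - k + 1), (-1) ^ k * ((m - k).choose j : ℝ) *
    (coefA m j k g ψ₁ 1 * uRe j 1 y + coefA m j k g ψ₂ 1 * uIm j 1 y)

/-- The contribution of one observation to `PhiHat20`. -/
noncomputable def obs2 (m : ℕ) (g ψ₁ ψ₂ : ℝ → ℝ) (h y : ℝ) : ℝ :=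
  (-1) ^ m * ∫ ω in Icc 1 (1 / h), (wDeriv m ψ₁ ω * (1 / (fourier g ω).re) * uRe 0 ω y +
    wDeriv m ψ₂ ω * (1 / (fourier g ω).re) * uIm 0 ω y)

theorem integrand1_eq {n : ℕ} (y : Fin n → ℝ) (j : ℕ) (ω : ℝ) :
    integrand1 m g ψ₁ ψ₂ y j ω = (n : ℝ)⁻¹ * ∑ l, (invDeriv g (m - j) ω * ψ₁ ω * uRe j ω (y l) +
      invDeriv g (m - j) ω * ψ₂ ω * uIm j ω (y l)) := by
  rw [integrand1, uHatRe, uHatIm, Finset.sum_add_distrib, ← Finset.mul_sum, ← Finset.mul_sum]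
  ring

theorem integrand2_eq {n : ℕ} (y : Fin n → ℝ) (ω : ℝ) :
    integrand2 m g ψ₁ ψ₂ y ω = (n : ℝ)⁻¹ *
      ∑ l, (wDeriv m ψ₁ ω * (1 / (fourier g ω).re) * uRe 0 ω (y l) +
        wDeriv m ψ₂ ω * (1 / (fourier g ω).re) * uIm 0 ω (y l)) := by
  rw [integrand2, uHatRe, uHatIm, Finset.sum_add_distrib, ← Finset.mul_sum, ← Finset.mul_sum]
  ring

theorem ErrorModel.integrableOn_integrand1 (G : ErrorModel m g K)
    (hA : Admissible m g ψ₁ ψ₂ Cσ f) (h₁ : Measurable ψ₁) (h₂ : Measurable ψ₂) {n : ℕ}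
    (y : Fin n → ℝ) {j : ℕ} (hj : j ≤ m) :
    IntegrableOn (integrand1 m g ψ₁ ψ₂ y j) (Icc 0 1) := by
  rw [funext (integrand1_eq y j)]
  exact (integrable_finsetSum _ fun l _ => (G.integrableOn_mul_uRe hA h₁ hj (y l)).add
    (G.integrableOn_mul_uIm hA h₂ hj (y l))).const_mul _

theorem ErrorModel.continuous_inv (G : ErrorModel m g K) :
    Continuous fun ω => 1 / (fourier g ω).re := G.contDiff_inv.continuous

theorem ErrorModel.integrableOn_coef (G : ErrorModel m g K) {ψ : ℝ → ℝ}
    (hψ : IsWeight m a b d Cψ ψ) (ha : 0 ≤ a) (hd : 0 ≤ d) (T : ℝ) :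
    IntegrableOn (fun ω => wDeriv m ψ ω * (1 / (fourier g ω).re)) (Icc 1 T) :=
  hψ.integrableOn_mul ha hd le_rfl (G.continuous_inv.continuousOn.integrableOn_Icc)

theorem ErrorModel.integrableOn_integrand2 (G : ErrorModel m g K)
    (h₁ : IsWeight m a b d Cψ ψ₁) (h₂ : IsWeight m a b d Cψ ψ₂) (ha : 0 ≤ a) (hd : 0 ≤ d) {n : ℕ}
    (y : Fin n → ℝ) (T : ℝ) : IntegrableOn (integrand2 m g ψ₁ ψ₂ y) (Icc 1 T) := by
  rw [funext (integrand2_eq y)]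
  exact (integrable_finsetSum _ fun l _ =>
    (integrableOn_mul_uRe_zero (G.integrableOn_coef h₁ ha hd T) (y l)).add
      (integrableOn_mul_uIm_zero (G.integrableOn_coef h₂ ha hd T) (y l))).const_mul _

theorem ErrorModel.PhiHat_eq (G : ErrorModel m g K)
    (hA : Admissible m g ψ₁ ψ₂ Cσ f)
    (h₁ : IsWeight m a b d Cψ ψ₁) (h₂ : IsWeight m a b d Cψ ψ₂) (ha : 0 ≤ a) (hd : 0 ≤ d) {n : ℕ}
    (hh0 : 0 < h) (hh : h ≤ 1) (y : Fin n → ℝ) :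
    PhiHat m g ψ₁ ψ₂ h y = (n : ℝ)⁻¹ *
      ∑ l, (obs1 m g ψ₁ ψ₂ (y l) + obsF m g ψ₁ ψ₂ (y l) + obs2 m g ψ₁ ψ₂ h (y l)) := by
  have e1 : PhiHat1 m g ψ₁ ψ₂ y = (n : ℝ)⁻¹ * ∑ l, obs1 m g ψ₁ ψ₂ (y l) := by
    simp only [PhiHat1, obs1]
    rw [Finset.sum_comm, Finset.mul_sum]
    refine Finset.sum_congr rfl fun j hj => ?_
    have hj' : j ≤ m := by simp at hj; omega
    have hi : ∀ l, IntegrableOn (fun ω => invDeriv g (m - j) ω * ψ₁ ω * uRe j ω (y l)) (Icc 0 1) :=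
      fun l => G.integrableOn_mul_uRe hA h₁.measurable hj' (y l)
    have hi' : ∀ l, IntegrableOn (fun ω => invDeriv g (m - j) ω * ψ₂ ω * uIm j ω (y l)) (Icc 0 1) :=
      fun l => G.integrableOn_mul_uIm hA h₂.measurable hj' (y l)
    rw [intervalIntegral.integral_of_le zero_le_one, ← integral_Icc_eq_integral_Ioc]
    simp_rw [integrand1_eq]
    rw [integral_const_mul, integral_finsetSum _ fun l _ => by exact (hi l).add (hi' l), ← Finset.mul_sum]
    simp_rw [fun l => integral_add (hi l) (hi' l)]
    ring
  have eF : FHat m g ψ₁ ψ₂ y = (n : ℝ)⁻¹ * ∑ l, obsF m g ψ₁ ψ₂ (y l) := by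
    simp only [FHat, obsF]
    rw [Finset.sum_comm, Finset.mul_sum]
    refine Finset.sum_congr rfl fun k _ => ?_
    rw [Finset.sum_comm, Finset.mul_sum]
    refine Finset.sum_congr rfl fun j _ => ?_
    rw [← Finset.mul_sum, Finset.sum_add_distrib, ← Finset.mul_sum, ← Finset.mul_sum, uHatRe,
      uHatIm]
    ring
  have e2 : PhiHat20 m g ψ₁ ψ₂ h y = (n : ℝ)⁻¹ * ∑ l, obs2 m g ψ₁ ψ₂ h (y l) := by
    have hT : 1 ≤ 1 / h := by rwa [le_div_iff₀ hh0, one_mul]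
    simp only [PhiHat20, obs2]
    rw [intervalIntegral.integral_of_le hT, ← integral_Icc_eq_integral_Ioc]
    simp_rw [integrand2_eq]
    rw [integral_const_mul, integral_finsetSum, ← Finset.mul_sum]
    · ring
    · exact fun l _ => (integrableOn_mul_uRe_zero (G.integrableOn_coef h₁ ha hd _) (y l)).add
        (integrableOn_mul_uIm_zero (G.integrableOn_coef h₂ ha hd _) (y l))
  rw [PhiHat, e1, eF, e2, Finset.sum_add_distrib, Finset.sum_add_distrib]
  ring

theorem ErrorModel.measurable_obs (G : ErrorModel m g K)
    (h₁ : IsWeight m a b d Cψ ψ₁) (h₂ : IsWeight m a b d Cψ ψ₂) (ha : 0 ≤ a) (hd : 0 ≤ d) :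
    Measurable fun y => obs1 m g ψ₁ ψ₂ y + obsF m g ψ₁ ψ₂ y + obs2 m g ψ₁ ψ₂ h y := by
  have hw : ∀ j {ψ : ℝ → ℝ}, Measurable ψ → Measurable fun p : ℝ × ℝ =>
      invDeriv g (m - j) p.2 * ψ p.2 := fun j ψ hψ =>
    ((G.continuous_invDeriv (by omega)).measurable.mul hψ).comp measurable_snd
  have m1 : Measurable (obs1 m g ψ₁ ψ₂) := by
    refine Finset.measurable_fun_sum _ fun j _ => Measurable.const_mul (Measurable.add ?_ ?_) _
    · exact (((hw j h₁.measurable).mul ((continuous_uRe j).measurable.comp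
        measurable_swap)).stronglyMeasurable.integral_prod_right
          (ν := volume.restrict (Icc (0 : ℝ) 1))).measurable
    · exact (((hw j h₂.measurable).mul ((continuous_uIm j).measurable.comp
        measurable_swap)).stronglyMeasurable.integral_prod_right
          (ν := volume.restrict (Icc (0 : ℝ) 1))).measurable
  have mF : Measurable (obsF m g ψ₁ ψ₂) := by
    refine Finset.measurable_fun_sum _ fun k _ => Finset.measurable_fun_sum _ fun j _ =>
      Measurable.const_mul (Measurable.add (Measurable.const_mul ?_ _)
        (Measurable.const_mul ?_ _)) _
    · exact ((continuous_uRe j).comp (Continuous.prodMk_right 1)).measurable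
    · exact ((continuous_uIm j).comp (Continuous.prodMk_right 1)).measurable
  have m2 : Measurable (obs2 m g ψ₁ ψ₂ h) :=
    (continuous_trig_integral (G.integrableOn_coef h₁ ha hd _)
      (G.integrableOn_coef h₂ ha hd _)).measurable.const_mul _
  exact (m1.add mF).add m2

/-- Each `j` contributes a mean and a variance bound by `meanVar_setIntegral`, and Leibniz' rule
reassembles the means. The `max` with `0` appears because the sign of `Cσ` is not prescribed. -/
theorem ErrorModel.meanVar_obs1 (G : ErrorModel m g K) (hA : Admissible m g ψ₁ ψ₂ Cσ f)
    (h₁ : Measurable ψ₁) (h₂ : Measurable ψ₂) :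
    MeanVar (obs1 m g ψ₁ ψ₂) (obsLaw f g)
      ((∫ ω in Icc (0 : ℝ) 1, ψ₁ ω * iteratedDeriv m (fun w => (fourier f w).re) ω) +
        ∫ ω in Icc (0 : ℝ) 1, ψ₂ ω * iteratedDeriv m (fun w => (fourier f w).im) ω)
      ((m + 1) * ∑ j ∈ Finset.range (m + 1),
        (m.choose j : ℝ) ^ 2 * (2 * (max Cσ 0 + max Cσ 0))) := by
  have := G.isProbabilityMeasure hA.pdf
  have hq := G.memLp_id hA.pdf hA.hasMoment
  have key := MeanVar.sum (μ := obsLaw f g) (Finset.range (m + 1))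
    (X := fun j y => (m.choose j : ℝ) *
      ((∫ ω in Icc (0 : ℝ) 1, invDeriv g (m - j) ω * ψ₁ ω * uRe j ω y) +
        ∫ ω in Icc (0 : ℝ) 1, invDeriv g (m - j) ω * ψ₂ ω * uIm j ω y))
    (e := fun j => (m.choose j : ℝ) *
      ((∫ ω in Icc (0 : ℝ) 1, invDeriv g (m - j) ω * ψ₁ ω * ∫ y, uRe j ω y ∂(obsLaw f g)) +
        ∫ ω in Icc (0 : ℝ) 1, invDeriv g (m - j) ω * ψ₂ ω * ∫ y, uIm j ω y ∂(obsLaw f g)))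
    (v := fun j => (m.choose j : ℝ) ^ 2 * (2 * (max Cσ 0 + max Cσ 0))) fun j hj => by
      have hj' : j ≤ m := by simp at hj; omega
      have hc : Measurable (invDeriv g (m - j)) := (G.continuous_invDeriv (by omega)).measurable
      refine ((meanVar_setIntegral (continuous_uRe j) (hc.mul h₁) (fun ω => memLp_uRe hq hj' ω)
        (G.integrableOn_mul_uRe hA h₁ hj') (G.integrableOn_mul_integral_uRe hA h₁ hj')
        (le_max_right Cσ 0) ?_).add (meanVar_setIntegral (continuous_uIm j) (hc.mul h₂)
        (fun ω => memLp_uIm hq hj' ω) (G.integrableOn_mul_uIm hA h₂ hj')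
        (G.integrableOn_mul_integral_uIm hA h₂ hj') (le_max_right Cσ 0) ?_)).const_mul _
      · refine le_trans (le_of_eq ?_) ((hA.variance_re j hj').trans
          (ENNReal.ofReal_le_ofReal (le_max_left Cσ 0)))
        simp only [mul_pow, sq_abs, sigmaSqRe, Pi.mul_apply]
      · refine le_trans (le_of_eq ?_) ((hA.variance_im j hj').trans
          (ENNReal.ofReal_le_ofReal (le_max_left Cσ 0)))
        simp only [mul_pow, sq_abs, sigmaSqIm, Pi.mul_apply]
  refine ⟨key.memLp, ?_, key.variance_le.trans_eq (by simp)⟩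
  refine key.mean.trans ?_
  simp_rw [G.iteratedDeriv_re_fourier hA.pdf hA.hasMoment le_rfl,
    G.iteratedDeriv_im_fourier hA.pdf hA.hasMoment le_rfl, Finset.mul_sum, mul_add]
  rw [Finset.sum_add_distrib]
  congr 1
  · rw [integral_finsetSum]
    · refine Finset.sum_congr rfl fun j _ => ?_
      rw [← integral_const_mul]
      refine integral_congr_ae (.of_forall fun ω => ?_)
      simp only
      ring
    · intro j hj
      refine ((G.integrableOn_mul_integral_uRe hA h₁ (j := j)
        (by simp at hj; omega)).const_mul (m.choose j : ℝ)).congr (.of_forall fun ω => ?_)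
      simp only
      ring
  · rw [integral_finsetSum]
    · refine Finset.sum_congr rfl fun j _ => ?_
      rw [← integral_const_mul]
      refine integral_congr_ae (.of_forall fun ω => ?_)
      simp only
      ring
    · intro j hj
      refine ((G.integrableOn_mul_integral_uIm hA h₂ (j := j)
        (by simp at hj; omega)).const_mul (m.choose j : ℝ)).congr (.of_forall fun ω => ?_)
      simp only
      ring

end Observation

end InvDeconv

namespace InvDeconv

/-! ### Repeated integration by parts and the limit at infinity. -/

section ByParts

open Filter Topology

variable {m : ℕ} {a b d C : ℝ} {ψ : ℝ → ℝ}

theorem IsWeight.continuousOn (h : IsWeight m a b d C ψ) {j : ℕ} (hj : j < m) :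
    ContinuousOn (wDeriv j ψ) (Ici 1) := (h.differentiable j hj).continuousOn

theorem IsWeight.intervalIntegrable (h : IsWeight m a b d C ψ) (ha : 0 ≤ a) (hd : 0 ≤ d) {j : ℕ}
    (hj : j ≤ m) {S T : ℝ} (hS : 1 ≤ S) (hST : S ≤ T) {φ : ℝ → ℝ} (hφ : Continuous φ) :
    IntervalIntegrable (fun ω => wDeriv j ψ ω * φ ω) volume S T := by
  rw [intervalIntegrable_iff_integrableOn_Icc_of_le hST]
  exact (h.integrableOn_mul ha hd hj hφ.continuousOn.integrableOn_Icc).mono_set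
    (Icc_subset_Icc_left hS)

/-- Induction on the number `k` of integrations by parts. The version with right derivatives is
used: the weight is differentiable only one-sidedly at `1`, and its top derivative is merely
integrable on `[1, T]`. -/
theorem IsWeight.integral_mul_iteratedDeriv (h : IsWeight m a b d C ψ) (ha : 0 ≤ a) (hd : 0 ≤ d)
    {u : ℝ → ℝ} (hu : ContDiff ℝ m u) {T : ℝ} (hT : 1 ≤ T) {k : ℕ} (hk : k ≤ m) :
    ∫ ω in (1 : ℝ)..T, wDeriv 0 ψ ω * iteratedDeriv m u ω =
      (∑ i ∈ Finset.Icc 1 k, (-1) ^ i * (wDeriv (i - 1) ψ 1 * iteratedDeriv (m - i) u 1 -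
        wDeriv (i - 1) ψ T * iteratedDeriv (m - i) u T)) +
      (-1) ^ k * ∫ ω in (1 : ℝ)..T, wDeriv k ψ ω * iteratedDeriv (m - k) u ω := by
  induction k with
  | zero => simp
  | succ k ih =>
    rw [ih (by omega), Finset.sum_Icc_succ_top (by omega)]
    have huc : ∀ j ≤ m, Continuous (iteratedDeriv j u) := fun j hj =>
      hu.continuous_iteratedDeriv j (by exact_mod_cast hj)
    have hsub : uIcc 1 T ⊆ Ici 1 := by rw [uIcc_of_le hT]; exact Icc_subset_Ici_self
    have hder : ∀ x, HasDerivAt (iteratedDeriv (m - (k + 1)) u) (iteratedDeriv (m - k) u x) x := by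
      intro x
      have h1 := (hu.differentiable_iteratedDeriv (m - (k + 1))
        (by exact_mod_cast (by omega : m - (k + 1) < m))) x
      have h2 := h1.hasDerivAt
      rwa [← iteratedDeriv_succ, show m - (k + 1) + 1 = m - k by omega] at h2
    have hw : IntervalIntegrable (wDeriv (k + 1) ψ) volume 1 T := by
      simpa using h.intervalIntegrable ha hd hk le_rfl hT (φ := fun _ => 1) continuous_const
    have key := intervalIntegral.integral_mul_deriv_eq_deriv_mul_of_hasDeriv_right
      (u := wDeriv k ψ) (v := iteratedDeriv (m - (k + 1)) u) (u' := wDeriv (k + 1) ψ)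
      (v' := iteratedDeriv (m - k) u) (a := 1) (b := T)
      ((h.continuousOn (by omega)).mono hsub) (huc _ (by omega)).continuousOn
      (fun x hx => by
        rw [min_eq_left hT] at hx
        exact (h.hasDerivWithinAt (by omega) hx.1.le).mono
          ((Ioi_subset_Ioi hx.1.le).trans Ioi_subset_Ici_self))
      (fun x _ => (hder x).hasDerivWithinAt) hw ((huc _ (by omega)).intervalIntegrable _ _)
    rw [key, Nat.add_sub_cancel]
    ring

/-- The Riemann–Lebesgue lemma for the integrable function `x^j f(x)`. -/
theorem tendsto_iteratedDeriv_fourier {f : ℝ → ℝ} (hf : IsPdf f) (hm : HasMoment (2 * m) f)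
    {j : ℕ} (hj : j ≤ 2 * m) : Tendsto (iteratedDeriv j (fourier f)) atTop (𝓝 0) := by
  have := isProbabilityMeasure_law hf
  have h1 := Real.tendsto_integral_exp_smul_cocompact
    (fun x : ℝ => (f x : ℂ) * ((x : ℂ) ^ j))
  -- The change of frequency passes from the kernel `exp(-2πi w x)` to `exp(i ω x)`.
  have h2 : Tendsto (fun ω : ℝ => -ω / (2 * Real.pi)) atTop (cocompact ℝ) := by
    refine Tendsto.mono_right ?_ atBot_le_cocompact
    exact (tendsto_neg_atTop_atBot).atBot_div_const (by positivity)
  have h3 := (h1.comp h2).const_mul (Complex.I ^ j)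
  rw [mul_zero] at h3
  refine h3.congr fun ω => ?_
  rw [fourier_eq_charFun hf, iteratedDeriv_charFun
    ((memLp_id_law hf hm).mono_exponent (by exact_mod_cast hj)), integral_law hf]
  congr 1
  refine integral_congr_ae (.of_forall fun x => ?_)
  simp only [Circle.smul_def, Real.fourierChar_apply, Complex.real_smul, smul_eq_mul]
  rw [mul_comm, mul_assoc]
  congr 3
  have hpi : (Real.pi : ℂ) ≠ 0 := by exact_mod_cast Real.pi_ne_zero
  push_cast
  field_simp

/-- The boundary terms at `T` vanish, being bounded weight derivatives times quantities tending to
`0`. The identity is stated as a limit because the transformed integral over `[1, ∞)` need not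
converge absolutely. -/
theorem IsWeight.tendsto_integral (h : IsWeight m a b d C ψ) (ha : 0 ≤ a) (hd : 0 ≤ d)
    {u : ℝ → ℝ} (hu : ContDiff ℝ m u) (hlim : ∀ j ≤ m, Tendsto (iteratedDeriv j u) atTop (𝓝 0))
    (hint : IntegrableOn (fun ω => ψ ω * iteratedDeriv m u ω) (Ioi 0)) :
    Tendsto (fun T : ℝ => (∫ ω in Icc (0 : ℝ) 1, ψ ω * iteratedDeriv m u ω) +
      (∑ k ∈ Finset.Icc 1 m, (-1) ^ k * (wDeriv (k - 1) ψ 1 * iteratedDeriv (m - k) u 1)) +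
      (-1) ^ m * ∫ ω in (1 : ℝ)..T, wDeriv m ψ ω * u ω) atTop
      (𝓝 (∫ ω in Ioi (0 : ℝ), ψ ω * iteratedDeriv m u ω)) := by
  have hw0 : wDeriv 0 ψ = ψ := by ext; simp [wDeriv]
  have h1 : Tendsto (fun T : ℝ => ∫ ω in (0 : ℝ)..T, ψ ω * iteratedDeriv m u ω) atTop
      (𝓝 (∫ ω in Ioi (0 : ℝ), ψ ω * iteratedDeriv m u ω)) :=
    intervalIntegral_tendsto_integral_Ioi 0 hint tendsto_id
  have h2 : Tendsto (fun T : ℝ => ∑ k ∈ Finset.Icc 1 m,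
      (-1 : ℝ) ^ k * (wDeriv (k - 1) ψ T * iteratedDeriv (m - k) u T)) atTop (𝓝 0) := by
    rw [show (0 : ℝ) = ∑ k ∈ Finset.Icc 1 m, (-1 : ℝ) ^ k * 0 by simp]
    refine tendsto_finsetSum _ fun k hk => Tendsto.const_mul _ ?_
    rw [Finset.mem_Icc] at hk
    refine squeeze_zero_norm' (a := fun T => C * ‖iteratedDeriv (m - k) u T‖) ?_ ?_
    · filter_upwards [eventually_ge_atTop 1] with T hT
      rw [norm_mul]
      gcongr
      exact h.abs_le ha hd (by omega) hT
    · simpa using (hlim (m - k) (by omega)).norm.const_mul C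
  have h3 := h1.add h2
  rw [add_zero] at h3
  refine h3.congr' ?_
  filter_upwards [eventually_ge_atTop 1] with T hT
  have hii : ∀ {S S' : ℝ}, 0 ≤ S → S ≤ S' →
      IntervalIntegrable (fun ω => ψ ω * iteratedDeriv m u ω) volume S S' := fun hS hSS' => by
    rw [intervalIntegrable_iff_integrableOn_Ioc_of_le hSS']
    exact hint.mono_set fun x hx => lt_of_le_of_lt hS hx.1
  rw [← intervalIntegral.integral_add_adjacent_intervals (hii le_rfl zero_le_one)
    (hii zero_le_one hT), intervalIntegral.integral_of_le zero_le_one,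
    ← integral_Icc_eq_integral_Ioc]
  have key := h.integral_mul_iteratedDeriv ha hd hu hT le_rfl
  rw [hw0, Nat.sub_self, iteratedDeriv_zero] at key
  rw [key, Finset.sum_congr rfl fun k _ => mul_sub ((-1 : ℝ) ^ k) _ _, Finset.sum_sub_distrib]
  ring

end ByParts

/-! ### The functional as the limit of the means of the estimator. -/

section Decomposition

open Filter Topology

variable {m : ℕ} {f g ψ₁ ψ₂ : ℝ → ℝ} {K Cσ a b d Cψ h : ℝ}

/-- The boundary term of the integrations by parts. -/
noncomputable def boundary (m : ℕ) (ψ₁ ψ₂ f : ℝ → ℝ) : ℝ :=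
  ∑ k ∈ Finset.Icc 1 m, (-1) ^ k *
    (wDeriv (k - 1) ψ₁ 1 * iteratedDeriv (m - k) (fun w => (fourier f w).re) 1 +
      wDeriv (k - 1) ψ₂ 1 * iteratedDeriv (m - k) (fun w => (fourier f w).im) 1)

/-- The part of `Phi` over the unit interval. -/
noncomputable def initial (m : ℕ) (ψ₁ ψ₂ f : ℝ → ℝ) : ℝ :=
  (∫ ω in Icc (0 : ℝ) 1, ψ₁ ω * iteratedDeriv m (fun w => (fourier f w).re) ω) +
    ∫ ω in Icc (0 : ℝ) 1, ψ₂ ω * iteratedDeriv m (fun w => (fourier f w).im) ω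

/-- The integrand of the remainder of `Phi` after the integrations by parts. -/
noncomputable def tailIntegrand (m : ℕ) (ψ₁ ψ₂ f : ℝ → ℝ) (ω : ℝ) : ℝ :=
  wDeriv m ψ₁ ω * (fourier f ω).re + wDeriv m ψ₂ ω * (fourier f ω).im

theorem continuous_fourier {t : ℝ → ℝ} (ht : IsPdf t) : Continuous (fourier t) := by
  have := isProbabilityMeasure_law ht
  rw [fourier_eq_charFun ht]
  exact continuous_charFun

theorem intervalIntegrable_tailIntegrand (hf : IsPdf f)
    (h₁ : IsWeight m a b d Cψ ψ₁) (h₂ : IsWeight m a b d Cψ ψ₂) (ha : 0 ≤ a) (hd : 0 ≤ d)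
    {S T : ℝ} (hS : 1 ≤ S) (hST : S ≤ T) :
    IntervalIntegrable (tailIntegrand m ψ₁ ψ₂ f) volume S T :=
  (h₁.intervalIntegrable ha hd le_rfl hS hST
    (Complex.continuous_re.comp (continuous_fourier hf))).add
    (h₂.intervalIntegrable ha hd le_rfl hS hST
      (Complex.continuous_im.comp (continuous_fourier hf)))

theorem Admissible.tendsto_Phi (hA : Admissible m g ψ₁ ψ₂ Cσ f)
    (h₁ : IsWeight m a b d Cψ ψ₁) (h₂ : IsWeight m a b d Cψ ψ₂) (ha : 0 ≤ a) (hd : 0 ≤ d) :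
    Tendsto (fun T : ℝ => initial m ψ₁ ψ₂ f + boundary m ψ₁ ψ₂ f +
      (-1) ^ m * ∫ ω in (1 : ℝ)..T, tailIntegrand m ψ₁ ψ₂ f ω) atTop (𝓝 (Phi m ψ₁ ψ₂ f)) := by
  have hc : ∀ {k}, k ≤ m → ContDiff ℝ k (fourier f) := fun hk =>
    contDiff_fourier hA.pdf hA.hasMoment (by omega)
  have hre := h₁.tendsto_integral ha hd (contDiff_re (hc le_rfl)) (fun j hj => by
    have := (Complex.continuous_re.tendsto 0).comp
      (tendsto_iteratedDeriv_fourier hA.pdf hA.hasMoment (by omega : j ≤ 2 * m))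
    exact this.congr fun ω => (iteratedDeriv_re (hc hj) ω).symm) hA.integrable_re
  have him := h₂.tendsto_integral ha hd (contDiff_im (hc le_rfl)) (fun j hj => by
    have := (Complex.continuous_im.tendsto 0).comp
      (tendsto_iteratedDeriv_fourier hA.pdf hA.hasMoment (by omega : j ≤ 2 * m))
    exact this.congr fun ω => (iteratedDeriv_im (hc hj) ω).symm) hA.integrable_im
  refine (hre.add him).congr' ?_
  filter_upwards [eventually_ge_atTop 1] with T hT
  simp only [initial, boundary, tailIntegrand]
  rw [intervalIntegral.integral_add
    (by
      exact h₁.intervalIntegrable ha hd le_rfl le_rfl hT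
        (Complex.continuous_re.comp (continuous_fourier hA.pdf)))
    (by
      exact h₂.intervalIntegrable ha hd le_rfl le_rfl hT
        (Complex.continuous_im.comp (continuous_fourier hA.pdf)))]
  simp_rw [mul_add, Finset.sum_add_distrib]
  ring

/-- Subtracting the cut at `H` from the cut at `T` leaves only the tail from `H` to `T`; a bound
uniform in `T` survives the limit. -/
theorem Admissible.abs_sub_Phi_le (hA : Admissible m g ψ₁ ψ₂ Cσ f)
    (h₁ : IsWeight m a b d Cψ ψ₁) (h₂ : IsWeight m a b d Cψ ψ₂) (ha : 0 ≤ a) (hd : 0 ≤ d)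
    {H R : ℝ} (hH : 1 ≤ H) (hR : ∀ T, H ≤ T → |∫ ω in H..T, tailIntegrand m ψ₁ ψ₂ f ω| ≤ R) :
    |initial m ψ₁ ψ₂ f + boundary m ψ₁ ψ₂ f +
      (-1) ^ m * (∫ ω in (1 : ℝ)..H, tailIntegrand m ψ₁ ψ₂ f ω) - Phi m ψ₁ ψ₂ f| ≤ R := by
  have h3 := ((hA.tendsto_Phi h₁ h₂ ha hd).const_sub (initial m ψ₁ ψ₂ f + boundary m ψ₁ ψ₂ f +
      (-1) ^ m * (∫ ω in (1 : ℝ)..H, tailIntegrand m ψ₁ ψ₂ f ω))).abs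
  refine le_of_tendsto h3 ?_
  filter_upwards [eventually_ge_atTop H] with T hT
  rw [← intervalIntegral.integral_add_adjacent_intervals
    (intervalIntegrable_tailIntegrand hA.pdf h₁ h₂ ha hd le_rfl hH)
    (intervalIntegrable_tailIntegrand hA.pdf h₁ h₂ ha hd hH hT), mul_add]
  rw [show ∀ x y z : ℝ, x + y - (x + (y + z)) = -z by intros; ring, abs_neg, abs_mul, abs_pow,
    abs_neg, abs_one, one_pow, one_mul]
  exact hR T hT

/-- Convergence as `H → ∞`, plus integrability up to the point where the error is below `1`, bounds
the bias for all `H`. No decay of the tail is used, but `R` depends on `f`. -/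
theorem Admissible.exists_abs_sub_Phi_le (hA : Admissible m g ψ₁ ψ₂ Cσ f)
    (h₁ : IsWeight m a b d Cψ ψ₁) (h₂ : IsWeight m a b d Cψ ψ₂) (ha : 0 ≤ a) (hd : 0 ≤ d) :
    ∃ R, ∀ H : ℝ, 1 ≤ H → |initial m ψ₁ ψ₂ f + boundary m ψ₁ ψ₂ f +
      (-1) ^ m * (∫ ω in (1 : ℝ)..H, tailIntegrand m ψ₁ ψ₂ f ω) - Phi m ψ₁ ψ₂ f| ≤ R := by
  have h3 := (hA.tendsto_Phi h₁ h₂ ha hd).sub_const (Phi m ψ₁ ψ₂ f)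
  rw [sub_self] at h3
  obtain ⟨T₀, hT₀⟩ := eventually_atTop.1 (h3.abs.eventually_le_const
    (show |(0 : ℝ)| < 1 by simp))
  set T := max T₀ 1
  have hint := intervalIntegrable_tailIntegrand hA.pdf h₁ h₂ ha hd le_rfl (le_max_right T₀ 1)
  set W := ∫ ω in (1 : ℝ)..T, |tailIntegrand m ψ₁ ψ₂ f ω|
  set E := initial m ψ₁ ψ₂ f + boundary m ψ₁ ψ₂ f - Phi m ψ₁ ψ₂ f
  have hW : 0 ≤ W := intervalIntegral.integral_nonneg (le_max_right T₀ 1) fun ω _ => abs_nonneg _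
  refine ⟨|E| + W + 1, fun H hH => ?_⟩
  rcases le_total H T with h | h
  · have h5 : |∫ ω in (1 : ℝ)..H, tailIntegrand m ψ₁ ψ₂ f ω| ≤ W := by
      refine (intervalIntegral.abs_integral_le_integral_abs hH).trans ?_
      refine intervalIntegral.integral_mono_interval le_rfl hH h
        (.of_forall fun ω => abs_nonneg _) hint.abs
    have h6 : |(-1) ^ m * (∫ ω in (1 : ℝ)..H, tailIntegrand m ψ₁ ψ₂ f ω)| ≤ W := by
      rwa [abs_mul, abs_pow, abs_neg, abs_one, one_pow, one_mul]
    rw [show ∀ x y : ℝ, x + y - Phi m ψ₁ ψ₂ f = x - Phi m ψ₁ ψ₂ f + y by intros; ring]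
    exact (abs_add_le _ _).trans (by linarith)
  · exact (hT₀ H ((le_max_left T₀ 1).trans h)).trans (by linarith [abs_nonneg E])

end Decomposition

end InvDeconv

namespace InvDeconv

/-! ### Variances of the boundary part and of the part over `[1, 1/h]`. -/

section ObservationVariance

variable {m : ℕ} {f g ψ₁ ψ₂ : ℝ → ℝ} {K Cσ a b d Cψ h M : ℝ}

/-- The inequality `|y|^(2j) ≤ 1 + y^(2m)` gives one bound for all `j ≤ m`. -/
theorem variance_le_of_abs_le_pow {μ : Measure ℝ} [IsProbabilityMeasure μ]
    (hm : MemLp id (2 * m : ℕ) μ) {j : ℕ} (hj : j ≤ m) {X : ℝ → ℝ}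
    (hX : AEStronglyMeasurable X μ) (hb : ∀ y, |X y| ≤ |y| ^ j) :
    variance X μ ≤ 1 + ∫ y, y ^ (2 * m) ∂μ := by
  have hi := integrable_pow_of_memLp hm le_rfl
  refine (variance_le_expectation_sq hX).trans ?_
  calc ∫ y, (X ^ 2) y ∂μ ≤ ∫ y, (1 + y ^ (2 * m)) ∂μ := by
        refine integral_mono (memLp_two_of_abs_le_pow hm hj hX hb).integrable_sq
          ((integrable_const 1).add hi) fun y => ?_
        simp only [Pi.pow_apply]
        rw [← sq_abs (X y), pow_mul, ← sq_abs y, ← pow_mul]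
        refine (pow_le_pow_left₀ (abs_nonneg _) (hb y) 2).trans ?_
        rw [← pow_mul, mul_comm j 2]
        rcases le_total |y| 1 with h | h
        · exact (pow_le_one₀ (abs_nonneg _) h).trans (le_add_of_nonneg_right (by positivity))
        · exact (pow_le_pow_right₀ h (by omega)).trans (le_add_of_nonneg_left zero_le_one)
    _ = _ := by
        rw [integral_add (integrable_const 1) hi]
        simp

theorem ErrorModel.meanVar_uRe (G : ErrorModel m g K) (hf : IsPdf f) (hfm : HasMoment (2 * m) f)
    (hM : moment (2 * m) f ≤ M) {j : ℕ} (hj : j ≤ m) (ω : ℝ) :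
    MeanVar (uRe j ω) (obsLaw f g) (∫ y, uRe j ω y ∂(obsLaw f g))
      (1 + 2 ^ (2 * m - 1) * (M + moment (2 * m) g)) := by
  have := G.isProbabilityMeasure hf
  have hq := G.memLp_id hf hfm
  refine ⟨memLp_uRe hq hj ω, rfl, (variance_le_of_abs_le_pow hq hj
    (memLp_uRe hq hj ω).aestronglyMeasurable (abs_uRe_le j ω)).trans ?_⟩
  gcongr
  exact (integral_pow_obsLaw_le hf G.pdf hfm G.hasMoment).trans (by gcongr)

theorem ErrorModel.meanVar_uIm (G : ErrorModel m g K) (hf : IsPdf f) (hfm : HasMoment (2 * m) f)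
    (hM : moment (2 * m) f ≤ M) {j : ℕ} (hj : j ≤ m) (ω : ℝ) :
    MeanVar (uIm j ω) (obsLaw f g) (∫ y, uIm j ω y ∂(obsLaw f g))
      (1 + 2 ^ (2 * m - 1) * (M + moment (2 * m) g)) := by
  have := G.isProbabilityMeasure hf
  have hq := G.memLp_id hf hfm
  refine ⟨memLp_uIm hq hj ω, rfl, (variance_le_of_abs_le_pow hq hj
    (memLp_uIm hq hj ω).aestronglyMeasurable (abs_uIm_le j ω)).trans ?_⟩
  gcongr
  exact (integral_pow_obsLaw_le hf G.pdf hfm G.hasMoment).trans (by gcongr)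

/-- Finitely many terms at the single frequency `1`, each with variance controlled by the moments;
`v` is chosen before `f` and depends on it only through `M`. -/
theorem ErrorModel.exists_meanVar_obsF (G : ErrorModel m g K) (ψ₁ ψ₂ : ℝ → ℝ) (M : ℝ) :
    ∃ v, ∀ f, IsPdf f → HasMoment (2 * m) f → moment (2 * m) f ≤ M →
      MeanVar (obsF m g ψ₁ ψ₂) (obsLaw f g) (boundary m ψ₁ ψ₂ f) v := by
  set Q := 1 + 2 ^ (2 * m - 1) * (M + moment (2 * m) g)
  refine ⟨(Finset.Icc 1 m).card * ∑ k ∈ Finset.Icc 1 m, ((Finset.range (m - k + 1)).card : ℝ) *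
    ∑ j ∈ Finset.range (m - k + 1), ((-1) ^ k * ((m - k).choose j : ℝ)) ^ 2 *
      (2 * (coefA m j k g ψ₁ 1 ^ 2 * Q + coefA m j k g ψ₂ 1 ^ 2 * Q)), fun f hf hfm hM => ?_⟩
  have := G.isProbabilityMeasure hf
  have key := MeanVar.sum (μ := obsLaw f g) (Finset.Icc 1 m) fun k hk =>
    MeanVar.sum (Finset.range (m - k + 1)) fun j hj =>
      (((G.meanVar_uRe hf hfm hM (j := j) (by simp at hj; omega) 1).const_mul
        (coefA m j k g ψ₁ 1)).add
        ((G.meanVar_uIm hf hfm hM (j := j) (by simp at hj; omega) 1).const_mul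
        (coefA m j k g ψ₂ 1))).const_mul ((-1) ^ k * ((m - k).choose j : ℝ))
  refine ⟨key.memLp, key.mean.trans ?_, key.variance_le⟩
  rw [boundary]
  refine Finset.sum_congr rfl fun k _ => ?_
  rw [G.iteratedDeriv_re_fourier hf hfm (Nat.sub_le m k),
    G.iteratedDeriv_im_fourier hf hfm (Nat.sub_le m k), mul_add, Finset.mul_sum, Finset.mul_sum,
    Finset.mul_sum, Finset.mul_sum, ← Finset.sum_add_distrib]
  refine Finset.sum_congr rfl fun j _ => ?_
  simp only [coefA]
  ring

theorem integral_uRe_zero_eq (G : ErrorModel m g K) (hf : IsPdf f) (hfm : HasMoment (2 * m) f)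
    (ω : ℝ) : 1 / (fourier g ω).re * ∫ y, uRe 0 ω y ∂(obsLaw f g) = (fourier f ω).re := by
  have := G.iteratedDeriv_re_fourier hf hfm (Nat.zero_le m) ω
  simpa [invDeriv] using this.symm

theorem integral_uIm_zero_eq (G : ErrorModel m g K) (hf : IsPdf f) (hfm : HasMoment (2 * m) f)
    (ω : ℝ) : 1 / (fourier g ω).re * ∫ y, uIm 0 ω y ∂(obsLaw f g) = (fourier f ω).im := by
  have := G.iteratedDeriv_im_fourier hf hfm (Nat.zero_le m) ω
  simpa [invDeriv] using this.symm

/-- The weight bound divided by the lower bound on `|g*|`; its square is exactly a multiple of the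
variance integrand in the rate. -/
theorem IsWeight.sq_coef_le {α β γ C₁ C₂ : ℝ} (hA1 : AssumptionA1 g α β γ C₁ C₂)
    (hg_real : ∀ ω : ℝ, (fourier g ω).im = 0) {ψ : ℝ → ℝ} (hψ : IsWeight m a b d Cψ ψ)
    {ω : ℝ} (hω : 1 ≤ ω) :
    (wDeriv m ψ ω * (1 / (fourier g ω).re)) ^ 2 ≤ (Cψ / C₁) ^ 2 *
      ((ω ^ 2 + 1) ^ (α - ((m : ℝ) + 1) * a) *
        Real.exp (-2 * d * ω ^ b + 2 * γ * ω ^ β)) := by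
  have hC₁ := hA1.C₁_pos
  have hlow := hA1.lower ω
  have hn : ‖fourier g ω‖ = |(fourier g ω).re| := by
    rw [Complex.abs_re_eq_norm.2 (hg_real ω)]
  rw [hn, abs_of_nonneg (by linarith : 0 ≤ ω)] at hlow
  have hb := hψ.bound m le_rfl ω hω
  set x := ω ^ 2 + 1
  have hx : 0 < x := by positivity
  have hlp : 0 < C₁ * x ^ (-α / 2) * Real.exp (-γ * ω ^ β) := by positivity
  have hCψ := hψ.const_nonneg
  have habs : |wDeriv m ψ ω * (1 / (fourier g ω).re)| ≤
      (Cψ * x ^ (-(a * ((m : ℝ) + 1)) / 2) * Real.exp (-d * ω ^ b)) *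
        (1 / (C₁ * x ^ (-α / 2) * Real.exp (-γ * ω ^ β))) := by
    rw [abs_mul, abs_div, abs_one]
    gcongr
  rw [← sq_abs]
  refine (pow_le_pow_left₀ (abs_nonneg _) habs 2).trans_eq ?_
  have e1 : x ^ (α - ((m : ℝ) + 1) * a) =
      (x ^ (-(a * ((m : ℝ) + 1)) / 2)) ^ 2 * ((x ^ (-α / 2)) ^ 2)⁻¹ := by
    rw [← Real.rpow_natCast, ← Real.rpow_natCast, ← Real.rpow_mul hx.le, ← Real.rpow_mul hx.le,
      ← Real.rpow_neg hx.le, ← Real.rpow_add hx]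
    congr 1
    push_cast
    ring
  have e2 : Real.exp (-2 * d * ω ^ b + 2 * γ * ω ^ β) =
      (Real.exp (-d * ω ^ b)) ^ 2 * ((Real.exp (-γ * ω ^ β)) ^ 2)⁻¹ := by
    rw [← Real.exp_nat_mul, ← Real.exp_nat_mul, ← Real.exp_neg, ← Real.exp_add]
    congr 1
    push_cast
    ring
  rw [e1, e2]
  field_simp

theorem continuous_rate_integrand (p q c b β : ℝ) (hb : 0 ≤ b) (hβ : 0 ≤ β) :
    Continuous fun ω : ℝ => (ω ^ 2 + 1) ^ p * Real.exp (q * ω ^ b + c * ω ^ β) := by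
  have h1 : Continuous fun ω : ℝ => (ω ^ 2 + 1) ^ p := by
    refine Continuous.rpow_const (by fun_prop) fun ω => Or.inl (by positivity)
  have h2 : Continuous fun ω : ℝ => ω ^ b := Real.continuous_rpow_const hb
  have h3 : Continuous fun ω : ℝ => ω ^ β := Real.continuous_rpow_const hβ
  fun_prop

theorem ErrorModel.meanVar_obs2 (G : ErrorModel m g K) {α β γ C₁ C₂ : ℝ}
    (hA1 : AssumptionA1 g α β γ C₁ C₂) (hf : IsPdf f) (hfm : HasMoment (2 * m) f)
    (h₁ : IsWeight m a b d Cψ ψ₁) (h₂ : IsWeight m a b d Cψ ψ₂) (ha : 0 ≤ a) (hd : 0 ≤ d)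
    (hb : 0 ≤ b) (hh0 : 0 < h) (hh : h ≤ 1) :
    MeanVar (obs2 m g ψ₁ ψ₂ h) (obsLaw f g)
      ((-1) ^ m * ∫ ω in (1 : ℝ)..(1 / h), tailIntegrand m ψ₁ ψ₂ f ω)
      ((max K 0) * (2 * Real.pi) * (2 * (Cψ / C₁) ^ 2) * ∫ ω in (1 : ℝ)..(1 / h),
        (ω ^ 2 + 1) ^ (α - ((m : ℝ) + 1) * a) *
          Real.exp (-2 * d * ω ^ b + 2 * γ * ω ^ β)) := by
  have := G.isProbabilityMeasure hf
  have hT : 1 ≤ 1 / h := by rwa [le_div_iff₀ hh0, one_mul]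
  have hc := continuous_rate_integrand (α - ((m : ℝ) + 1) * a) (-2 * d) (2 * γ) b β hb
    hA1.β_nonneg
  have hle : ∀ ω ∈ Icc 1 (1 / h), (wDeriv m ψ₁ ω * (1 / (fourier g ω).re)) ^ 2 +
      (wDeriv m ψ₂ ω * (1 / (fourier g ω).re)) ^ 2 ≤ (2 * (Cψ / C₁) ^ 2) *
      ((ω ^ 2 + 1) ^ (α - ((m : ℝ) + 1) * a) *
        Real.exp (-2 * d * ω ^ b + 2 * γ * ω ^ β)) := fun ω hω => by
    linarith [h₁.sq_coef_le hA1 G.im_eq_zero hω.1, h₂.sq_coef_le hA1 G.im_eq_zero hω.1]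
  have hci := (hc.continuousOn.integrableOn_Icc (a := 1) (b := 1 / h) (μ := volume)).const_mul
    (2 * (Cψ / C₁) ^ 2)
  have hm := ((G.integrableOn_coef h₁ ha hd (1 / h)).1.pow 2).add
    ((G.integrableOn_coef h₂ ha hd (1 / h)).1.pow 2)
  have hsq : IntegrableOn (fun ω => (wDeriv m ψ₁ ω * (1 / (fourier g ω).re)) ^ 2 +
      (wDeriv m ψ₂ ω * (1 / (fourier g ω).re)) ^ 2) (Icc 1 (1 / h)) := by
    refine hci.mono' hm ?_
    filter_upwards [ae_restrict_mem measurableSet_Icc] with ω hω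
    rw [Real.norm_of_nonneg (by positivity)]
    exact hle ω hω
  have key := (meanVar_trig_integral (μ := obsLaw f g) (le_max_right K 0)
    (obsLaw_le hf G.pdf (G.bdd.mono fun x hx => hx.trans (le_max_left K 0))) measurableSet_Icc
    (G.integrableOn_coef h₁ ha hd (1 / h)) (G.integrableOn_coef h₂ ha hd (1 / h)) hsq).const_mul
    ((-1) ^ m)
  refine ⟨key.memLp, key.mean.trans ?_, key.variance_le.trans ?_⟩
  · rw [intervalIntegral.integral_of_le hT, ← integral_Icc_eq_integral_Ioc]
    congr 1
    refine integral_congr_ae (.of_forall fun ω => ?_)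
    simp only [tailIntegrand]
    rw [mul_assoc, mul_assoc, integral_uRe_zero_eq G hf hfm, integral_uIm_zero_eq G hf hfm]
  · rw [← pow_mul, mul_comm m 2, pow_mul, neg_one_sq, one_pow, one_mul,
      mul_assoc (max K 0 * (2 * Real.pi)) (2 * (Cψ / C₁) ^ 2)]
    have hpi := Real.pi_pos
    have hK0 := le_max_right K 0
    refine mul_le_mul_of_nonneg_left ?_ (by positivity)
    rw [intervalIntegral.integral_of_le hT, ← integral_Icc_eq_integral_Ioc, ← integral_const_mul]
    exact setIntegral_mono_on hsq hci measurableSet_Icc hle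

end ObservationVariance

end InvDeconv

namespace InvDeconv

/-! ### Tails of powers times stretched exponentials. -/

section TailBounds

/-- In terms of `t = ω / H ≥ 1`, a power of `t` is dominated by `exp(d (t^b - 1))` up to a constant,
and `H^b ≥ 1` only enlarges the exponent. The constant is thus uniform in `H`. -/
theorem exists_rpow_le_mul_exp {κ b d : ℝ} (hb : 0 < b) (hd : 0 < d) :
    ∃ C : ℝ, 0 < C ∧ ∀ H ω : ℝ, 1 ≤ H → H ≤ ω →
      ω ^ κ ≤ C * H ^ κ * Real.exp (d * (ω ^ b - H ^ b)) := by
  rcases le_total κ 0 with hκ | hκ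
  · refine ⟨1, one_pos, fun H ω hH hω => ?_⟩
    have hH0 : 0 < H := by linarith
    have h1 : ω ^ κ ≤ H ^ κ := Real.rpow_le_rpow_of_nonpos hH0 hω hκ
    have h2 : H ^ b ≤ ω ^ b := Real.rpow_le_rpow hH0.le hω hb.le
    have h3 : 1 ≤ Real.exp (d * (ω ^ b - H ^ b)) :=
      Real.one_le_exp (mul_nonneg hd.le (by linarith))
    rw [one_mul]
    exact h1.trans (le_mul_of_one_le_right (Real.rpow_nonneg hH0.le κ) h3)
  -- Chosen so that `κ/b · δ ≤ d` when `log x ≤ x - 1` is applied at `x = δ t^b`; `κ + 1` instead of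
  -- `κ` allows `κ = 0`. The constants left over form `L`.
  · set δ := d * b / (κ + 1)
    have hδ : 0 < δ := by positivity
    set L := κ / b * (-Real.log δ - 1 + δ)
    refine ⟨Real.exp L, Real.exp_pos _, fun H ω hH hω => ?_⟩
    have hH0 : 0 < H := by linarith
    have hω0 : 0 < ω := by linarith
    set t := ω / H
    have ht : 1 ≤ t := by rwa [le_div_iff₀ hH0, one_mul]
    have ht0 : 0 < t := by linarith
    have hωt : ω = H * t := by simp only [t]; field_simp
    have htb : 1 ≤ t ^ b := Real.one_le_rpow ht hb.le
    have hHb : 1 ≤ H ^ b := Real.one_le_rpow hH hb.le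
    have hlog : b * Real.log t ≤ δ * t ^ b - 1 - Real.log δ := by
      have := Real.log_le_sub_one_of_pos (mul_pos hδ (by positivity : 0 < t ^ b))
      rw [Real.log_mul hδ.ne' (by positivity), Real.log_rpow ht0] at this
      linarith
    have hκδ : κ / b * δ ≤ d := by
      simp only [δ]
      rw [div_mul_div_comm, div_le_iff₀ (by positivity)]
      nlinarith [mul_pos hd hb]
    have hkey : κ * Real.log t ≤ L + d * (t ^ b - 1) := by
      have h1 := mul_le_mul_of_nonneg_left hlog (by positivity : 0 ≤ κ / b)
      have h2 : κ / b * (b * Real.log t) = κ * Real.log t := by field_simp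
      rw [h2] at h1
      have h3 := mul_le_mul_of_nonneg_right hκδ (by linarith : 0 ≤ t ^ b - 1)
      simp only [L]
      nlinarith
    rw [hωt, Real.mul_rpow hH0.le ht0.le, Real.mul_rpow hH0.le ht0.le]
    have h4 : t ^ κ ≤ Real.exp L * Real.exp (d * (H ^ b * t ^ b - H ^ b)) := by
      rw [Real.rpow_def_of_pos ht0, ← Real.exp_add, Real.exp_le_exp]
      have : d * (t ^ b - 1) ≤ d * (H ^ b * t ^ b - H ^ b) := by
        refine mul_le_mul_of_nonneg_left ?_ hd.le
        nlinarith
      linarith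
    have h5 := mul_le_mul_of_nonneg_left h4 (Real.rpow_nonneg hH0.le κ)
    linarith

theorem continuousOn_rpow_mul_exp (p d : ℝ) {b H T : ℝ} (hb : 0 ≤ b) (hH : 0 < H) :
    ContinuousOn (fun ω : ℝ => ω ^ p * Real.exp (d * ω ^ b)) (Icc H T) := by
  have h2 : Continuous fun ω : ℝ => ω ^ b := Real.continuous_rpow_const hb
  refine ContinuousOn.mul (fun ω hω => ?_) (by fun_prop)
  exact (Real.continuousAt_rpow_const ω p (Or.inl (by linarith [hω.1]))).continuousWithinAt

theorem integral_rpow_mul_exp_le {b d H T : ℝ} (hb : 0 < b) (hd : 0 < d) (hH : 1 ≤ H)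
    (hT : H ≤ T) : ∫ ω in H..T, ω ^ (b - 1) * Real.exp (-d * ω ^ b) ≤
      (d * b)⁻¹ * Real.exp (-d * H ^ b) := by
  have hder : ∀ x ∈ uIcc H T, HasDerivAt (fun ω : ℝ => -(d * b)⁻¹ * Real.exp (-d * ω ^ b))
      (x ^ (b - 1) * Real.exp (-d * x ^ b)) x := fun x hx => by
    rw [uIcc_of_le hT] at hx
    have hx0 : x ≠ 0 := by linarith [hx.1]
    have := (((Real.hasDerivAt_rpow_const (p := b) (Or.inl hx0)).const_mul (-d)).exp).const_mul
      (-(d * b)⁻¹)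
    refine this.congr_deriv ?_
    field_simp
  rw [intervalIntegral.integral_eq_sub_of_hasDerivAt hder
    ((continuousOn_rpow_mul_exp _ _ hb.le (by linarith)).intervalIntegrable_of_Icc hT)]
  have : 0 < (d * b)⁻¹ * Real.exp (-d * T ^ b) := by positivity
  linarith

/-- For `b = 0` a pure power is integrated. For `b > 0` write `ω^(-p) = ω^(1-p-b) ω^(b-1)`: half of
the exponential absorbs the growth of the first factor relative to `H`, and the other half times
`ω^(b-1)` has an explicit antiderivative. -/
theorem exists_integral_rpow_mul_exp_le {p b d : ℝ} (hb : 0 ≤ b) (hbd : 0 < b → 0 < d)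
    (h : 0 < b ∨ 1 < p + b) : ∃ C : ℝ, 0 ≤ C ∧ ∀ H T : ℝ, 1 ≤ H → H ≤ T →
      ∫ ω in H..T, ω ^ (-p) * Real.exp (-d * ω ^ b) ≤
        C * (H ^ (1 - p - b) * Real.exp (-d * H ^ b)) := by
  rcases hb.eq_or_lt with rfl | hb
  · have hp : 1 < p := by simpa using h
    refine ⟨(p - 1)⁻¹, inv_nonneg.2 (by linarith), fun H T hH hT => ?_⟩
    have hH0 : 0 < H := by linarith
    simp only [Real.rpow_zero, mul_one, sub_zero]
    rw [intervalIntegral.integral_mul_const, integral_rpow (Or.inr ⟨by linarith, by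
      rw [uIcc_of_le hT]; exact fun h0 => by linarith [h0.1]⟩), ← mul_assoc]
    refine mul_le_mul_of_nonneg_right ?_ (Real.exp_pos _).le
    have h1 : 0 ≤ T ^ (-p + 1) := Real.rpow_nonneg (by linarith) _
    rw [show 1 - p = -p + 1 by ring, show -p + 1 = -(p - 1) by ring, div_neg, ← neg_div, neg_sub,
      div_eq_inv_mul]
    rw [show -p + 1 = -(p - 1) by ring] at h1
    refine mul_le_mul_of_nonneg_left (by linarith) (inv_nonneg.2 (by linarith))
  · have hd := hbd hb
    obtain ⟨C, hC, hCb⟩ := exists_rpow_le_mul_exp (κ := 1 - p - b) hb (half_pos hd)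
    refine ⟨C * (d / 2 * b)⁻¹, by positivity, fun H T hH hT => ?_⟩
    have hH0 : 0 < H := by linarith
    calc ∫ ω in H..T, ω ^ (-p) * Real.exp (-d * ω ^ b)
        ≤ ∫ ω in H..T, C * H ^ (1 - p - b) * Real.exp (-(d / 2) * H ^ b) *
            (ω ^ (b - 1) * Real.exp (-(d / 2) * ω ^ b)) := by
          refine intervalIntegral.integral_mono_on hT
            ((continuousOn_rpow_mul_exp _ _ hb.le hH0).intervalIntegrable_of_Icc hT)
            (((continuousOn_rpow_mul_exp _ _ hb.le hH0).intervalIntegrable_of_Icc hT).const_mul _)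
            fun ω hω => ?_
          have hω0 : 0 < ω := by linarith [hω.1]
          have h1 := hCb H ω hH hω.1
          have e1 : ω ^ (-p) = ω ^ (1 - p - b) * ω ^ (b - 1) := by
            rw [← Real.rpow_add hω0]; congr 1; ring
          have e2 : Real.exp (d / 2 * (ω ^ b - H ^ b)) * Real.exp (-d * ω ^ b) =
              Real.exp (-(d / 2) * H ^ b) * Real.exp (-(d / 2) * ω ^ b) := by
            rw [← Real.exp_add, ← Real.exp_add]; congr 1; ring
          have h2 : 0 ≤ ω ^ (b - 1) * Real.exp (-d * ω ^ b) := by positivity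
          calc ω ^ (-p) * Real.exp (-d * ω ^ b)
              = ω ^ (1 - p - b) * (ω ^ (b - 1) * Real.exp (-d * ω ^ b)) := by rw [e1, mul_assoc]
            _ ≤ C * H ^ (1 - p - b) * Real.exp (d / 2 * (ω ^ b - H ^ b)) *
                  (ω ^ (b - 1) * Real.exp (-d * ω ^ b)) := mul_le_mul_of_nonneg_right h1 h2
            _ = C * H ^ (1 - p - b) * ω ^ (b - 1) *
                  (Real.exp (d / 2 * (ω ^ b - H ^ b)) * Real.exp (-d * ω ^ b)) := by ring
            _ = _ := by rw [e2]; ring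
      _ ≤ C * H ^ (1 - p - b) * Real.exp (-(d / 2) * H ^ b) *
            ((d / 2 * b)⁻¹ * Real.exp (-(d / 2) * H ^ b)) := by
          rw [intervalIntegral.integral_const_mul]
          exact mul_le_mul_of_nonneg_left (integral_rpow_mul_exp_le hb (half_pos hd) hH hT)
            (by positivity)
      _ = _ := by
          have e3 : Real.exp (-d * H ^ b) =
              Real.exp (-(d / 2) * H ^ b) * Real.exp (-(d / 2) * H ^ b) := by
            rw [← Real.exp_add]; congr 1; ring
          rw [e3]
          ring

theorem integral_mul_sq_le {φ χ : ℝ → ℝ} {H T : ℝ} (hT : H ≤ T) (hφ : ContinuousOn φ (Icc H T))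
    (hχ : ContinuousOn χ (Icc H T)) (hφ0 : ∀ ω ∈ Icc H T, 0 ≤ φ ω) (hχ0 : ∀ ω ∈ Icc H T, 0 ≤ χ ω) :
    (∫ ω in H..T, φ ω * χ ω) ^ 2 ≤ (∫ ω in H..T, φ ω ^ 2) * ∫ ω in H..T, χ ω ^ 2 := by
  simp only [intervalIntegral.integral_of_le hT, ← integral_Icc_eq_integral_Ioc]
  have hm : ∀ {φ : ℝ → ℝ}, ContinuousOn φ (Icc H T) →
      MemLp φ (ENNReal.ofReal 2) (volume.restrict (Icc H T)) := fun h => by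
    rw [show ENNReal.ofReal 2 = 2 by simp]
    exact (memLp_two_iff_integrable_sq (h.aestronglyMeasurable measurableSet_Icc)).2
      (h.pow 2).integrableOn_Icc
  have key := integral_mul_le_Lp_mul_Lq_of_nonneg (μ := volume.restrict (Icc H T))
    Real.HolderConjugate.two_two ((ae_restrict_mem measurableSet_Icc).mono hφ0)
    ((ae_restrict_mem measurableSet_Icc).mono hχ0) (hm hφ) (hm hχ)
  simp only [Real.rpow_two, ← Real.sqrt_eq_rpow] at key
  have h0 : 0 ≤ ∫ ω in Icc H T, φ ω * χ ω := setIntegral_nonneg measurableSet_Icc fun ω hω =>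
    mul_nonneg (hφ0 ω hω) (hχ0 ω hω)
  refine (pow_le_pow_left₀ h0 key 2).trans_eq ?_
  rw [mul_pow, Real.sq_sqrt (integral_nonneg fun ω => sq_nonneg _),
    Real.sq_sqrt (integral_nonneg fun ω => sq_nonneg _)]

end TailBounds

/-! ### The squared bias over the two classes. -/

section Bias

variable {m : ℕ} {f g ψ₁ ψ₂ : ℝ → ℝ} {a b d Cψ s B : ℝ}

theorem rpow_sq_add_one_le {ω q : ℝ} (hω : 1 ≤ ω) (hq : 0 ≤ q) :
    (ω ^ 2 + 1) ^ (-q / 2) ≤ ω ^ (-q) := by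
  have hω0 : 0 < ω := by linarith
  calc (ω ^ 2 + 1) ^ (-q / 2) ≤ (ω ^ 2) ^ (-q / 2) :=
        Real.rpow_le_rpow_of_nonpos (by positivity) (by linarith) (by linarith)
    _ = ω ^ (-q) := by
        rw [← Real.rpow_natCast, ← Real.rpow_mul hω0.le]
        congr 1
        push_cast
        ring

theorem abs_tailIntegrand_le (h₁ : IsWeight m a b d Cψ ψ₁) (h₂ : IsWeight m a b d Cψ ψ₂)
    (ha : 0 ≤ a) {ω : ℝ} (hω : 1 ≤ ω) :
    |tailIntegrand m ψ₁ ψ₂ f ω| ≤ 2 * Cψ *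
      (ω ^ (-(((m : ℝ) + 1) * a)) * Real.exp (-d * ω ^ b) * ‖fourier f ω‖) := by
  have hw : ∀ {ψ : ℝ → ℝ}, IsWeight m a b d Cψ ψ →
      |wDeriv m ψ ω| ≤ Cψ * (ω ^ (-(((m : ℝ) + 1) * a)) * Real.exp (-d * ω ^ b)) := fun h => by
    refine (h.bound m le_rfl ω hω).trans ?_
    have := h.const_nonneg
    rw [mul_assoc, mul_comm a]
    gcongr
    exact rpow_sq_add_one_le hω (by positivity)
  have hω0 : 0 < ω := by linarith
  have hC := h₁.const_nonneg
  rw [tailIntegrand]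
  refine (abs_add_le _ _).trans ?_
  rw [abs_mul, abs_mul]
  have e1 := mul_le_mul (hw h₁) (Complex.abs_re_le_norm (fourier f ω)) (abs_nonneg _)
    (by positivity)
  have e2 := mul_le_mul (hw h₂) (Complex.abs_im_le_norm (fourier f ω)) (abs_nonneg _)
    (by positivity)
  linarith

theorem abs_integral_tailIntegrand_le (hf : IsPdf f) (h₁ : IsWeight m a b d Cψ ψ₁)
    (h₂ : IsWeight m a b d Cψ ψ₂) (ha : 0 ≤ a) (hd : 0 ≤ d) {H T : ℝ} (hH : 1 ≤ H) (hT : H ≤ T)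
    {χ : ℝ → ℝ} (hχ : IntervalIntegrable χ volume H T)
    (hle : ∀ ω ∈ Icc H T,
      ω ^ (-(((m : ℝ) + 1) * a)) * Real.exp (-d * ω ^ b) * ‖fourier f ω‖ ≤ χ ω) :
    |∫ ω in H..T, tailIntegrand m ψ₁ ψ₂ f ω| ≤ 2 * Cψ * ∫ ω in H..T, χ ω := by
  have hC := h₁.const_nonneg
  refine (intervalIntegral.abs_integral_le_integral_abs hT).trans ?_
  rw [← intervalIntegral.integral_const_mul]
  refine intervalIntegral.integral_mono_on hT
    (intervalIntegrable_tailIntegrand hf h₁ h₂ ha hd hH hT).abs (hχ.const_mul _) fun ω hω => ?_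
  exact (abs_tailIntegrand_le h₁ h₂ ha (hH.trans hω.1)).trans
    (mul_le_mul_of_nonneg_left (hle ω hω) (by positivity))

/-- Here `‖f*(ω)‖ ≤ B ω^(-s)`, so the tail integral with `p = (m+1)a + s` applies and `1 - p - b =
-A`. For `b = 0`, the condition `A > 0` is precisely its convergence condition. -/
theorem exists_bias_decayBall (h₁ : IsWeight m a b d Cψ ψ₁) (h₂ : IsWeight m a b d Cψ ψ₂)
    (ha : 0 ≤ a) (hb : 0 ≤ b) (hd : 0 ≤ d) (hbd : 0 < b → 0 < d) {A : ℝ}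
    (hA : A = ((m : ℝ) + 1) * a + s + b - 1) (hbA : 0 < b ∨ 0 < A) :
    ∃ D : ℝ, 0 ≤ D ∧ ∀ f ∈ DecayBall s B, IsPdf f → ∀ H T : ℝ, 1 ≤ H → H ≤ T →
      (∫ ω in H..T, tailIntegrand m ψ₁ ψ₂ f ω) ^ 2 ≤
        D * (H ^ (-(2 * A)) * Real.exp (-2 * d * H ^ b)) := by
  obtain ⟨C, hC, hCb⟩ := exists_integral_rpow_mul_exp_le (p := ((m : ℝ) + 1) * a + s) hb hbd
    (hbA.imp_right fun h => by linarith)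
  refine ⟨(2 * Cψ * B * C) ^ 2, sq_nonneg _, fun f hf hpdf H T hH hT => ?_⟩
  have hH0 : 0 < H := by linarith
  have hB : 0 ≤ B := (by positivity : (0 : ℝ) ≤ ‖fourier f 0‖ * (|0| ^ s + 1)).trans (hf 0)
  have hCψ := h₁.const_nonneg
  have hcont := (continuousOn_rpow_mul_exp (-(((m : ℝ) + 1) * a + s)) (-d) (T := T) hb
    hH0).intervalIntegrable_of_Icc (μ := volume) hT
  have h3 := abs_integral_tailIntegrand_le hpdf h₁ h₂ ha hd hH hT (hcont.const_mul B)
    fun ω hω => by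
      have hω0 : 0 < ω := by linarith [hω.1]
      have hfB : ‖fourier f ω‖ ≤ B * ω ^ (-s) := by
        rw [Real.rpow_neg hω0.le, ← div_eq_mul_inv, le_div_iff₀ (by positivity)]
        refine le_trans ?_ (hf ω)
        rw [abs_of_pos hω0]
        exact mul_le_mul_of_nonneg_left (by linarith) (norm_nonneg _)
      rw [neg_add, Real.rpow_add hω0]
      calc _ ≤ ω ^ (-(((m : ℝ) + 1) * a)) * Real.exp (-d * ω ^ b) * (B * ω ^ (-s)) := by gcongr
        _ = _ := by ring
  rw [intervalIntegral.integral_const_mul] at h3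
  have h4 := hCb H T hH hT
  have h5 : |∫ ω in H..T, tailIntegrand m ψ₁ ψ₂ f ω| ≤
      2 * Cψ * B * C * (H ^ (-A) * Real.exp (-d * H ^ b)) := by
    refine h3.trans ?_
    rw [show -A = 1 - (((m : ℝ) + 1) * a + s) - b by rw [hA]; ring]
    calc _ ≤ 2 * Cψ * (B * (C * (H ^ (1 - (((m : ℝ) + 1) * a + s) - b) *
          Real.exp (-d * H ^ b)))) := by gcongr
      _ = _ := by ring
  rw [← sq_abs]
  refine (pow_le_pow_left₀ (abs_nonneg _) h5 2).trans_eq ?_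
  rw [mul_pow, mul_pow (H ^ (-A)), ← Real.rpow_mul_natCast hH0.le, ← Real.exp_nat_mul]
  congr 3
  · push_cast; ring
  · push_cast; ring

/-- Cauchy–Schwarz pairs `‖f*‖ (ω²+1)^(s/2)`, of squared norm at most `B²`, with the weight bound
times `ω^(-s)`. Squaring doubles both `p` and `d`, and `1 - 2p - b = -2A`; this accounts for the
smaller `b`-dependent shift in `A`. -/
theorem exists_bias_sobolevBall (h₁ : IsWeight m a b d Cψ ψ₁) (h₂ : IsWeight m a b d Cψ ψ₂)
    (ha : 0 ≤ a) (hb : 0 ≤ b) (hd : 0 ≤ d) (hbd : 0 < b → 0 < d) (hs : 0 ≤ s) {A : ℝ}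
    (hA : A = ((m : ℝ) + 1) * a + s + (b - 1) / 2) (hbA : 0 < b ∨ 0 < A) :
    ∃ D : ℝ, 0 ≤ D ∧ ∀ f ∈ SobolevBall s B, IsPdf f → ∀ H T : ℝ, 1 ≤ H → H ≤ T →
      (∫ ω in H..T, tailIntegrand m ψ₁ ψ₂ f ω) ^ 2 ≤
        D * (H ^ (-(2 * A)) * Real.exp (-2 * d * H ^ b)) := by
  set p := ((m : ℝ) + 1) * a + s
  obtain ⟨C, hC, hCb⟩ := exists_integral_rpow_mul_exp_le (p := 2 * p) (d := 2 * d) hb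
    (fun h => by have := hbd h; positivity) (hbA.imp_right fun h => by linarith)
  refine ⟨(2 * Cψ) ^ 2 * (C * B ^ 2), by positivity, fun f hf hpdf H T hH hT => ?_⟩
  have hH0 : 0 < H := by linarith
  have hCψ := h₁.const_nonneg
  have hcφ := continuousOn_rpow_mul_exp (-p) (-d) (T := T) hb hH0
  have hcχ : Continuous fun ω : ℝ => ‖fourier f ω‖ * (ω ^ 2 + 1) ^ (s / 2) := by
    have h1 : Continuous fun ω : ℝ => (ω ^ 2 + 1) ^ (s / 2) :=
      Continuous.rpow_const (by fun_prop) fun ω => Or.inl (by positivity)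
    exact (continuous_fourier hpdf).norm.mul h1
  have h3 := abs_integral_tailIntegrand_le hpdf h₁ h₂ ha hd hH hT
    ((hcφ.mul hcχ.continuousOn).intervalIntegrable_of_Icc (μ := volume) hT) fun ω hω => by
      have hω0 : 0 < ω := by linarith [hω.1]
      have h4 : ω ^ s ≤ (ω ^ 2 + 1) ^ (s / 2) := by
        calc ω ^ s = (ω ^ 2) ^ (s / 2) := by
              rw [← Real.rpow_natCast, ← Real.rpow_mul hω0.le]
              congr 1
              push_cast
              ring
          _ ≤ _ := Real.rpow_le_rpow (by positivity) (by linarith) (by positivity)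
      have h5 : ω ^ (-(((m : ℝ) + 1) * a)) = ω ^ (-p) * ω ^ s := by
        rw [← Real.rpow_add hω0]; congr 1; simp only [p]; ring
      rw [h5]
      calc _ ≤ ω ^ (-p) * (ω ^ 2 + 1) ^ (s / 2) * Real.exp (-d * ω ^ b) * ‖fourier f ω‖ := by
            gcongr
        _ = _ := by
            simp only [Pi.mul_apply]
            ring
  have hpos : ∀ ω ∈ Icc H T, 0 ≤ ω ^ (-p) * Real.exp (-d * ω ^ b) := fun ω hω => by
    have : 0 < ω := by linarith [hω.1]
    positivity
  have hcs := integral_mul_sq_le hT hcφ hcχ.continuousOn hpos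
    fun ω _ => by positivity
  have hφ2 : ∫ ω in H..T, (ω ^ (-p) * Real.exp (-d * ω ^ b)) ^ 2 =
      ∫ ω in H..T, ω ^ (-(2 * p)) * Real.exp (-(2 * d) * ω ^ b) := by
    refine intervalIntegral.integral_congr fun ω hω => ?_
    rw [uIcc_of_le hT] at hω
    have hω0 : 0 < ω := by linarith [hω.1]
    rw [mul_pow, ← Real.rpow_mul_natCast hω0.le, ← Real.exp_nat_mul]
    congr 2
    · push_cast; ring
    · push_cast; ring
  have hχ2 : ∫ ω in H..T, (‖fourier f ω‖ * (ω ^ 2 + 1) ^ (s / 2)) ^ 2 ≤ B ^ 2 := by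
    have hi : IntegrableOn (fun ω => (‖fourier f ω‖ * (ω ^ 2 + 1) ^ (s / 2)) ^ 2) (Ioc H T) :=
      (hcχ.pow 2).continuousOn.integrableOn_Icc.mono_set Ioc_subset_Icc_self
    rw [intervalIntegral.integral_of_le hT, ← ENNReal.ofReal_le_ofReal_iff (sq_nonneg B),
      ofReal_integral_eq_lintegral_ofReal hi (.of_forall fun ω => sq_nonneg _)]
    refine le_trans ?_ hf
    refine (setLIntegral_le_lintegral _ _).trans_eq (lintegral_congr fun ω => ?_)
    rw [mul_pow, ← Real.rpow_mul_natCast (by positivity)]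
    congr 3
    push_cast
    ring
  rw [hφ2] at hcs
  have h4 := hCb H T hH hT
  have h6 : 0 ≤ ∫ ω in H..T, (‖fourier f ω‖ * (ω ^ 2 + 1) ^ (s / 2)) ^ 2 :=
    intervalIntegral.integral_nonneg hT fun ω _ => sq_nonneg _
  have h7 := hcs.trans (mul_le_mul h4 hχ2 h6 (by positivity))
  rw [← sq_abs]
  refine (pow_le_pow_left₀ (abs_nonneg _) h3 2).trans ?_
  rw [mul_pow, mul_assoc ((2 * Cψ) ^ 2)]
  refine mul_le_mul_of_nonneg_left (h7.trans_eq ?_) (sq_nonneg _)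
  rw [show -(2 * A) = 1 - 2 * p - b by rw [hA]; ring,
    show -(2 * d) * H ^ b = -2 * d * H ^ b by ring]
  ring

end Bias

/-! ### Domination of the parametric rate. -/

section Rate

variable {m : ℕ} {α β γ a b d A : ℝ}

/-- For `h ≤ 1/2` the variance integral contains the fixed integral over `[1, 2]`. For `h ∈ [1/2,
1]` the bias term is bounded below by compactness, while `n⁻¹ ≤ 1`. -/
theorem exists_inv_le_rate (hb : 0 ≤ b) (hβ : 0 ≤ β) :
    ∃ κ : ℝ, 0 < κ ∧ ∀ (n : ℕ), 1 ≤ n → ∀ h : ℝ, 0 < h → h ≤ 1 →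
      (n : ℝ)⁻¹ ≤ κ * rate m α β γ a b d A n h := by
  have hc := continuous_rate_integrand (α - ((m : ℝ) + 1) * a) (-2 * d) (2 * γ) b β hb hβ
  set ρ : ℝ → ℝ := fun ω => (ω ^ 2 + 1) ^ (α - ((m : ℝ) + 1) * a) *
    Real.exp (-2 * d * ω ^ b + 2 * γ * ω ^ β)
  have hρ : ∀ ω, 0 < ρ ω := fun ω => by positivity
  have hδ : 0 < ∫ ω in (1 : ℝ)..2, ρ ω :=
    intervalIntegral.intervalIntegral_pos_of_pos (hc.intervalIntegrable 1 2) hρ one_lt_two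
  set δ := ∫ ω in (1 : ℝ)..2, ρ ω
  have hcb : ContinuousOn (fun h : ℝ => h ^ (2 * A) * Real.exp (-2 * d * h ^ (-b)))
      (Icc (1 / 2) 1) := by
    have hr : ∀ q : ℝ, ContinuousOn (fun h : ℝ => h ^ q) (Icc (1 / 2) 1) := fun q h hh =>
      (Real.continuousAt_rpow_const h q (Or.inl (by linarith [hh.1]))).continuousWithinAt
    exact (hr _).mul (((hr _).const_smul (-2 * d)).rexp)
  obtain ⟨h₀, hh₀, hmin⟩ := isCompact_Icc.exists_isMinOn
    (⟨1, by norm_num⟩ : (Icc (1 / 2 : ℝ) 1).Nonempty) hcb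
  set ε := h₀ ^ (2 * A) * Real.exp (-2 * d * h₀ ^ (-b))
  have hε : 0 < ε := by
    have : 0 < h₀ := by linarith [hh₀.1]
    positivity
  refine ⟨ε⁻¹ + δ⁻¹, by positivity, fun n hn h hh0 hh1 => ?_⟩
  have hT : 1 ≤ 1 / h := by rwa [le_div_iff₀ hh0, one_mul]
  have hJ : 0 ≤ ∫ ω in (1 : ℝ)..(1 / h), ρ ω :=
    intervalIntegral.integral_nonneg hT fun ω _ => (hρ ω).le
  have hn0 : (0 : ℝ) < (n : ℝ)⁻¹ := by positivity
  have hbias : 0 < h ^ (2 * A) * Real.exp (-2 * d * h ^ (-b)) := by positivity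
  change _ ≤ (ε⁻¹ + δ⁻¹) * (h ^ (2 * A) * Real.exp (-2 * d * h ^ (-b)) +
    (n : ℝ)⁻¹ * ∫ ω in (1 : ℝ)..(1 / h), ρ ω)
  rcases le_total h (1 / 2) with hle | hle
  · have h2 : 2 ≤ 1 / h := by rw [le_div_iff₀ hh0]; linarith
    have h3 : δ ≤ ∫ ω in (1 : ℝ)..(1 / h), ρ ω :=
      intervalIntegral.integral_mono_interval le_rfl one_le_two h2
        (.of_forall fun ω => (hρ ω).le) (hc.intervalIntegrable _ _)
    calc (n : ℝ)⁻¹ = δ⁻¹ * (0 + (n : ℝ)⁻¹ * δ) := by field_simp; simp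
      _ ≤ (ε⁻¹ + δ⁻¹) * _ := by
        gcongr
        linarith [inv_pos.2 hε]
  · have h3 : ε ≤ h ^ (2 * A) * Real.exp (-2 * d * h ^ (-b)) := hmin ⟨hle, hh1⟩
    have h4 : (n : ℝ)⁻¹ ≤ 1 := inv_le_one_of_one_le₀ (by exact_mod_cast hn)
    calc (n : ℝ)⁻¹ ≤ ε⁻¹ * (ε + 0) := by rw [add_zero, inv_mul_cancel₀ hε.ne']; exact h4
      _ ≤ (ε⁻¹ + δ⁻¹) * _ := by
        gcongr
        · linarith [inv_pos.2 hδ]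
        · positivity

end Rate

/-! ### Assembling the risk bound. -/

section Risk

variable {m : ℕ} {g ψ₁ ψ₂ : ℝ → ℝ} {K α β γ a b d A Cψ Cσ C₁ C₂ : ℝ}

/-- The estimation error is controlled by a constant depending on the mixing density only through
its moment, and by the bias. -/
theorem ErrorModel.exists_riskBound (G : ErrorModel m g K) (hA1 : AssumptionA1 g α β γ C₁ C₂)
    (h₁ : IsWeight m a b d Cψ ψ₁) (h₂ : IsWeight m a b d Cψ ψ₂)
    (ha : 0 ≤ a) (hb : 0 ≤ b) (hd : 0 ≤ d) (M D : ℝ) (hD : 0 ≤ D) :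
    ∃ C : ℝ, 0 < C ∧ ∀ f, Admissible m g ψ₁ ψ₂ Cσ f → moment (2 * m) f ≤ M →
      (∀ h : ℝ, 0 < h → h ≤ 1 → (initial m ψ₁ ψ₂ f + boundary m ψ₁ ψ₂ f +
        (-1) ^ m * (∫ ω in (1 : ℝ)..(1 / h), tailIntegrand m ψ₁ ψ₂ f ω) - Phi m ψ₁ ψ₂ f) ^ 2 ≤
          D * (h ^ (2 * A) * Real.exp (-2 * d * h ^ (-b)))) →
      RiskBound.{u} m g ψ₁ ψ₂ f (fun n h => C * rate m α β γ a b d A n h) := by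
  obtain ⟨vF, hvF⟩ := G.exists_meanVar_obsF ψ₁ ψ₂ M
  obtain ⟨κ, hκ, hκb⟩ := exists_inv_le_rate (m := m) (α := α) (β := β) (γ := γ) (a := a) (b := b)
    (d := d) (A := A) hb hA1.β_nonneg
  set v₁ := ((m : ℝ) + 1) * ∑ j ∈ Finset.range (m + 1),
    (m.choose j : ℝ) ^ 2 * (2 * (max Cσ 0 + max Cσ 0))
  set c := (max K 0) * (2 * Real.pi) * (2 * (Cψ / C₁) ^ 2)
  have hc : 0 ≤ c := by
    have := Real.pi_pos
    have := le_max_right K 0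
    positivity
  set V := |2 * (2 * (v₁ + vF))|
  -- `κ V` absorbs the constant variances, `2 c` the Plancherel term (doubled by `MeanVar.add`), `D`
  -- the squared bias; `1` secures positivity. `V` is an absolute value because nothing is known
  -- about the sign of `vF`.
  refine ⟨κ * V + 2 * c + D + 1, by positivity, fun f hf hM hbias n hn h hh0 hh1 => ⟨fun y => ?_,
    fun Ω _ P _ Y hY => ?_⟩⟩
  · have hT : 1 ≤ 1 / h := by rwa [le_div_iff₀ hh0, one_mul]
    refine ⟨fun j hj => ?_, ?_⟩
    · rw [intervalIntegrable_iff_integrableOn_Icc_of_le zero_le_one]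
      exact G.integrableOn_integrand1 hf h₁.measurable h₂.measurable y hj
    · rw [intervalIntegrable_iff_integrableOn_Icc_of_le hT]
      exact G.integrableOn_integrand2 h₁ h₂ ha hd y _
  · have := G.isProbabilityMeasure hf.pdf
    have hZ := ((G.meanVar_obs1 hf h₁.measurable h₂.measurable).add
      (hvF f hf.pdf hf.hasMoment hM)).add
      (G.meanVar_obs2 hA1 hf.pdf hf.hasMoment h₁ h₂ ha hd hb hh0 hh1)
    simp_rw [G.PhiHat_eq hf h₁ h₂ ha hd hh0 hh1]
    refine (hY.lintegral_sq_mean_sub_le hn hZ (G.measurable_obs h₁ h₂ ha hd) _).trans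
      (ENNReal.ofReal_le_ofReal ?_)
    have hr := hκb n hn h hh0 hh1
    have hbi := hbias h hh0 hh1
    change (n : ℝ)⁻¹ * (2 * (2 * (v₁ + vF) + c * _)) + (initial m ψ₁ ψ₂ f + _ + _ - _) ^ 2 ≤ _
    rw [rate] at hr ⊢
    set J := ∫ ω in (1 : ℝ)..(1 / h), (ω ^ 2 + 1) ^ (α - ((m : ℝ) + 1) * a) *
      Real.exp (-2 * d * ω ^ b + 2 * γ * ω ^ β)
    set E := h ^ (2 * A) * Real.exp (-2 * d * h ^ (-b))
    have hE : 0 ≤ E := by positivity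
    have hn0 : (0 : ℝ) < (n : ℝ)⁻¹ := by positivity
    have hJ : 0 ≤ J := by
      refine intervalIntegral.integral_nonneg (by rwa [le_div_iff₀ hh0, one_mul]) fun ω hω => ?_
      positivity
    have hV : 2 * (2 * (v₁ + vF)) ≤ V := le_abs_self _
    have hV0 : 0 ≤ V := abs_nonneg _
    have hnJ : 0 ≤ (n : ℝ)⁻¹ * J := by positivity
    have t1 : (n : ℝ)⁻¹ * (2 * (2 * (v₁ + vF))) ≤ V * (κ * (E + (n : ℝ)⁻¹ * J)) := by
      calc _ ≤ (n : ℝ)⁻¹ * V := by gcongr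
        _ = V * (n : ℝ)⁻¹ := mul_comm _ _
        _ ≤ _ := by gcongr
    have t2 : 0 ≤ c * E := by positivity
    have t3 : 0 ≤ D * ((n : ℝ)⁻¹ * J) := by positivity
    linarith

end Risk

end InvDeconv

namespace InvDeconv

/-- The tail bound at `H = 1/h` is uniform in the upper end, so it passes to the limit defining the
bias; `(1/h)^q = h^(-q)` restores the form of the rate. -/
theorem Admissible.sq_sub_Phi_le {m : ℕ} {f g ψ₁ ψ₂ : ℝ → ℝ} {a b d A Cψ Cσ D h : ℝ}
    (hf : Admissible m g ψ₁ ψ₂ Cσ f) (h₁ : IsWeight m a b d Cψ ψ₁) (h₂ : IsWeight m a b d Cψ ψ₂)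
    (ha : 0 ≤ a) (hd : 0 ≤ d) (hD : 0 ≤ D)
    (htail : ∀ H T : ℝ, 1 ≤ H → H ≤ T → (∫ ω in H..T, tailIntegrand m ψ₁ ψ₂ f ω) ^ 2 ≤
        D * (H ^ (-(2 * A)) * Real.exp (-2 * d * H ^ b))) (hh0 : 0 < h) (hh1 : h ≤ 1) :
    (initial m ψ₁ ψ₂ f + boundary m ψ₁ ψ₂ f +
      (-1) ^ m * (∫ ω in (1 : ℝ)..(1 / h), tailIntegrand m ψ₁ ψ₂ f ω) - Phi m ψ₁ ψ₂ f) ^ 2 ≤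
        D * (h ^ (2 * A) * Real.exp (-2 * d * h ^ (-b))) := by
  have hT : 1 ≤ 1 / h := by rwa [le_div_iff₀ hh0, one_mul]
  have e : ∀ q : ℝ, (1 / h) ^ q = h ^ (-q) := fun q => by
    rw [one_div, Real.inv_rpow hh0.le, Real.rpow_neg hh0.le]
  rw [← neg_neg (2 * A), ← e, ← e]
  refine Real.sq_le (by positivity) |>.2 ?_
  exact abs_le.1 (hf.abs_sub_Phi_le h₁ h₂ ha hd hT fun T hTT =>
    Real.abs_le_sqrt (htail _ _ hT hTT))

end InvDeconv

theorem theorem4 (m : ℕ) (g ψ₁ ψ₂ : ℝ → ℝ)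
    (α β γ Cg₁ Cg₂ Cg τ a b d Cψ Cσ s B : ℝ)
    -- the error density
    (hg : IsPdf g) (hg_bdd : ∃ K : ℝ, ∀ᵐ x ∂volume, g x ≤ K)
    (hg_mom : HasMoment (2 * m) g)
    (hg_real : ∀ ω : ℝ, (fourier g ω).im = 0)
    (hA1 : AssumptionA1 g α β γ Cg₁ Cg₂)
    (hτ : 0 ≤ τ) (hτγ : γ = 0 → τ = 0)
    (hg_deriv : ∀ j ≤ m, ∀ ω : ℝ,
      ‖1 / fourier g ω * iteratedDeriv j (fourier g) ω‖ ≤ Cg * (|ω| + 1) ^ ((j : ℝ) * τ))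
    -- the weights
    (ha : 0 ≤ a) (hb : 0 ≤ b) (hd : 0 ≤ d) (hbd : d = 0 → b = 0)
    (hψ₁ : IsWeight m a b d Cψ ψ₁) (hψ₂ : IsWeight m a b d Cψ ψ₂)
    -- the class of mixing densities and the exponent
    (hs : 0 ≤ s) (F : Set (ℝ → ℝ)) (A : ℝ)
    (hFA : (F = DecayBall s B ∧ A = ((m : ℝ) + 1) * a + s + b - 1) ∨
      (F = SobolevBall s B ∧ A = ((m : ℝ) + 1) * a + s + (b - 1) / 2)) :
    (∀ f ∈ F, Admissible m g ψ₁ ψ₂ Cσ f → ∃ C : ℝ, 0 < C ∧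
      RiskBound.{u} m g ψ₁ ψ₂ f (fun n h => C * rate m α β γ a b d A n h)) ∧
    (0 < b ∨ 0 < A → ∀ M : ℝ, ∃ C : ℝ, 0 < C ∧
      ∀ f ∈ F, Admissible m g ψ₁ ψ₂ Cσ f → moment (2 * m) f ≤ M →
        RiskBound.{u} m g ψ₁ ψ₂ f (fun n h => C * rate m α β γ a b d A n h)) := by
  obtain ⟨K, hK⟩ := hg_bdd
  have G : ErrorModel m g K := ⟨hg, hK, hg_mom, hg_real, fun ω h0 => by
    have h1 := hA1.lower ω
    have h2 : InvDeconv.fourier g ω = 0 := Complex.ext h0 (hg_real ω)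
    rw [h2, norm_zero] at h1
    have hC₁ := hA1.C₁_pos
    exact absurd h1 (not_le.2 (by positivity))⟩
  have hbd' : 0 < b → 0 < d := fun h => hd.lt_of_ne fun h0 => h.ne' (hbd h0.symm)
  have huniform : 0 < b ∨ 0 < A → ∀ M : ℝ, ∃ C : ℝ, 0 < C ∧
      ∀ f ∈ F, Admissible m g ψ₁ ψ₂ Cσ f → moment (2 * m) f ≤ M →
        RiskBound.{u} m g ψ₁ ψ₂ f (fun n h => C * rate m α β γ a b d A n h) := fun hbA M => by
    obtain ⟨D, hD, hDb⟩ : ∃ D : ℝ, 0 ≤ D ∧ ∀ f ∈ F, IsPdf f → ∀ H T : ℝ, 1 ≤ H → H ≤ T →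
        (∫ ω in H..T, tailIntegrand m ψ₁ ψ₂ f ω) ^ 2 ≤
          D * (H ^ (-(2 * A)) * Real.exp (-2 * d * H ^ b)) := by
      rcases hFA with ⟨rfl, hA⟩ | ⟨rfl, hA⟩
      · exact exists_bias_decayBall hψ₁ hψ₂ ha hb hd hbd' hA hbA
      · exact exists_bias_sobolevBall hψ₁ hψ₂ ha hb hd hbd' hs hA hbA
    obtain ⟨C, hC, hCb⟩ := G.exists_riskBound (A := A) (Cσ := Cσ) hA1 hψ₁ hψ₂ ha hb hd M D hD
    exact ⟨C, hC, fun f hfF hf hM => hCb f hf hM fun h hh0 hh1 =>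
      hf.sq_sub_Phi_le hψ₁ hψ₂ ha hd hD (hDb f hfF hf.pdf) hh0 hh1⟩
  refine ⟨fun f hfF hf => ?_, huniform⟩
  -- For a fixed `f` the uniform statement applies with `M` its own moment, unless `b = 0` and `A ≤
  -- 0`.
  by_cases hbA : 0 < b ∨ 0 < A
  · obtain ⟨C, hC, hCb⟩ := huniform hbA (moment (2 * m) f)
    exact ⟨C, hC, hCb f hfF hf le_rfl⟩
  · push Not at hbA
    obtain rfl : b = 0 := le_antisymm hbA.1 hb
    obtain ⟨R, hR⟩ := hf.exists_abs_sub_Phi_le hψ₁ hψ₂ ha hd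
    -- In the remaining case `h^(2A) ≥ 1` and the exponential in the bias term equals `exp(-2d)`, so
    -- `D = R² exp(2d)` turns a bounded bias into the required estimate.
    obtain ⟨C, hC, hCb⟩ := G.exists_riskBound (A := A) (Cσ := Cσ) hA1 hψ₁ hψ₂ ha hb hd
      (moment (2 * m) f) (R ^ 2 * Real.exp (2 * d)) (by positivity)
    refine ⟨C, hC, hCb f hf le_rfl fun h hh0 hh1 => ?_⟩
    have h1 := hR (1 / h) (by rwa [le_div_iff₀ hh0, one_mul])
    have h2 : 1 ≤ h ^ (2 * A) := Real.one_le_rpow_of_pos_of_le_one_of_nonpos hh0 hh1 (by linarith)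
    rw [← sq_abs]
    refine (pow_le_pow_left₀ (abs_nonneg _) h1 2).trans ?_
    have h3 : Real.exp (2 * d) * Real.exp (-2 * d * h ^ (-(0 : ℝ))) = 1 := by
      rw [← Real.exp_add, neg_zero, Real.rpow_zero, Real.exp_eq_one_iff]
      ring
    calc R ^ 2 = R ^ 2 * 1 := (mul_one _).symm
      _ ≤ R ^ 2 * h ^ (2 * A) := by gcongr
      _ = R ^ 2 * h ^ (2 * A) *
            (Real.exp (2 * d) * Real.exp (-2 * d * h ^ (-(0 : ℝ)))) := by rw [h3, mul_one]
      _ = _ := by ring
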